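/- Let $K_\nu$ be a local field: a topological field isomorphic to $\mathbb R$, to $\mathbb C$, or a non-archimedean local field. Let $\lambda$ be a non-trivial continuous unitary additive character of $K_\nu$, let $dy$ be the Haar measure self-dual with respect to $\lambda$, and let $|y|$ be the normalised absolute value, so that $d(uy)=|u|\,dy$. For a Schwartz--Bruhat function $\varphi$ on $K_\nu$ put $$\widetilde\varphi(x)=\int_{K_\nu}\varphi(y)\lambda(-xy)\,dy .$$ Let $A$ be multiplication by $\log|y|$, and let $B$ be its Fourier conjugate, $$B(\varphi)(y)=\int_{K_\nu}\log|x|\,\widetilde\varphi(x)\,\lambda(xy)\,dx .$$ Let $H=A+B$ be the conductor operator and let $K=i[B,A]=i(BA-AB)$ be the commutator operator. By a punctured test function we mean a Schwartz--Bruhat function vanishing identically in a neighbourhood of $0$. On Schwartz--Bruhat functions $\varphi$, both $\varphi$ and $\log|x|\,\widetilde\varphi(x)$ are integrable, and $A$ maps punctured test functions to punctured test functions. Let $\chi$ be a continuous unitary character of $K_\nu^\times$. For every $s$ with $0<\mathrm{Re}(s)<1$ there is a unique complex number $\Gamma(\chi,s)$ (the Tate--Gel'fand--Graev gamma factor) such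 that for all Schwartz--Bruhat $\varphi$ $$\int_{K_\nu} \widetilde\varphi(x)\,\chi(x)|x|^{s-1}\,dx=\Gamma(\chi,s)\int_{K_\nu}\varphi(y)\,\chi(y)^{-1}|y|^{-s}\,dy ,$$ both integrals being absolutely convergent. The function $s\mapsto\Gamma(\chi,s)$ is holomorphic and nowhere zero in the strip $0<\mathrm{Re}(s)<1$, so that $\frac{\partial}{\partial s}\log\Gamma(\chi,s)=\Gamma'(\chi,s)/\Gamma(\chi,s)$ is defined there. The operator $H$ is symmetric, $\int H(\alpha_1)\alpha_2\,dy=\int\alpha_1H(\alpha_2)\,dy$ for all Schwartz--Bruhat $\alpha_1,\alpha_2$, and $K$ is antisymmetric, $\int K(\alpha_1)\alpha_2\,dy=-\int\alpha_1K(\alpha_2)\,dy$ for all punctured test functions $\alpha_1,\alpha_2$, all integrals being absolutely convergent. Accordingly, for a locally integrable function $T$ one sets $\langle H(T),\alpha\rangle=\int T\,H(\alpha)\,dy$ for Schwartz--Bruhat $\alpha$, and $\langle K(T),\alpha\rangle=-\int T\,K(\alpha)\,dy$ for punctured test functions $\alpha$, whenever these integrals converge absolutely. Then for every $s$ with $0<\mathrm{Re}(s)<1$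 these integrals converge absolutely for $T=\chi(y)^{-1}|y|^{-s}$, and $$({\cal S}_H)\qquad H\big(\chi(y)^{-1}|y|^{-s}\big)=\Big(\frac{\partial}{\partial s}\log\Gamma(\chi,s)\Big)\,\chi(y)^{-1}|y|^{-s}$$ as an identity of distributions (tested against all Schwartz--Bruhat functions, hence in particular on the punctured line), and $$({\cal S}_K)\qquad K\big(\chi(y)^{-1}|y|^{-s}\big)=\Big(-i\,\frac{\partial^2}{\partial s^2}\log\Gamma(\chi,s)\Big)\,\chi(y)^{-1}|y|^{-s}$$ as an identity of distributions on the punctured line (tested against all punctured test functions). -/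

import Mathlib

open MeasureTheory

noncomputable section

namespace LocalCommutator

/-- A local field: a topological field isomorphic to `ℝ`, or to `ℂ`, or a non-archimedean local
field (non-discrete, locally compact, topology given by a valuation). -/
def IsLocalField (K : Type*) [Field K] [TopologicalSpace K] : Prop :=
  (∃ e : K ≃+* ℝ, Continuous e ∧ Continuous e.symm) ∨
  (∃ e : K ≃+* ℂ, Continuous e ∧ Continuous e.symm) ∨
  (∃ v : ValuativeRel K, @IsNonarchimedeanLocalField K _ v _)

/-- Schwartz--Bruhat functions: Schwartz functions if the field is `ℝ` or `ℂ`, locally constant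
compactly supported functions if it is non-archimedean. (On a connected non-compact field a
function of the latter kind is zero, so the last alternative adds nothing there.) -/
def IsSchwartzBruhat {K : Type*} [Field K] [TopologicalSpace K] (φ : K → ℂ) : Prop :=
  (∃ e : K ≃+* ℝ, Continuous e ∧ Continuous e.symm ∧
    ∃ f : SchwartzMap ℝ ℂ, ∀ x, φ x = f (e x)) ∨
  (∃ e : K ≃+* ℂ, Continuous e ∧ Continuous e.symm ∧
    ∃ f : SchwartzMap ℂ ℂ, ∀ x, φ x = f (e x)) ∨
  (IsLocallyConstant φ ∧ HasCompactSupport φ)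

/-- Test functions on the punctured line: Schwartz--Bruhat functions vanishing identically in a
neighbourhood of the origin. -/
def IsPuncturedTest {K : Type*} [Field K] [TopologicalSpace K] (φ : K → ℂ) : Prop :=
  IsSchwartzBruhat φ ∧ ∀ᶠ y in nhds (0 : K), φ y = 0

section

variable {K : Type*} [Field K] [TopologicalSpace K] [IsTopologicalRing K] [LocallyCompactSpace K]

open Classical in
/-- The normalised absolute value: `|y|` is the factor by which multiplication by `y` scales
additive Haar measure (so `|z| = z * conj z` on `ℂ`), and `|0| = 0`. -/
def nabs (y : K) : ℝ :=
  if h : y = 0 then 0 else (distribHaarChar K (Units.mk0 y h) : ℝ)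

open Classical in
/-- The function `y ↦ χ(y) |y|^s` on the field; its value at `0` is immaterial and set to `0`. -/
def quasiChar (χ : Kˣ →ₜ* Circle) (s : ℂ) (y : K) : ℂ :=
  if h : y = 0 then 0 else (χ (Units.mk0 y h) : ℂ) * ((nabs y : ℝ) : ℂ) ^ s

variable [MeasurableSpace K]

/-- The Fourier transform `x ↦ ∫ φ(y) λ(-xy) dy`. -/
def fourierTr (lam : AddChar K Circle) (μ : Measure K) (φ : K → ℂ) (x : K) : ℂ :=
  ∫ y, φ y * (lam (-(x * y)) : ℂ) ∂μ

/-- The conjugate Fourier transform `y ↦ ∫ ψ(x) λ(xy) dx`. -/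
def fourierInvTr (lam : AddChar K Circle) (μ : Measure K) (ψ : K → ℂ) (y : K) : ℂ :=
  ∫ x, ψ x * (lam (x * y) : ℂ) ∂μ

/-- The Haar measure `μ` is self-dual for the additive character `λ`: Fourier inversion holds with
`μ` on both sides. -/
def IsSelfDual (lam : AddChar K Circle) (μ : Measure K) : Prop :=
  ∀ φ : K → ℂ, IsSchwartzBruhat φ → ∀ y, fourierInvTr lam μ (fourierTr lam μ φ) y = φ y

/-- `A`: multiplication by `log |y|`. -/
def opA (φ : K → ℂ) (y : K) : ℂ := (Real.log (nabs y) : ℂ) * φ y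

/-- `B`: the Fourier conjugate of `A`, that is, multiplication by `log |x|` on the Fourier side. -/
def opB (lam : AddChar K Circle) (μ : Measure K) (φ : K → ℂ) : K → ℂ :=
  fourierInvTr lam μ (opA (fourierTr lam μ φ))

/-- The conductor operator `H = A + B`. -/
def opH (lam : AddChar K Circle) (μ : Measure K) (φ : K → ℂ) (y : K) : ℂ :=
  opA φ y + opB lam μ φ y

/-- The commutator operator `K = i [B, A] = i (BA - AB)`. -/
def opK (lam : AddChar K Circle) (μ : Measure K) (φ : K → ℂ) (y : K) : ℂ :=
  Complex.I * (opB lam μ (opA φ) y - opA (opB lam μ φ) y)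

/-- `O'` is the transpose of `O` on the class `S` of test functions:
`∫ O(α₁) α₂ = ∫ α₁ O'(α₂)`, with absolutely convergent integrals. Then `O` acts on a distribution
`T` by `⟨O(T), α⟩ = ⟨T, O'(α)⟩`. -/
def HasTranspose (μ : Measure K) (S : (K → ℂ) → Prop) (O O' : (K → ℂ) → (K → ℂ)) : Prop :=
  ∀ α₁ α₂ : K → ℂ, S α₁ → S α₂ →
    Integrable (fun y => O α₁ y * α₂ y) μ ∧ Integrable (fun y => α₁ y * O' α₂ y) μ ∧
    ∫ y, O α₁ y * α₂ y ∂μ = ∫ y, α₁ y * O' α₂ y ∂μ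

/-- The identity of distributions `O(T) = c T` on the class `S` of test functions. Here the
function `T` is regarded as the distribution `α ↦ ∫ T α`, and an operator `O` with transpose `O'`
acts by `⟨O(T), α⟩ = ⟨T, O'(α)⟩`; absolute convergence of all integrals is part of the assertion. -/
def IsDistributionEigenfunction (μ : Measure K) (S : (K → ℂ) → Prop)
    (O' : (K → ℂ) → (K → ℂ)) (T : K → ℂ) (c : ℂ) : Prop :=
  ∀ α : K → ℂ, S α →
    Integrable (fun y => T y * α y) μ ∧ Integrable (fun y => T y * O' α y) μ ∧
    ∫ y, T y * O' α y ∂μ = c * ∫ y, T y * α y ∂μ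

/-- `g` is the constant in `F(χ(x)|x|^(s-1)) = g χ(y)⁻¹ |y|^(-s)`, an identity of distributions
between locally integrable functions (for `0 < Re s < 1`). -/
def IsGammaFactor (lam : AddChar K Circle) (μ : Measure K) (χ : Kˣ →ₜ* Circle) (s g : ℂ) : Prop :=
  ∀ φ : K → ℂ, IsSchwartzBruhat φ →
    Integrable (fun x => fourierTr lam μ φ x * quasiChar χ (s - 1) x) μ ∧
    Integrable (fun y => φ y * quasiChar χ⁻¹ (-s) y) μ ∧
    ∫ x, fourierTr lam μ φ x * quasiChar χ (s - 1) x ∂μ =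
      g * ∫ y, φ y * quasiChar χ⁻¹ (-s) y ∂μ

/-- The Tate--Gel'fand--Graev gamma factor `Γ(χ, s)` for `0 < Re s < 1`. -/
def gammaFactor (lam : AddChar K Circle) (μ : Measure K) (χ : Kˣ →ₜ* Circle) (s : ℂ) : ℂ :=
  Classical.epsilon fun g : ℂ => IsGammaFactor lam μ χ s g

end

/-- The critical strip `0 < Re s < 1`. -/
def criticalStrip : Set ℂ := {s | 0 < s.re ∧ s.re < 1}

end LocalCommutator

end

namespace LocalCommutator

open MeasureTheory Filter Topology
open scoped ENNReal NNReal Pointwise SchwartzMap ContDiff FourierTransform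

set_option linter.unusedSectionVars false

/-! ### The module `nabs` and the quasi-characters -/

section Module

variable {K : Type*} [Field K] [TopologicalSpace K] [IsTopologicalRing K] [LocallyCompactSpace K]

/-! Write Z(χ, s, h) for the integral of h(x) χ(x) |x|^s, so that testing χ⁻¹|y|^(-s) against h
gives Z(χ⁻¹, -s, h), and ∂/∂s of this is -Z(χ⁻¹, -s, Ah). The gamma factor is defined by Z(χ, s-1,
φ̃) = Γ(s) Z(χ⁻¹, -s, φ). Differentiating in s gives Z(χ, s-1, Aφ̃) = Γ'(s) Z(χ⁻¹, -s, φ) - Γ(s)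
Z(χ⁻¹, -s, Aφ). If the functional equation also holds for the function u = Aφ̃, whose inverse
transform is Bφ, the left side is Γ(s) Z(χ⁻¹, -s, Bφ), and division by Γ(s) gives Z(Bφ) = (Γ'/Γ)
Z(φ) - Z(Aφ), the identity for H (`zetaInt_opB`). Differentiating this once more, and adding the
same identity with Aφ in place of φ, cancels everything except Z(BAφ) - Z(ABφ) = (Γ'/Γ)' Z(φ), the
identity for K (`zetaInt_commutator`). The second use needs Aφ to be Schwartz--Bruhat, hence the
punctured line.

The difficulty is that u = Aφ̃ is not Schwartz--Bruhat. Tate's functional equation is therefore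
proved in symmetric form for all pairs with absolutely convergent integrals
(`zetaInt_mul_zetaInt_fourierInvTr`), which extends the relation defining Γ to every u such that u
and its inverse transform are both `IsMellin` (`zetaInt_eq_gammaFactor_mul`). It remains to show
that Bφ, a bounded function, is O(|y|^(-δ)) at infinity for every δ < 1. First differences of log|x|
do not suffice: on ℂ the normalised module is the square of the norm, so they only have size
(|t|/|x|)^(1/2). Second differences do, because log|x+t| + log|x-t| - 2 log|x| = log|1 - t²/x²|
(`exists_norm_fourierInvTr_opA_le`).

All this is done uniformly from the class `LocalAnalysis`, whose inequalities use only the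
subadditivity of √|x| and bounds on first and second differences of test functions. The class, and
the stability of Schwartz--Bruhat functions under the Fourier transform, are then verified
separately for non-archimedean fields and for ℝ and ℂ. -/

lemma nabs_zero : nabs (0 : K) = 0 := by simp [nabs]

lemma nabs_of_ne_zero {x : K} (h : x ≠ 0) :
    nabs x = (distribHaarChar K (Units.mk0 x h) : ℝ) := by simp [nabs, h]

lemma nabs_pos {x : K} (h : x ≠ 0) : 0 < nabs x := by
  rw [nabs_of_ne_zero h]
  exact_mod_cast distribHaarChar_pos

lemma nabs_nonneg (x : K) : 0 ≤ nabs x := by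
  by_cases h : x = 0
  · simp [h, nabs_zero]
  · exact (nabs_pos h).le

lemma nabs_mul (x y : K) : nabs (x * y) = nabs x * nabs y := by
  by_cases hx : x = 0
  · simp [hx, nabs_zero]
  by_cases hy : y = 0
  · simp [hy, nabs_zero]
  rw [nabs_of_ne_zero hx, nabs_of_ne_zero hy, nabs_of_ne_zero (mul_ne_zero hx hy),
    ← NNReal.coe_mul, ← map_mul]
  congr 2
  ext
  simp

lemma nabs_one : nabs (1 : K) = 1 := by
  rw [nabs_of_ne_zero one_ne_zero, Units.mk0_one, map_one, NNReal.coe_one]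

lemma nabs_inv (x : K) : nabs x⁻¹ = (nabs x)⁻¹ := by
  by_cases hx : x = 0
  · simp [hx, nabs_zero]
  refine eq_inv_of_mul_eq_one_left ?_
  rw [← nabs_mul, inv_mul_cancel₀ hx, nabs_one]

lemma nabs_pow (x : K) (n : ℕ) : nabs (x ^ n) = nabs x ^ n := by
  induction n with
  | zero => simp [nabs_one]
  | succ n ih => rw [pow_succ, pow_succ, nabs_mul, ih]

lemma nabs_div (x y : K) : nabs (x / y) = nabs x / nabs y := by
  rw [div_eq_mul_inv, nabs_mul, nabs_inv, div_eq_mul_inv]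

lemma nabs_neg (x : K) : nabs (-x) = nabs x := by
  have h1 : nabs (-1 : K) = 1 := by
    have : nabs (-1 : K) ^ 2 = 1 := by rw [← nabs_pow]; simp [nabs_one]
    exact (pow_eq_one_iff_of_nonneg (nabs_nonneg _) two_ne_zero).1 this
  rw [neg_eq_neg_one_mul, nabs_mul, h1, one_mul]

lemma quasiChar_zero (χ : Kˣ →ₜ* Circle) (s : ℂ) : quasiChar χ s (0 : K) = 0 := by
  simp [quasiChar]

lemma quasiChar_of_ne_zero (χ : Kˣ →ₜ* Circle) (s : ℂ) {x : K} (h : x ≠ 0) :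
    quasiChar χ s x = (χ (Units.mk0 x h) : ℂ) * ((nabs x : ℝ) : ℂ) ^ s := by
  simp [quasiChar, h]

lemma quasiChar_one (χ : Kˣ →ₜ* Circle) (s : ℂ) : quasiChar χ s (1 : K) = 1 := by
  rw [quasiChar_of_ne_zero χ s one_ne_zero]
  simp [nabs_one]

lemma norm_quasiChar (χ : Kˣ →ₜ* Circle) (s : ℂ) {x : K} (h : x ≠ 0) :
    ‖quasiChar χ s x‖ = nabs x ^ s.re := by
  rw [quasiChar_of_ne_zero χ s h, norm_mul, Circle.norm_coe, one_mul,
    Complex.norm_cpow_eq_rpow_re_of_pos (nabs_pos h)]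

lemma norm_quasiChar_le (χ : Kˣ →ₜ* Circle) (s : ℂ) (x : K) :
    ‖quasiChar χ s x‖ ≤ nabs x ^ s.re := by
  by_cases h : x = 0
  · simp only [h, quasiChar_zero, norm_zero]
    exact Real.rpow_nonneg (nabs_nonneg _) _
  · exact (norm_quasiChar χ s h).le

lemma quasiChar_mul (χ : Kˣ →ₜ* Circle) (s : ℂ) (x y : K) :
    quasiChar χ s (x * y) = quasiChar χ s x * quasiChar χ s y := by
  by_cases hx : x = 0
  · simp [hx, quasiChar_zero]
  by_cases hy : y = 0
  · simp [hy, quasiChar_zero]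
  rw [quasiChar_of_ne_zero χ s hx, quasiChar_of_ne_zero χ s hy,
    quasiChar_of_ne_zero χ s (mul_ne_zero hx hy), nabs_mul, Complex.ofReal_mul,
    Complex.mul_cpow_ofReal_nonneg (nabs_nonneg _) (nabs_nonneg _)]
  have : Units.mk0 (x * y) (mul_ne_zero hx hy) = Units.mk0 x hx * Units.mk0 y hy := by ext; simp
  rw [this, map_mul, Circle.coe_mul]
  ring

lemma quasiChar_mul_quasiChar_inv (χ : Kˣ →ₜ* Circle) (s t : ℂ) {x : K} (hx : x ≠ 0) :
    quasiChar χ s x * quasiChar χ⁻¹ t x = ((nabs x : ℝ) : ℂ) ^ (s + t) := by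
  rw [quasiChar_of_ne_zero χ s hx, quasiChar_of_ne_zero χ⁻¹ t hx,
    Complex.cpow_add _ _ (by exact_mod_cast (nabs_pos hx).ne')]
  have : ((χ (Units.mk0 x hx) : Circle) : ℂ) * ((χ⁻¹ (Units.mk0 x hx) : Circle) : ℂ) = 1 := by
    rw [← Circle.coe_mul]
    have : χ (Units.mk0 x hx) * χ⁻¹ (Units.mk0 x hx) = 1 := mul_inv_cancel (χ (Units.mk0 x hx))
    rw [this, Circle.coe_one]
  linear_combination (((nabs x : ℝ) : ℂ) ^ s * ((nabs x : ℝ) : ℂ) ^ t) * this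

end Module

/-- The facts on a local field, its module and its Schwartz--Bruhat functions on which the
functional equation and the decay estimates rest. -/
class LocalAnalysis (K : Type*) [Field K] [TopologicalSpace K] [IsTopologicalRing K]
    [LocallyCompactSpace K] : Prop extends T2Space K, SecondCountableTopology K,
    ContinuousInv₀ K where
  continuous_nabs : Continuous (nabs : K → ℝ)
  sqrt_nabs_add_le (a b : K) : √(nabs (a + b)) ≤ √(nabs a) + √(nabs b)
  exists_nabs_lt_one : ∃ p : K, p ≠ 0 ∧ nabs p < 1
  isCompact_nabs_le_one : IsCompact {x : K | nabs x ≤ 1}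
  continuous_of_isSchwartzBruhat {α : K → ℂ} (hα : IsSchwartzBruhat α) : Continuous α
  isSchwartzBruhat_comp_neg {α : K → ℂ} (hα : IsSchwartzBruhat α) :
    IsSchwartzBruhat fun x => α (-x)
  exists_bound {α : K → ℂ} (hα : IsSchwartzBruhat α) : ∃ C : ℝ, 0 ≤ C ∧
    ∀ t x : K, nabs t ≤ 1 → ‖α x‖ ≤ C * ((1 + nabs x) ^ 2)⁻¹ ∧
      ‖α (x + t) - α x‖ ≤ C * √(nabs t) * ((1 + nabs x) ^ 2)⁻¹ ∧
      ‖α (x + t) - 2 * α x + α (x - t)‖ ≤ C * nabs t * ((1 + nabs x) ^ 2)⁻¹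
  exists_bump {U : Set K} (hU : U ∈ 𝓝 (1 : K)) : ∃ f : K → ℝ, Continuous f ∧ HasCompactSupport f ∧
    (∀ x, 0 ≤ f x) ∧ f 1 ≠ 0 ∧ Function.support f ⊆ U ∧ IsSchwartzBruhat fun x => (f x : ℂ)
  isPuncturedTest_opA {α : K → ℂ} (hα : IsPuncturedTest α) : IsPuncturedTest (opA α)

/-! ### Scaling of Haar measure and integrability of powers of the module -/

section Haar

variable {K : Type*} [Field K] [TopologicalSpace K] [IsTopologicalRing K] [LocallyCompactSpace K]
  [LocalAnalysis K] [MeasurableSpace K] [BorelSpace K] (μ : Measure K) [μ.IsAddHaarMeasure]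

lemma measurable_nabs : Measurable (nabs : K → ℝ) := LocalAnalysis.continuous_nabs.measurable

lemma continuousOn_quasiChar (χ : Kˣ →ₜ* Circle) (s : ℂ) :
    ContinuousOn (quasiChar χ s) ({0}ᶜ : Set K) := by
  rw [continuousOn_iff_continuous_domRestrict]
  have hmk : Continuous fun x : ({0}ᶜ : Set K) => Units.mk0 (x : K) x.2 := by
    rw [Units.continuous_iff]
    refine ⟨continuous_subtype_val, ?_⟩
    have : Continuous fun x : ({0}ᶜ : Set K) => (x : K)⁻¹ :=
      continuous_subtype_val.inv₀ fun x => x.2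
    refine this.congr fun x => ?_
    rw [Units.val_inv_eq_inv_val]
    rfl
  have h1 : Continuous fun x : ({0}ᶜ : Set K) =>
      (χ (Units.mk0 (x : K) x.2) : ℂ) * ((nabs (x : K) : ℝ) : ℂ) ^ s := by
    refine (continuous_subtype_val.comp ((map_continuous χ).comp hmk)).mul ?_
    refine Continuous.cpow ?_ continuous_const fun x => Or.inl ?_
    · exact Complex.continuous_ofReal.comp
        (LocalAnalysis.continuous_nabs.comp continuous_subtype_val)
    · simpa using nabs_pos x.2
  convert h1 using 2 with x
  exact quasiChar_of_ne_zero χ s x.2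

lemma measurable_quasiChar (χ : Kˣ →ₜ* Circle) (s : ℂ) : Measurable (quasiChar χ s : K → ℂ) :=
  measurable_of_continuousOn_compl_singleton 0 (continuousOn_quasiChar χ s)

lemma map_mul_left_eq {y : K} (hy : y ≠ 0) :
    μ.map (fun x => y * x) = ENNReal.ofReal (nabs y)⁻¹ • μ := by
  ext s hs
  rw [Measure.map_apply (measurable_const_mul y) hs, Measure.smul_apply, smul_eq_mul]
  have h := distribHaarChar_mul μ (Units.mk0 y hy)⁻¹ s
  have h2 : (Units.mk0 y hy)⁻¹ • s = (fun x => y * x) ⁻¹' s := by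
    ext x
    rw [Set.mem_inv_smul_set_iff]
    rfl
  rw [← h2, ← h, map_inv, nabs_of_ne_zero hy, ← NNReal.coe_inv, ENNReal.ofReal_coe_nnreal]

lemma measurableEmbedding_mul_left₀ {y : K} (hy : y ≠ 0) : MeasurableEmbedding fun x => y * x :=
  (Homeomorph.mulLeft₀ y hy).measurableEmbedding

lemma lintegral_comp_mul_left {y : K} (hy : y ≠ 0) (f : K → ℝ≥0∞) :
    ∫⁻ x, f (y * x) ∂μ = ENNReal.ofReal (nabs y)⁻¹ * ∫⁻ x, f x ∂μ := by
  rw [← (measurableEmbedding_mul_left₀ hy).lintegral_map, map_mul_left_eq μ hy,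
    lintegral_smul_measure, smul_eq_mul]

lemma integral_comp_mul_left {y : K} (hy : y ≠ 0) (f : K → ℂ) :
    ∫ x, f (y * x) ∂μ = ((nabs y : ℝ) : ℂ)⁻¹ * ∫ x, f x ∂μ := by
  rw [← (measurableEmbedding_mul_left₀ hy).integral_map, map_mul_left_eq μ hy,
    integral_smul_measure, ENNReal.toReal_ofReal (inv_nonneg.2 (nabs_nonneg y)),
    Complex.real_smul, Complex.ofReal_inv]

lemma integral_comp_mul_left_real {y : K} (hy : y ≠ 0) (f : K → ℝ) :
    ∫ x, f (y * x) ∂μ = (nabs y)⁻¹ * ∫ x, f x ∂μ := by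
  rw [← (measurableEmbedding_mul_left₀ hy).integral_map, map_mul_left_eq μ hy,
    integral_smul_measure, ENNReal.toReal_ofReal (inv_nonneg.2 (nabs_nonneg y)), smul_eq_mul]

lemma integrable_comp_mul_left {y : K} (hy : y ≠ 0) {E : Type*} [NormedAddCommGroup E] {f : K → E}
    (hf : Integrable f μ) : Integrable (fun x => f (y * x)) μ := by
  refine ((measurableEmbedding_mul_left₀ hy).integrable_map_iff).1 ?_
  rw [map_mul_left_eq μ hy]
  exact hf.smul_measure ENNReal.ofReal_ne_top

/-- Multiplication by p with |p| < 1 fixes {0} but scales the measure by a factor other than 1, and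
the mass of {0} is finite, so it vanishes. -/
lemma ae_ne_zero : ∀ᵐ x ∂μ, x ≠ (0 : K) := by
  obtain ⟨p, hp, hp1⟩ := LocalAnalysis.exists_nabs_lt_one (K := K)
  have h := congrArg (fun ν : Measure K => ν {0}) (map_mul_left_eq μ hp)
  simp only [Measure.smul_apply, smul_eq_mul] at h
  rw [Measure.map_apply (measurable_const_mul p) (measurableSet_singleton 0)] at h
  have h2 : (fun x => p * x) ⁻¹' {0} = {0} := by ext x; simp [hp]
  rw [h2] at h
  have hfin : μ {(0 : K)} ≠ ⊤ := isCompact_singleton.measure_lt_top.ne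
  have h0 : μ {(0 : K)} = 0 := by
    by_contra h0
    have h3 : ENNReal.ofReal (nabs p)⁻¹ = 1 := by
      have : 1 * μ {(0 : K)} = ENNReal.ofReal (nabs p)⁻¹ * μ {(0 : K)} := by rw [one_mul]; exact h
      exact ((ENNReal.mul_left_inj h0 hfin).1 this).symm
    rw [ENNReal.ofReal_eq_one] at h3
    have := (one_lt_inv₀ (nabs_pos hp)).2 hp1
    linarith
  rw [ae_iff]
  simpa using h0

/-- The preimage is the dilate q^k S; the measure contributes |q|^k and the integrand |q|^(kc).
Summing over k turns integrals over a union of shells into a geometric series. -/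
lemma lintegral_preimage_rpow {q : K} (hq : q ≠ 0) (S : Set K) (hS : MeasurableSet S) (c : ℝ)
    (k : ℕ) :
    ∫⁻ x in (fun x => (q ^ k)⁻¹ * x) ⁻¹' S, ENNReal.ofReal (nabs x ^ c) ∂μ =
      ENNReal.ofReal (nabs q ^ (1 + c)) ^ k * ∫⁻ x in S, ENNReal.ofReal (nabs x ^ c) ∂μ := by
  have hqk : (q ^ k)⁻¹ ≠ 0 := inv_ne_zero (pow_ne_zero _ hq)
  have hn : 0 < nabs q := nabs_pos hq
  rw [← lintegral_indicator hS, ← lintegral_indicator (measurable_const_mul _ hS)]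
  have h : ∀ x, ((fun x => (q ^ k)⁻¹ * x) ⁻¹' S).indicator
      (fun x => ENNReal.ofReal (nabs x ^ c)) x = ENNReal.ofReal ((nabs q ^ k) ^ c) *
        S.indicator (fun x => ENNReal.ofReal (nabs x ^ c)) ((q ^ k)⁻¹ * x) := by
    intro x
    by_cases hx : (q ^ k)⁻¹ * x ∈ S
    · rw [Set.indicator_of_mem hx, Set.indicator_of_mem (show x ∈ _ ⁻¹' S from hx),
        ← ENNReal.ofReal_mul (by positivity), ← Real.mul_rpow (by positivity) (nabs_nonneg _),
        ← nabs_pow, ← nabs_mul, mul_inv_cancel_left₀ (pow_ne_zero _ hq)]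
    · rw [Set.indicator_of_notMem hx, Set.indicator_of_notMem (show x ∉ _ ⁻¹' S from hx), mul_zero]
  simp_rw [h]
  rw [lintegral_const_mul' _ _ ENNReal.ofReal_ne_top, lintegral_comp_mul_left μ hqk
    (fun x => S.indicator (fun x => ENNReal.ofReal (nabs x ^ c)) x), ← mul_assoc,
    ← ENNReal.ofReal_mul (by positivity), nabs_inv, inv_inv, nabs_pow,
    ← ENNReal.ofReal_pow (by positivity)]
  congr 2
  rw [← Real.rpow_natCast, ← Real.rpow_natCast, ← Real.rpow_mul hn.le, ← Real.rpow_mul hn.le,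
    ← Real.rpow_add hn]
  ring_nf

lemma lintegral_iUnion_rpow_lt_top {q : K} (hq : q ≠ 0) {S : Set K} (hS : MeasurableSet S) {c : ℝ}
    (hc : nabs q ^ (1 + c) < 1) (hfin : ∫⁻ x in S, ENNReal.ofReal (nabs x ^ c) ∂μ ≠ ⊤) :
    ∫⁻ x in ⋃ k : ℕ, (fun x => (q ^ k)⁻¹ * x) ⁻¹' S, ENNReal.ofReal (nabs x ^ c) ∂μ < ⊤ := by
  refine (lintegral_iUnion_le _ _).trans_lt ?_
  simp_rw [lintegral_preimage_rpow μ hq S hS c]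
  rw [ENNReal.tsum_mul_right, ENNReal.tsum_geometric]
  refine ENNReal.mul_lt_top ?_ hfin.lt_top
  rw [ENNReal.inv_lt_top, tsub_pos_iff_lt]
  exact ENNReal.ofReal_lt_one.2 hc

variable (K) in
lemma isCompact_nabs_le (r : ℝ) : IsCompact {x : K | nabs x ≤ r} := by
  obtain ⟨p, hp, hp1⟩ := LocalAnalysis.exists_nabs_lt_one (K := K)
  obtain ⟨n, hn⟩ := exists_pow_lt_of_lt_one (show 0 < (|r| + 1)⁻¹ by positivity) hp1
  have hpn : p ^ n ≠ 0 := pow_ne_zero _ hp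
  have h := LocalAnalysis.isCompact_nabs_le_one (K := K).image
    (Homeomorph.mulLeft₀ (p ^ n)⁻¹ (inv_ne_zero hpn)).continuous
  refine h.of_isClosed_subset (isClosed_le LocalAnalysis.continuous_nabs continuous_const) ?_
  intro x hx
  refine ⟨p ^ n * x, ?_, by simp [hpn]⟩
  simp only [Set.mem_ofPred_eq] at hx ⊢
  rw [nabs_mul, nabs_pow]
  calc nabs p ^ n * nabs x ≤ (|r| + 1)⁻¹ * (|r| + 1) := by
        refine mul_le_mul hn.le ?_ (nabs_nonneg _) (by positivity)
        linarith [le_abs_self r]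
    _ = 1 := inv_mul_cancel₀ (by positivity)

lemma lintegral_rpow_ne_top {r R : ℝ} (hr : 0 < r) (c : ℝ) {S : Set K}
    (h : ∀ x ∈ S, r ≤ nabs x ∧ nabs x ≤ R) :
    ∫⁻ x in S, ENNReal.ofReal (nabs x ^ c) ∂μ ≠ ⊤ := by
  have hb : ∀ x ∈ S, ENNReal.ofReal (nabs x ^ c) ≤ ENNReal.ofReal (r ^ c + R ^ c) := by
    intro x hx
    obtain ⟨h1, h2⟩ := h x hx
    refine ENNReal.ofReal_le_ofReal ?_
    have h3 : 0 < R := hr.trans_le (h1.trans h2)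
    have h4 := Real.rpow_pos_of_pos h3 c
    have h5 := Real.rpow_pos_of_pos hr c
    rcases le_total 0 c with hc | hc
    · linarith [Real.rpow_le_rpow (nabs_nonneg x) h2 hc]
    · linarith [Real.rpow_le_rpow_of_nonpos hr h1 hc]
  refine ((setLIntegral_mono measurable_const hb).trans_lt ?_).ne
  rw [setLIntegral_const]
  refine ENNReal.mul_lt_top ENNReal.ofReal_lt_top ?_
  exact (measure_mono fun x hx => (h x hx).2).trans_lt (isCompact_nabs_le K R).measure_lt_top

lemma integrableOn_nabs_rpow_le_one {a : ℝ} (ha : -1 < a) :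
    IntegrableOn (fun x : K => nabs x ^ a) {x | nabs x ≤ 1} μ := by
  obtain ⟨p, hp, hp1⟩ := LocalAnalysis.exists_nabs_lt_one (K := K)
  have hn := nabs_pos hp
  refine ⟨(measurable_nabs.pow_const a).aestronglyMeasurable, ?_⟩
  rw [hasFiniteIntegral_iff_ofReal (ae_of_all _ fun x => Real.rpow_nonneg (nabs_nonneg x) a)]
  have hS : MeasurableSet {x : K | nabs p ≤ nabs x ∧ nabs x ≤ 1} :=
    (measurableSet_le measurable_const measurable_nabs).inter
      (measurableSet_le measurable_nabs measurable_const)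
  have h := lintegral_iUnion_rpow_lt_top μ hp hS (c := a)
    (Real.rpow_lt_one hn.le hp1 (by linarith))
    (lintegral_rpow_ne_top μ hn a fun x hx => hx)
  refine lt_of_le_of_lt (lintegral_mono_set' ?_) h
  filter_upwards [ae_ne_zero μ] with x hx hx1
  -- The shells |p|^(k+1) ≤ |x| ≤ |p|^k cover the punctured unit ball; the origin is a null set.
  obtain ⟨k, hk1, hk2⟩ := exists_nat_pow_near_of_lt_one (nabs_pos hx) hx1 hn hp1
  refine Set.mem_iUnion.2 ⟨k, ?_⟩
  simp only [Set.mem_preimage, Set.mem_ofPred_eq, nabs_mul, nabs_inv, nabs_pow]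
  have hk : 0 < nabs p ^ k := by positivity
  constructor
  · rw [inv_mul_eq_div, le_div_iff₀ hk, ← pow_succ']
    exact hk1.le
  · rw [inv_mul_eq_div, div_le_one hk]
    exact hk2

lemma integrableOn_nabs_rpow_one_le {a : ℝ} (ha : a < -1) :
    IntegrableOn (fun x : K => nabs x ^ a) {x | 1 ≤ nabs x} μ := by
  obtain ⟨p, hp, hp1⟩ := LocalAnalysis.exists_nabs_lt_one (K := K)
  have hn := nabs_pos hp
  have hq : p⁻¹ ≠ 0 := inv_ne_zero hp
  have hq1 : 1 < nabs p⁻¹ := by rw [nabs_inv]; exact (one_lt_inv₀ hn).2 hp1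
  refine ⟨(measurable_nabs.pow_const a).aestronglyMeasurable, ?_⟩
  rw [hasFiniteIntegral_iff_ofReal (ae_of_all _ fun x => Real.rpow_nonneg (nabs_nonneg x) a)]
  have hS : MeasurableSet {x : K | 1 ≤ nabs x ∧ nabs x ≤ nabs p⁻¹} :=
    (measurableSet_le measurable_const measurable_nabs).inter
      (measurableSet_le measurable_nabs measurable_const)
  have h := lintegral_iUnion_rpow_lt_top μ hq hS (c := a)
    (Real.rpow_lt_one_of_one_lt_of_neg hq1 (by linarith))
    (lintegral_rpow_ne_top μ one_pos a fun x hx => hx)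
  refine lt_of_le_of_lt (lintegral_mono_set ?_) h
  intro x hx1
  obtain ⟨k, hk1, hk2⟩ := exists_nat_pow_near hx1 hq1
  refine Set.mem_iUnion.2 ⟨k, ?_⟩
  simp only [Set.mem_preimage, Set.mem_ofPred_eq, nabs_mul, nabs_inv (_ ^ _), nabs_pow]
  have hk : 0 < nabs p⁻¹ ^ k := by positivity
  constructor
  · rw [inv_mul_eq_div, le_div_iff₀ hk, one_mul]
    exact hk1
  · rw [inv_mul_eq_div, div_le_iff₀ hk, ← pow_succ']
    exact hk2.le

lemma integrable_of_bounds {E : Type*} [NormedAddCommGroup E] {h : K → E}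
    (hm : AEStronglyMeasurable h μ) {a b C : ℝ} (ha : -1 < a) (hb : b < -1)
    (h1 : ∀ x, x ≠ 0 → nabs x ≤ 1 → ‖h x‖ ≤ C * nabs x ^ a)
    (h2 : ∀ x, 1 ≤ nabs x → ‖h x‖ ≤ C * nabs x ^ b) : Integrable h μ := by
  have hu : {x : K | nabs x ≤ 1} ∪ {x | 1 ≤ nabs x} = Set.univ := by
    ext x; simpa using le_total _ _
  rw [← integrableOn_univ, ← hu]
  refine IntegrableOn.union ?_ ?_
  · refine Integrable.mono' ((integrableOn_nabs_rpow_le_one μ ha).const_mul C) hm.restrict ?_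
    rw [ae_restrict_iff' (measurableSet_le measurable_nabs measurable_const)]
    filter_upwards [ae_ne_zero μ] with x hx hx1 using h1 x hx hx1
  · refine Integrable.mono' ((integrableOn_nabs_rpow_one_le μ hb).const_mul C) hm.restrict ?_
    rw [ae_restrict_iff' (measurableSet_le measurable_const measurable_nabs)]
    exact ae_of_all _ h2

lemma integrable_rpow_mul_inv_sq {a : ℝ} (ha : -1 < a) (ha1 : a < 1) :
    Integrable (fun x : K => nabs x ^ a * ((1 + nabs x) ^ 2)⁻¹) μ := by
  refine integrable_of_bounds μ (a := a) (b := a - 2) (C := 1)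
    ((measurable_nabs.pow_const a).mul
      (((measurable_const.add measurable_nabs).pow_const 2).inv)).aestronglyMeasurable
    ha (by linarith) (fun x _ _ => ?_) (fun x hx => ?_)
  · have hn := nabs_nonneg x
    rw [Real.norm_of_nonneg (by positivity), one_mul]
    refine mul_le_of_le_one_right (by positivity) (inv_le_one_of_one_le₀ ?_)
    nlinarith
  · have hn : 0 < nabs x := by linarith
    rw [Real.norm_of_nonneg (by positivity), one_mul, Real.rpow_sub hn, div_eq_mul_inv]
    refine mul_le_mul_of_nonneg_left (inv_anti₀ (by positivity) ?_) (by positivity)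
    rw [Real.rpow_two]
    nlinarith

end Haar

/-! ### Zeta integrals, Tate's functional equation, differentiation in s -/

section Zeta

variable {K : Type*} [Field K] [TopologicalSpace K] [IsTopologicalRing K] [LocallyCompactSpace K]
  [LocalAnalysis K] [MeasurableSpace K] [BorelSpace K] (μ : Measure K) [μ.IsAddHaarMeasure]

/-- The local zeta integral `∫ h(x) χ(x) |x|^s dx` with respect to additive Haar measure. -/
noncomputable def zetaInt (χ : Kˣ →ₜ* Circle) (s : ℂ) (h : K → ℂ) : ℂ := ∫ x, h x * quasiChar χ s x ∂μ

/-- Integrability of `|x|^a h(x)`. -/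
def PowIntegrable (a : ℝ) (h : K → ℂ) : Prop :=
  Measurable h ∧ Integrable (fun x => nabs x ^ a * ‖h x‖) μ

variable {μ}

lemma PowIntegrable.integrable_mul_quasiChar {a : ℝ} {h : K → ℂ} (hh : PowIntegrable μ a h)
    (χ : Kˣ →ₜ* Circle) {s : ℂ} (hs : s.re = a) :
    Integrable (fun x => h x * quasiChar χ s x) μ := by
  refine Integrable.mono' hh.2 (hh.1.mul (measurable_quasiChar χ s)).aestronglyMeasurable
    (ae_of_all _ fun x => ?_)
  rw [norm_mul, mul_comm, ← hs]
  exact mul_le_mul_of_nonneg_right (norm_quasiChar_le χ s x) (norm_nonneg _)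

/-- The factor |y| is the Jacobian of k ↦ yk, and it cancels χ(y)|y|^(s-1) · χ⁻¹(y)|y|^(-s) = |y|⁻¹.
-/
lemma mul_quasiChar_comp_mul (χ : Kˣ →ₜ* Circle) (s : ℂ) (u w : K → ℂ) {y : K} (hy : y ≠ 0)
    (k : K) : u (y * k) * w y * quasiChar χ (s - 1) k =
      ((nabs y : ℝ) : ℂ) * (u (y * k) * quasiChar χ (s - 1) (y * k)) *
        (w y * quasiChar χ⁻¹ (-s) y) := by
  have h1 := quasiChar_mul_quasiChar_inv χ (s - 1) (-s) hy
  have h2 : s - 1 + -s = -1 := by ring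
  have h3 : ((nabs y : ℝ) : ℂ) ≠ 0 := by exact_mod_cast (nabs_pos hy).ne'
  rw [h2, Complex.cpow_neg_one] at h1
  have h4 : ((nabs y : ℝ) : ℂ) * (quasiChar χ (s - 1) y * quasiChar χ⁻¹ (-s) y) = 1 := by
    rw [h1, mul_inv_cancel₀ h3]
  rw [quasiChar_mul]
  linear_combination (-u (y * k) * w y * quasiChar χ (s - 1) k) * h4

/-- Substituting x = yk in the first integral makes the product the zeta integral of a
multiplicative convolution. -/
lemma zetaInt_mul_zetaInt (χ : Kˣ →ₜ* Circle) {s : ℂ} {u w : K → ℂ}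
    (hu : PowIntegrable μ (s.re - 1) u) (hw : PowIntegrable μ (-s.re) w) :
    zetaInt μ χ (s - 1) u * zetaInt μ χ⁻¹ (-s) w =
      ∫ k, (∫ y, u (y * k) * w y ∂μ) * quasiChar χ (s - 1) k ∂μ := by
  have hui := hu.integrable_mul_quasiChar χ (s := s - 1) (by simp)
  have hwi := hw.integrable_mul_quasiChar χ⁻¹ (s := -s) (by simp)
  have hprod : Integrable (Function.uncurry fun y k => u (y * k) * w y * quasiChar χ (s - 1) k)
      (μ.prod μ) := by
    have hm : Measurable (Function.uncurry fun y k : K =>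
        u (y * k) * w y * quasiChar χ (s - 1) k) :=
      ((hu.1.comp (measurable_fst.mul measurable_snd)).mul (hw.1.comp measurable_fst)).mul
        ((measurable_quasiChar χ _).comp measurable_snd)
    rw [integrable_prod_iff hm.aestronglyMeasurable]
    constructor
    · filter_upwards [ae_ne_zero μ] with y hy
      simp only [Function.uncurry, mul_quasiChar_comp_mul χ s u w hy]
      exact ((integrable_comp_mul_left μ hy hui).const_mul _).mul_const _
    · refine (hwi.norm.const_mul (∫ x, ‖u x * quasiChar χ (s - 1) x‖ ∂μ)).congr ?_
      filter_upwards [ae_ne_zero μ] with y hy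
      simp only [Function.uncurry, mul_quasiChar_comp_mul χ s u w hy]
      simp_rw [norm_mul (_ * _ : ℂ) (w y * _), norm_mul ((nabs y : ℝ) : ℂ)]
      rw [integral_mul_const, integral_const_mul, integral_comp_mul_left_real μ hy
        (fun x => ‖u x * quasiChar χ (s - 1) x‖), Complex.norm_real,
        Real.norm_of_nonneg (nabs_nonneg y), mul_inv_cancel_left₀ (nabs_pos hy).ne']
  have h1 : zetaInt μ χ (s - 1) u * zetaInt μ χ⁻¹ (-s) w =
      ∫ y, ∫ k, u (y * k) * w y * quasiChar χ (s - 1) k ∂μ ∂μ := by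
    rw [zetaInt, zetaInt, ← integral_const_mul]
    refine integral_congr_ae ?_
    filter_upwards [ae_ne_zero μ] with y hy
    have h3 : ((nabs y : ℝ) : ℂ) ≠ 0 := by exact_mod_cast (nabs_pos hy).ne'
    simp only [mul_quasiChar_comp_mul χ s u w hy]
    rw [integral_mul_const, integral_const_mul, integral_comp_mul_left μ hy
        (fun x => u x * quasiChar χ (s - 1) x), mul_inv_cancel_left₀ h3]
  rw [h1, integral_integral_swap hprod]
  simp_rw [integral_mul_const]

lemma measurable_coe_comp {lam : AddChar K Circle} (hlam : Continuous lam) {X : Type*}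
    [MeasurableSpace X] {f : X → K} (hf : Measurable f) :
    Measurable fun x => (lam (f x) : ℂ) :=
  (continuous_subtype_val.comp hlam).measurable.comp hf

/-- Rescaling the inner variable by k puts both sides in the form |k| ∬ u(ky) v(kx) λ(kxy), which is
symmetric under exchanging (u, y) with (v, x). This symmetry is the whole content of Tate's
functional equation. -/
lemma integral_comp_mul_fourierInvTr {lam : AddChar K Circle} (hlam : Continuous lam)
    {u v : K → ℂ} (hu : Measurable u) (hv : Measurable v) (hui : Integrable u μ)
    (hvi : Integrable v μ) {k : K} (hk : k ≠ 0) :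
    ∫ y, u (y * k) * fourierInvTr lam μ v y ∂μ = ∫ y, v (y * k) * fourierInvTr lam μ u y ∂μ := by
  have key : ∀ u v : K → ℂ, ∫ y, u (y * k) * fourierInvTr lam μ v y ∂μ =
      ((nabs k : ℝ) : ℂ) * ∫ y, ∫ x, u (k * y) * v (k * x) * (lam (k * x * y) : ℂ) ∂μ ∂μ := by
    intro u v
    rw [← integral_const_mul]
    refine integral_congr_ae (ae_of_all _ fun y => ?_)
    have h3 : ((nabs k : ℝ) : ℂ) ≠ 0 := by exact_mod_cast (nabs_pos hk).ne'
    simp only [fourierInvTr, mul_assoc (u _)]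
    rw [integral_const_mul, integral_comp_mul_left μ hk (fun x => v x * (lam (x * y) : ℂ)),
      mul_comm y k]
    field_simp
  rw [key, key, integral_integral_swap]
  · congr 2
    ext x
    congr 1
    ext y
    rw [mul_right_comm k y x]
    ring
  · have h := (integrable_comp_mul_left μ hk hui).mul_prod (integrable_comp_mul_left μ hk hvi)
    refine Integrable.mono h ?_ (ae_of_all _ fun z => ?_)
    · refine Measurable.aestronglyMeasurable ?_
      exact ((hu.comp (measurable_const.mul measurable_fst)).mul
        (hv.comp (measurable_const.mul measurable_snd))).mul
        (measurable_coe_comp hlam ((measurable_const.mul measurable_snd).mul measurable_fst))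
    · simp only [Function.uncurry]
      rw [norm_mul (_ * _), Circle.norm_coe, mul_one]

/-- Tate's local functional equation, in symmetric form. -/
theorem zetaInt_mul_zetaInt_fourierInvTr {lam : AddChar K Circle} (hlam : Continuous lam)
    (χ : Kˣ →ₜ* Circle) {s : ℂ} {u v : K → ℂ} (hui : Integrable u μ) (hvi : Integrable v μ)
    (hu : PowIntegrable μ (s.re - 1) u) (hv : PowIntegrable μ (s.re - 1) v)
    (hu' : PowIntegrable μ (-s.re) (fourierInvTr lam μ u))
    (hv' : PowIntegrable μ (-s.re) (fourierInvTr lam μ v)) :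
    zetaInt μ χ (s - 1) u * zetaInt μ χ⁻¹ (-s) (fourierInvTr lam μ v) =
      zetaInt μ χ (s - 1) v * zetaInt μ χ⁻¹ (-s) (fourierInvTr lam μ u) := by
  rw [zetaInt_mul_zetaInt χ hu hv', zetaInt_mul_zetaInt χ hv hu']
  refine integral_congr_ae ?_
  filter_upwards [ae_ne_zero μ] with k hk
  rw [integral_comp_mul_fourierInvTr hlam hu.1 hv.1 hui hvi hk]

variable (μ) in
/-- Functions whose zeta integrals converge absolutely in the critical strip. -/
def IsMellin (h : K → ℂ) : Prop := ∀ σ : ℝ, 0 < σ → σ < 1 → PowIntegrable μ (-σ) h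

lemma abs_log_le_rpow_add {n ε : ℝ} (hn : 0 < n) (hε : 0 < ε) :
    |Real.log n| ≤ (n ^ ε + n ^ (-ε)) / ε := by
  have h1 := Real.log_le_rpow_div hn.le hε
  have h2 := Real.log_le_rpow_div (inv_pos.2 hn).le hε
  rw [Real.log_inv, Real.inv_rpow hn.le, ← Real.rpow_neg hn.le] at h2
  have h3 := Real.rpow_pos_of_pos hn ε
  have h4 := Real.rpow_pos_of_pos hn (-ε)
  rw [add_div]
  have h5 : 0 < n ^ ε / ε := by positivity
  have h6 : 0 < n ^ (-ε) / ε := by positivity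
  rw [abs_le]
  constructor <;> linarith

lemma rpow_le_add_rpow {n a b c : ℝ} (hn : 0 < n) (hab : a ≤ b) (hbc : b ≤ c) :
    n ^ b ≤ n ^ a + n ^ c := by
  have h1 := Real.rpow_pos_of_pos hn a
  have h2 := Real.rpow_pos_of_pos hn c
  rcases le_total n 1 with h | h
  · linarith [Real.rpow_le_rpow_of_exponent_ge hn h hab]
  · linarith [Real.rpow_le_rpow_of_exponent_le h hbc]

lemma measurable_opA {h : K → ℂ} (hh : Measurable h) : Measurable (opA h) :=
  (Complex.measurable_ofReal.comp (Real.measurable_log.comp measurable_nabs)).mul hh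

lemma norm_opA (h : K → ℂ) (x : K) : ‖opA h x‖ = |Real.log (nabs x)| * ‖h x‖ := by
  rw [opA, norm_mul, Complex.norm_real, Real.norm_eq_abs]

lemma powIntegrable_opA {h : K → ℂ} {a ε : ℝ} (hε : 0 < ε) (h1 : PowIntegrable μ (a + ε) h)
    (h2 : PowIntegrable μ (a - ε) h) : PowIntegrable μ a (opA h) := by
  refine ⟨measurable_opA h1.1, ?_⟩
  refine Integrable.mono' ((h1.2.add h2.2).div_const ε)
    ((measurable_nabs.pow_const a).mul (measurable_opA h1.1).norm).aestronglyMeasurable ?_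
  filter_upwards [ae_ne_zero μ] with x hx
  have hn := nabs_pos hx
  rw [norm_mul, norm_norm, norm_opA, Real.norm_of_nonneg (by positivity)]
  calc nabs x ^ a * (|Real.log (nabs x)| * ‖h x‖)
      ≤ nabs x ^ a * ((nabs x ^ ε + nabs x ^ (-ε)) / ε * ‖h x‖) := by
        gcongr
        exact abs_log_le_rpow_add hn hε
    _ = _ := by
        simp only [Pi.add_apply]
        rw [Real.rpow_add hn, sub_eq_add_neg, Real.rpow_add hn]
        ring

/-- The strip is open, so the logarithm can be absorbed into |x|^ε + |x|^(-ε) with ε half the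
distance to the edges. -/
lemma IsMellin.mul_log {h : K → ℂ} (hh : IsMellin μ h) : IsMellin μ (opA h) := by
  intro σ h0 h1
  have hε : 0 < min σ (1 - σ) / 2 := by
    have : 0 < min σ (1 - σ) := lt_min h0 (by linarith)
    linarith
  have hl := min_le_left σ (1 - σ)
  have hr := min_le_right σ (1 - σ)
  refine powIntegrable_opA hε ?_ ?_
  · convert hh (σ - min σ (1 - σ) / 2) (by linarith) (by linarith) using 1
    ring
  · convert hh (σ + min σ (1 - σ) / 2) (by linarith) (by linarith) using 1
    ring

lemma hasDerivAt_quasiChar_neg (χ : Kˣ →ₜ* Circle) (s : ℂ) {x : K} (hx : x ≠ 0) :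
    HasDerivAt (fun s => quasiChar χ (-s) x)
      (-((Real.log (nabs x) : ℂ) * quasiChar χ (-s) x)) s := by
  simp only [quasiChar_of_ne_zero χ _ hx]
  have hn : ((nabs x : ℝ) : ℂ) ≠ 0 := by exact_mod_cast (nabs_pos hx).ne'
  have h := ((hasDerivAt_neg s).const_cpow (c := ((nabs x : ℝ) : ℂ)) (Or.inl hn)).const_mul
    (χ (Units.mk0 x hx) : ℂ)
  refine h.congr_deriv ?_
  rw [← Complex.ofReal_log (nabs_nonneg x)]
  ring

lemma IsMellin.hasDerivAt_zetaInt {h : K → ℂ} (hh : IsMellin μ h) (χ : Kˣ →ₜ* Circle) {s : ℂ}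
    (hs : s ∈ criticalStrip) :
    HasDerivAt (fun s => zetaInt μ χ (-s) h) (-zetaInt μ χ (-s) (opA h)) s := by
  obtain ⟨h0, h1⟩ := hs
  set ε : ℝ := min s.re (1 - s.re) / 2 with hεdef
  have hε : 0 < ε := by
    have : 0 < min s.re (1 - s.re) := lt_min h0 (by linarith)
    linarith
  have hl := min_le_left s.re (1 - s.re)
  have hr := min_le_right s.re (1 - s.re)
  have hA := hh.mul_log
  have hb1 := hA (s.re - ε) (by linarith) (by linarith)
  have hb1' := (hh s.re h0 h1).1
  have hb2 := hA (s.re + ε) (by linarith) (by linarith)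
  have key := hasDerivAt_integral_of_dominated_loc_of_deriv_le (μ := μ)
    (F := fun s x => h x * quasiChar χ (-s) x)
    (F' := fun s x => -(opA h x * quasiChar χ (-s) x))
    (x₀ := s) (s := Metric.ball s ε)
    -- For z in the ball, -Re z lies between the two exponents, so |x|^(-Re z) is at most the sum of
    -- the two powers.
    (bound := fun x => nabs x ^ (-(s.re - ε)) * ‖opA h x‖ +
      nabs x ^ (-(s.re + ε)) * ‖opA h x‖)
    (Metric.ball_mem_nhds s hε)
    (Eventually.of_forall fun z =>
      (hb1'.mul (measurable_quasiChar χ (-z))).aestronglyMeasurable)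
    ((hh s.re h0 h1).integrable_mul_quasiChar χ (by simp))
    (hb1.1.mul (measurable_quasiChar χ (-s))).neg.aestronglyMeasurable ?_
    (hb1.2.add hb2.2) ?_
  · have := key.2
    rw [integral_neg] at this
    exact this
  · filter_upwards [ae_ne_zero μ] with x hx z hz
    have hz' : |z.re - s.re| < ε := by
      refine lt_of_le_of_lt ?_ (mem_ball_iff_norm.1 hz)
      rw [← Complex.sub_re]
      exact Complex.abs_re_le_norm _
    rw [abs_lt] at hz'
    rw [norm_neg, norm_mul, norm_quasiChar χ _ hx, mul_comm, ← add_mul]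
    refine mul_le_mul_of_nonneg_right ?_ (norm_nonneg _)
    rw [add_comm]
    refine rpow_le_add_rpow (nabs_pos hx) ?_ ?_ <;> rw [Complex.neg_re] <;> linarith
  · filter_upwards [ae_ne_zero μ] with x hx z _
    refine ((hasDerivAt_quasiChar_neg χ z hx).const_mul (h x)).congr_deriv ?_
    rw [opA]
    ring

end Zeta

/-! ### Decay of the Fourier transform of log|x| ψ(x) -/

lemma log_one_add_le_rpow_div {z η : ℝ} (hz : 0 ≤ z) (hη : 0 < η) (hη1 : η ≤ 1) :
    Real.log (1 + z) ≤ z ^ η / η := by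
  rw [le_div_iff₀ hη, mul_comm, ← Real.log_rpow (by linarith)]
  have h1 : (1 + z) ^ η ≤ 1 + z ^ η := by
    simpa using Real.rpow_add_le_add_rpow zero_le_one hz hη.le hη1
  have h2 : 0 ≤ z ^ η := Real.rpow_nonneg hz η
  calc Real.log ((1 + z) ^ η) ≤ Real.log (1 + z ^ η) :=
        Real.log_le_log (Real.rpow_pos_of_pos (by linarith) _) h1
    _ ≤ z ^ η := by
        have := Real.log_le_sub_one_of_pos (show 0 < 1 + z ^ η by linarith)
        linarith

section Decay

variable {K : Type*} [Field K] [TopologicalSpace K] [IsTopologicalRing K] [LocallyCompactSpace K]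
  [LocalAnalysis K]

/-- Subadditivity of √|x| gives √|a| ≤ √|b| (1 + z) with z² = |a-b|/|b|; take logarithms and use
log(1+z) ≤ z^η/η. -/
lemma log_nabs_sub_le {a b : K} (ha : a ≠ 0) (hb : b ≠ 0) {η : ℝ} (hη : 0 < η) (hη1 : η ≤ 1) :
    Real.log (nabs a) - Real.log (nabs b) ≤ 2 / η * (nabs (a - b) / nabs b) ^ (η / 2) := by
  have hna := nabs_pos ha
  have hnb := nabs_pos hb
  set z := √(nabs (a - b) / nabs b) with hz
  have hz0 : 0 ≤ z := Real.sqrt_nonneg _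
  have h1 : √(nabs a) ≤ √(nabs b) * (1 + z) := by
    have h := LocalAnalysis.sqrt_nabs_add_le b (a - b)
    rw [add_sub_cancel] at h
    rwa [hz, Real.sqrt_div (nabs_nonneg _), mul_add, mul_one,
      mul_div_cancel₀ _ (Real.sqrt_pos.2 hnb).ne']
  have h2 := Real.log_le_log (Real.sqrt_pos.2 hna) h1
  rw [Real.log_mul (Real.sqrt_pos.2 hnb).ne' (by linarith), Real.log_sqrt hna.le,
    Real.log_sqrt hnb.le] at h2
  have h3 := log_one_add_le_rpow_div hz0 hη hη1
  have h4 : z ^ η = (nabs (a - b) / nabs b) ^ (η / 2) := by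
    rw [hz, Real.sqrt_eq_rpow, ← Real.rpow_mul (div_nonneg (nabs_nonneg _) hnb.le)]
    ring_nf
  rw [← h4]
  calc _ ≤ 2 * Real.log (1 + z) := by linarith
    _ ≤ 2 * (z ^ η / η) := by linarith
    _ = _ := by ring

/-- The weight `|x|^(-δ) + |x|^(-1/2) + |x|^(1/2)`. -/
noncomputable def logWeight (δ : ℝ) (x : K) : ℝ :=
  nabs x ^ (-δ) + nabs x ^ (-(1 / 2) : ℝ) + nabs x ^ (1 / 2 : ℝ)

lemma logWeight_nonneg (δ : ℝ) (x : K) : 0 ≤ logWeight δ x := by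
  have := nabs_nonneg x
  unfold logWeight
  positivity

lemma rpow_neg_le_logWeight (δ : ℝ) (x : K) : nabs x ^ (-δ) ≤ logWeight δ x := by
  have := nabs_nonneg x
  have h1 : 0 ≤ nabs x ^ (-(1 / 2) : ℝ) := by positivity
  have h2 : 0 ≤ nabs x ^ (1 / 2 : ℝ) := by positivity
  unfold logWeight
  linarith

lemma rpow_neg_half_le_logWeight (δ : ℝ) (x : K) : nabs x ^ (-(1 / 2) : ℝ) ≤ logWeight δ x := by
  have := nabs_nonneg x
  have h1 : 0 ≤ nabs x ^ (-δ) := by positivity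
  have h2 : 0 ≤ nabs x ^ (1 / 2 : ℝ) := by positivity
  unfold logWeight
  linarith

lemma abs_log_nabs_le_logWeight (δ : ℝ) {x : K} (hx : x ≠ 0) :
    |Real.log (nabs x)| ≤ 2 * logWeight δ x := by
  have := nabs_nonneg x
  have h1 : 0 ≤ nabs x ^ (-δ) := by positivity
  have h := abs_log_le_rpow_add (nabs_pos hx) (ε := 1 / 2) (by norm_num)
  unfold logWeight
  linarith

lemma abs_log_nabs_add_sub_le (δ : ℝ) {x t : K} (hx : x ≠ 0) (hxt : x + t ≠ 0) :
    |Real.log (nabs (x + t)) - Real.log (nabs x)| ≤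
      2 * √(nabs t) * (logWeight δ x + logWeight δ (x + t)) := by
  have h1 := log_nabs_sub_le hxt hx one_pos le_rfl
  have h2 := log_nabs_sub_le hx hxt one_pos le_rfl
  have h3 : ∀ a : K, a ≠ 0 → 2 / 1 * (nabs t / nabs a) ^ (1 / 2 : ℝ) ≤
      2 * √(nabs t) * logWeight δ a := by
    intro a ha
    have := rpow_neg_half_le_logWeight δ a
    rw [div_one, Real.div_rpow (nabs_nonneg _) (nabs_nonneg _), div_eq_mul_inv,
      ← Real.rpow_neg (nabs_nonneg _), ← Real.sqrt_eq_rpow, ← mul_assoc]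
    gcongr
  rw [add_sub_cancel_left] at h1
  rw [show x - (x + t) = -t by ring, nabs_neg] at h2
  have h4 := h1.trans (h3 x hx)
  have h5 := h2.trans (h3 _ hxt)
  have h6 : 0 ≤ 2 * √(nabs t) * logWeight δ x :=
    mul_nonneg (by positivity) (logWeight_nonneg δ x)
  have h7 : 0 ≤ 2 * √(nabs t) * logWeight δ (x + t) :=
    mul_nonneg (by positivity) (logWeight_nonneg δ _)
  rw [abs_le, mul_add]
  constructor <;> linarith

/-- The second difference is the single difference log|x² - t²| - log|x²|. The two arguments differ
by t², so the previous bound gives |t|^δ where a first difference gives |t|^(δ/2). -/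
lemma abs_log_nabs_second_diff_le {δ : ℝ} (hδ : 0 < δ) (hδ1 : δ ≤ 1) {x t : K} (hx : x ≠ 0)
    (hxt : x + t ≠ 0) (hxt' : x - t ≠ 0) :
    |Real.log (nabs (x + t)) - 2 * Real.log (nabs x) + Real.log (nabs (x - t))| ≤
      2 / δ * nabs t ^ δ * (logWeight δ x + logWeight δ (x + t) + logWeight δ (x - t)) := by
  have hxx : x * x ≠ 0 := mul_ne_zero hx hx
  have hpm : (x + t) * (x - t) ≠ 0 := mul_ne_zero hxt hxt'
  have hn := nabs_pos hx
  have hp := nabs_pos hxt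
  have hm := nabs_pos hxt'
  have h1 := log_nabs_sub_le hpm hxx hδ hδ1
  have h2 := log_nabs_sub_le hxx hpm hδ hδ1
  have e : Real.log (nabs (x + t)) - 2 * Real.log (nabs x) + Real.log (nabs (x - t)) =
      Real.log (nabs ((x + t) * (x - t))) - Real.log (nabs (x * x)) := by
    rw [nabs_mul, nabs_mul, Real.log_mul hp.ne' hm.ne', Real.log_mul hn.ne' hn.ne']
    ring
  have h3 : ∀ a b : K, a ≠ 0 → b ≠ 0 → 2 / δ * (nabs (t * t) / nabs (a * b)) ^ (δ / 2) ≤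
      2 / δ * nabs t ^ δ * (nabs a ^ (-(δ / 2)) * nabs b ^ (-(δ / 2))) := by
    intro a b ha hb
    have h0 := nabs_nonneg a
    have h0' := nabs_nonneg b
    have h0'' := nabs_nonneg t
    rw [nabs_mul, nabs_mul, Real.div_rpow (by positivity) (by positivity),
      Real.mul_rpow (by positivity) (by positivity), Real.mul_rpow (by positivity) (by positivity),
      Real.rpow_neg (by positivity), Real.rpow_neg (by positivity), ← mul_inv,
      div_eq_mul_inv (nabs t ^ (δ / 2) * nabs t ^ (δ / 2)), mul_assoc (2 / δ)]
    by_cases ht : t = 0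
    · simp [ht, nabs_zero, Real.zero_rpow hδ.ne', Real.zero_rpow (half_pos hδ).ne']
    · rw [← Real.rpow_add (nabs_pos ht), add_halves]
  have h4 : ∀ a b : K, nabs a ^ (-(δ / 2)) * nabs b ^ (-(δ / 2)) ≤
      logWeight δ a + logWeight δ b := by
    intro a b
    have hsq : ∀ c : K, nabs c ^ (-(δ / 2)) * nabs c ^ (-(δ / 2)) ≤ logWeight δ c := by
      intro c
      refine le_trans (le_of_eq ?_) (rpow_neg_le_logWeight δ c)
      rw [← sq, ← Real.rpow_natCast, ← Real.rpow_mul (nabs_nonneg c)]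
      congr 1
      push_cast
      ring
    have := two_mul_le_add_sq (nabs a ^ (-(δ / 2))) (nabs b ^ (-(δ / 2)))
    nlinarith [hsq a, hsq b, logWeight_nonneg δ a, logWeight_nonneg δ b]
  have h5 : nabs x ^ (-(δ / 2)) * nabs x ^ (-(δ / 2)) ≤ logWeight δ x := by
    have := h4 x x
    have h5 := rpow_neg_le_logWeight δ x
    rwa [← Real.rpow_add hn, show -(δ / 2) + -(δ / 2) = -δ by ring]
  have ht0 := nabs_nonneg t
  have hc : 0 ≤ 2 / δ * nabs t ^ δ := by positivity
  rw [show (x + t) * (x - t) - x * x = -(t * t) by ring, nabs_neg] at h1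
  rw [show x * x - (x + t) * (x - t) = t * t by ring] at h2
  have h6 := h1.trans ((h3 x x hx hx).trans (mul_le_mul_of_nonneg_left h5 hc))
  have h7 := h2.trans ((h3 _ _ hxt hxt').trans
    (mul_le_mul_of_nonneg_left (h4 (x + t) (x - t)) hc))
  have g0 := mul_nonneg hc (logWeight_nonneg δ x)
  have g1 := mul_nonneg hc (logWeight_nonneg δ (x + t))
  have g2 := mul_nonneg hc (logWeight_nonneg δ (x - t))
  rw [e, abs_le, mul_add, mul_add]
  rw [mul_add] at h7
  constructor <;> linarith

/-- A discrete Leibniz rule. The second difference of the logarithm contributes 2/δ; the two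
products of first differences, each √|t| · √|t|, and the second difference of ψ contribute 2 each,
using |t| ≤ |t|^δ for |t| ≤ 1. -/
lemma norm_opA_second_diff_le {ψ : K → ℂ} {C : ℝ} (hC : 0 ≤ C) {t x : K}
    (hψ : ‖ψ x‖ ≤ C * ((1 + nabs x) ^ 2)⁻¹)
    (hψp : ‖ψ (x + t) - ψ x‖ ≤ C * √(nabs t) * ((1 + nabs x) ^ 2)⁻¹)
    (hψm : ‖ψ (x - t) - ψ x‖ ≤ C * √(nabs t) * ((1 + nabs x) ^ 2)⁻¹)
    (hψ2 : ‖ψ (x + t) - 2 * ψ x + ψ (x - t)‖ ≤ C * nabs t * ((1 + nabs x) ^ 2)⁻¹)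
    (ht : nabs t ≤ 1) {δ : ℝ} (hδ : 0 < δ) (hδ1 : δ ≤ 1) (hx : x ≠ 0) (hxt : x + t ≠ 0)
    (hxt' : x - t ≠ 0) :
    ‖opA ψ (x + t) - 2 * opA ψ x + opA ψ (x - t)‖ ≤ C * (2 / δ + 6) * nabs t ^ δ *
      (((1 + nabs x) ^ 2)⁻¹ * (logWeight δ x + logWeight δ (x + t) + logWeight δ (x - t))) := by
  set w := ((1 + nabs x) ^ 2)⁻¹ with hw
  have hw0 : 0 ≤ w := by positivity
  set g := logWeight δ x
  set gp := logWeight δ (x + t)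
  set gm := logWeight δ (x - t)
  have hg : 0 ≤ g := logWeight_nonneg δ x
  have hgp : 0 ≤ gp := logWeight_nonneg δ _
  have hgm : 0 ≤ gm := logWeight_nonneg δ _
  set G := g + gp + gm with hG
  have hG0 : 0 ≤ G := by positivity
  have ht0 := nabs_nonneg t
  have hnt : nabs t ≤ nabs t ^ δ := by
    rcases ht0.eq_or_lt with h | h
    · rw [← h, Real.zero_rpow hδ.ne']
    · simpa using Real.rpow_le_rpow_of_exponent_ge h ht hδ1
  have l2 := abs_log_nabs_second_diff_le hδ hδ1 hx hxt hxt'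
  have lp := abs_log_nabs_add_sub_le δ hx hxt
  have lm := abs_log_nabs_add_sub_le δ (t := -t) hx (by rwa [← sub_eq_add_neg])
  rw [nabs_neg, ← sub_eq_add_neg] at lm
  have l0 := abs_log_nabs_le_logWeight δ hx
  set a := Real.log (nabs x)
  set ap := Real.log (nabs (x + t))
  set am := Real.log (nabs (x - t))
  change |ap - 2 * a + am| ≤ 2 / δ * nabs t ^ δ * G at l2
  change |ap - a| ≤ 2 * √(nabs t) * (g + gp) at lp
  change |am - a| ≤ 2 * √(nabs t) * (g + gm) at lm
  change |a| ≤ 2 * g at l0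
  have e : opA ψ (x + t) - 2 * opA ψ x + opA ψ (x - t) =
      ((ap - 2 * a + am : ℝ) : ℂ) * ψ x + ((ap - a : ℝ) : ℂ) * (ψ (x + t) - ψ x) +
      ((am - a : ℝ) : ℂ) * (ψ (x - t) - ψ x) + (a : ℂ) * (ψ (x + t) - 2 * ψ x + ψ (x - t)) := by
    simp only [opA, ap, am, a]
    push_cast
    ring
  have hs : √(nabs t) * √(nabs t) = nabs t := Real.mul_self_sqrt ht0
  have b1 : ‖((ap - 2 * a + am : ℝ) : ℂ) * ψ x‖ ≤ (2 / δ * nabs t ^ δ * G) * (C * w) := by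
    rw [norm_mul, Complex.norm_real]
    exact mul_le_mul l2 hψ (norm_nonneg _) (by positivity)
  have b2 : ‖((ap - a : ℝ) : ℂ) * (ψ (x + t) - ψ x)‖ ≤ 2 * nabs t ^ δ * G * (C * w) := by
    rw [norm_mul, Complex.norm_real]
    refine (mul_le_mul lp hψp (norm_nonneg _) (by positivity)).trans ?_
    calc _ = 2 * (√(nabs t) * √(nabs t)) * (g + gp) * (C * w) := by ring
      _ = 2 * nabs t * (g + gp) * (C * w) := by rw [hs]
      _ ≤ _ := by gcongr; linarith
  have b3 : ‖((am - a : ℝ) : ℂ) * (ψ (x - t) - ψ x)‖ ≤ 2 * nabs t ^ δ * G * (C * w) := by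
    rw [norm_mul, Complex.norm_real]
    refine (mul_le_mul lm hψm (norm_nonneg _) (by positivity)).trans ?_
    calc _ = 2 * (√(nabs t) * √(nabs t)) * (g + gm) * (C * w) := by ring
      _ = 2 * nabs t * (g + gm) * (C * w) := by rw [hs]
      _ ≤ _ := by gcongr; linarith
  have b4 : ‖(a : ℂ) * (ψ (x + t) - 2 * ψ x + ψ (x - t))‖ ≤ 2 * nabs t ^ δ * G * (C * w) := by
    rw [norm_mul, Complex.norm_real]
    refine (mul_le_mul l0 hψ2 (norm_nonneg _) (by positivity)).trans ?_
    calc _ = 2 * nabs t * g * (C * w) := by ring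
      _ ≤ _ := by gcongr; linarith
  rw [e]
  calc _ ≤ _ := norm_add_le_of_le (norm_add_le_of_le (norm_add_le_of_le b1 b2) b3) b4
    _ = _ := by ring

-- From √|x| ≤ √|x+t| + 1 follows 1 + |x| ≤ 3(1 + |x+t|), whose square gives the 9. Subadditivity is
-- an explicit hypothesis because the lemma is also used in building the non-archimedean instance of
-- `LocalAnalysis`.
omit [LocalAnalysis K] in
lemma inv_sq_le_nine_mul (hK : ∀ a b : K, √(nabs (a + b)) ≤ √(nabs a) + √(nabs b)) {x t : K}
    (ht : nabs t ≤ 1) : ((1 + nabs (x + t)) ^ 2)⁻¹ ≤ 9 * ((1 + nabs x) ^ 2)⁻¹ := by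
  have h := hK (x + t) (-t)
  rw [add_neg_cancel_right, nabs_neg] at h
  have h1 : √(nabs t) ≤ 1 := Real.sqrt_le_iff.2 ⟨zero_le_one, by simpa using ht⟩
  have hs := Real.sq_sqrt (nabs_nonneg x)
  have hs' := Real.sq_sqrt (nabs_nonneg (x + t))
  have h0 := Real.sqrt_nonneg (nabs x)
  have h0' := Real.sqrt_nonneg (nabs (x + t))
  have h2 : √(nabs x) ≤ √(nabs (x + t)) + 1 := by linarith
  have hx := nabs_nonneg x
  have hxt := nabs_nonneg (x + t)
  have h3 : 1 + nabs x ≤ 3 * (1 + nabs (x + t)) := by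
    nlinarith [sq_nonneg (√(nabs (x + t)) - 1)]
  rw [← div_eq_mul_inv, le_div_iff₀ (by positivity), inv_mul_le_iff₀ (by positivity)]
  nlinarith

variable [MeasurableSpace K] [BorelSpace K] {μ : Measure K} [μ.IsAddHaarMeasure]

lemma measurable_logWeight (δ : ℝ) : Measurable (logWeight δ : K → ℝ) :=
  ((measurable_nabs.pow_const _).add (measurable_nabs.pow_const _)).add (measurable_nabs.pow_const _)

lemma integrable_inv_sq_mul_logWeight {δ : ℝ} (hδ : 0 < δ) (hδ1 : δ < 1) :
    Integrable (fun x : K => ((1 + nabs x) ^ 2)⁻¹ * logWeight δ x) μ := by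
  have h := ((integrable_rpow_mul_inv_sq μ (a := -δ) (by linarith) (by linarith)).add
    (integrable_rpow_mul_inv_sq μ (a := -(1 / 2)) (by norm_num) (by norm_num))).add
    (integrable_rpow_mul_inv_sq μ (a := 1 / 2) (by norm_num) (by norm_num))
  refine h.congr (ae_of_all _ fun x => ?_)
  simp only [Pi.add_apply, logWeight]
  ring

lemma integral_inv_sq_mul_logWeight_add {δ : ℝ} (hδ : 0 < δ) (hδ1 : δ < 1) {t : K}
    (ht : nabs t ≤ 1) :
    Integrable (fun x : K => ((1 + nabs x) ^ 2)⁻¹ * logWeight δ (x + t)) μ ∧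
    ∫ x : K, ((1 + nabs x) ^ 2)⁻¹ * logWeight δ (x + t) ∂μ ≤
      9 * ∫ x : K, ((1 + nabs x) ^ 2)⁻¹ * logWeight δ x ∂μ := by
  have h := (integrable_inv_sq_mul_logWeight (μ := μ) hδ hδ1)
  have h9 := ((h.comp_add_right t).const_mul 9)
  have hle : ∀ x : K, ((1 + nabs x) ^ 2)⁻¹ * logWeight δ (x + t) ≤
      9 * (((1 + nabs (x + t)) ^ 2)⁻¹ * logWeight δ (x + t)) := by
    intro x
    have := inv_sq_le_nine_mul LocalAnalysis.sqrt_nabs_add_le (x := x + t) (t := -t) (by rwa [nabs_neg])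
    rw [add_neg_cancel_right] at this
    rw [← mul_assoc]
    exact mul_le_mul_of_nonneg_right this (logWeight_nonneg _ _)
  have hi : Integrable (fun x : K => ((1 + nabs x) ^ 2)⁻¹ * logWeight δ (x + t)) μ := by
    refine Integrable.mono' h9 ?_ (ae_of_all _ fun x => ?_)
    · exact ((((measurable_const.add measurable_nabs).pow_const 2).inv).mul
        ((measurable_logWeight δ).comp (measurable_add_const t))).aestronglyMeasurable
    · rw [Real.norm_of_nonneg (mul_nonneg (by positivity) (logWeight_nonneg _ _))]
      exact hle x
  refine ⟨hi, (integral_mono hi h9 hle).trans (le_of_eq ?_)⟩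
  rw [integral_const_mul, integral_add_right_eq_self
    (fun x : K => ((1 + nabs x) ^ 2)⁻¹ * logWeight δ x) t]

lemma norm_coe_mul_eq (lam : AddChar K Circle) (z : ℂ) (x : K) : ‖z * (lam x : ℂ)‖ = ‖z‖ := by
  rw [norm_mul, Circle.norm_coe, mul_one]

lemma integrable_mul_coe {lam : AddChar K Circle} (hlam : Continuous lam) {u : K → ℂ}
    (hu : Integrable u μ) {f : K → K} (hf : Measurable f) :
    Integrable (fun x => u x * (lam (f x) : ℂ)) μ := by
  refine hu.mono (hu.1.mul (measurable_coe_comp hlam hf).aestronglyMeasurable)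
    (ae_of_all _ fun x => ?_)
  rw [norm_coe_mul_eq]

lemma fourierInvTr_translate (lam : AddChar K Circle) (u : K → ℂ) (t y : K) :
    ∫ x, u (x + t) * (lam (x * y) : ℂ) ∂μ = (lam (-(t * y)) : ℂ) * fourierInvTr lam μ u y := by
  rw [fourierInvTr, ← integral_add_right_eq_self (fun x => u x * (lam (x * y) : ℂ)) t, ← integral_const_mul]
  refine integral_congr_ae (ae_of_all _ fun x => ?_)
  have : lam (x * y) = lam (-(t * y)) * lam ((x + t) * y) := by
    rw [← AddChar.map_add_eq_mul]
    congr 1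
    ring
  simp only [this, Circle.coe_mul]
  ring

lemma norm_fourierInvTr_le (lam : AddChar K Circle) (u : K → ℂ) (y : K) :
    ‖fourierInvTr lam μ u y‖ ≤ ∫ x, ‖u x‖ ∂μ := by
  refine (norm_integral_le_integral_norm _).trans (le_of_eq ?_)
  simp_rw [norm_coe_mul_eq]

lemma measurable_fourierInvTr {lam : AddChar K Circle} (hlam : Continuous lam) {u : K → ℂ}
    (hu : Measurable u) : Measurable (fourierInvTr lam μ u) := by
  have h : StronglyMeasurable (Function.uncurry fun y x : K => u x * (lam (x * y) : ℂ)) :=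
    ((hu.comp measurable_snd).mul
      (measurable_coe_comp hlam (measurable_snd.mul measurable_fst))).stronglyMeasurable
  exact h.integral_prod_right.measurable

/-- Translation by ±t multiplies the transform by λ(∓ty), and the transform is bounded by the L¹
norm. -/
lemma norm_fourierInvTr_second_diff {lam : AddChar K Circle} (hlam : Continuous lam) {u : K → ℂ}
    (hu : Integrable u μ) (t y : K) :
    ‖(lam (-(t * y)) : ℂ) - 2 + lam (t * y)‖ * ‖fourierInvTr lam μ u y‖ ≤
      ∫ x, ‖u (x + t) - 2 * u x + u (x - t)‖ ∂μ := by
  have hy : Measurable fun x : K => x * y := measurable_mul_const y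
  have h1 := integrable_mul_coe hlam (hu.comp_add_right t) hy
  have h2 := (integrable_mul_coe hlam hu hy).const_mul 2
  have h3 := integrable_mul_coe hlam (hu.comp_add_right (-t)) hy
  have e : ((lam (-(t * y)) : ℂ) - 2 + lam (t * y)) * fourierInvTr lam μ u y =
      ∫ x, (u (x + t) - 2 * u x + u (x - t)) * (lam (x * y) : ℂ) ∂μ := by
    have h4 := fourierInvTr_translate (μ := μ) lam u t y
    have h5 := fourierInvTr_translate (μ := μ) lam u (-t) y
    rw [neg_mul, neg_neg] at h5
    have h12 : Integrable (fun x => u (x + t) * (lam (x * y) : ℂ) -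
      2 * (u x * (lam (x * y) : ℂ))) μ := h1.sub h2
    rw [add_mul, sub_mul, ← h4, ← h5, fourierInvTr, ← integral_const_mul, ← integral_sub h1 h2,
      ← integral_add h12 h3]
    refine integral_congr_ae (ae_of_all _ fun x => ?_)
    simp only [sub_eq_add_neg]
    ring
  rw [← norm_mul, e]
  refine (norm_integral_le_integral_norm _).trans (le_of_eq ?_)
  simp_rw [norm_coe_mul_eq]

lemma powIntegrable_of_isSchwartzBruhat {α : K → ℂ} (hα : IsSchwartzBruhat α) {a : ℝ}
    (ha : -1 < a) (ha1 : a < 1) : PowIntegrable μ a α := by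
  have hm := (LocalAnalysis.continuous_of_isSchwartzBruhat hα).measurable
  obtain ⟨C, hC, h⟩ := LocalAnalysis.exists_bound hα
  refine ⟨hm, Integrable.mono' ((integrable_rpow_mul_inv_sq μ ha ha1).const_mul C)
    ((measurable_nabs.pow_const a).mul hm.norm).aestronglyMeasurable (ae_of_all _ fun x => ?_)⟩
  have := (h 0 x (by rw [nabs_zero]; exact zero_le_one)).1
  have hn := nabs_nonneg x
  rw [Real.norm_of_nonneg (by positivity)]
  calc nabs x ^ a * ‖α x‖ ≤ nabs x ^ a * (C * ((1 + nabs x) ^ 2)⁻¹) := by gcongr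
    _ = _ := by ring

lemma PowIntegrable.integrable {h : K → ℂ} (hh : PowIntegrable μ 0 h) : Integrable h μ := by
  have := hh.2
  simp only [Real.rpow_zero, one_mul] at this
  exact (integrable_norm_iff hh.1.aestronglyMeasurable).1 this

lemma integrable_of_isSchwartzBruhat {α : K → ℂ} (hα : IsSchwartzBruhat α) : Integrable α μ :=
  (powIntegrable_of_isSchwartzBruhat hα (by norm_num) (by norm_num)).integrable

lemma isMellin_of_isSchwartzBruhat {α : K → ℂ} (hα : IsSchwartzBruhat α) : IsMellin μ α :=
  fun _ h0 h1 => powIntegrable_of_isSchwartzBruhat hα (by linarith) (by linarith)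

lemma integrable_opA_of_isSchwartzBruhat {α : K → ℂ} (hα : IsSchwartzBruhat α) :
    Integrable (opA α) μ :=
  (powIntegrable_opA (a := 0) (ε := 1 / 2) (by norm_num)
    (powIntegrable_of_isSchwartzBruhat hα (by norm_num) (by norm_num))
    (powIntegrable_of_isSchwartzBruhat hα (by norm_num) (by norm_num))).integrable

/-- Decay of the Fourier transform of `log |x| ψ(x)` for a Schwartz--Bruhat function `ψ`. -/
lemma exists_norm_fourierInvTr_opA_le {lam : AddChar K Circle} (hlam : Continuous lam)
    (hlam1 : ∃ x, lam x ≠ 1) {ψ : K → ℂ} (hψ : IsSchwartzBruhat ψ) {δ : ℝ} (hδ : 0 < δ)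
    (hδ1 : δ < 1) : ∃ C : ℝ, ∀ y : K, y ≠ 0 →
      ‖fourierInvTr lam μ (opA ψ) y‖ ≤ C * nabs y ^ (-δ) := by
  obtain ⟨x₀, hx₀⟩ := hlam1
  have hx₀0 : x₀ ≠ 0 := by rintro rfl; simp at hx₀
  obtain ⟨C, hC, hb⟩ := LocalAnalysis.exists_bound hψ
  have hui := integrable_opA_of_isSchwartzBruhat (μ := μ) hψ
  set c : ℝ := ‖(lam (-x₀) : ℂ) - 2 + lam x₀‖ with hc
  have hc0 : 0 < c := by
    rw [hc, norm_pos_iff]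
    intro h0
    apply hx₀
    have h1 : (lam (-x₀) : ℂ) * lam x₀ = 1 := by
      rw [← Circle.coe_mul, ← AddChar.map_add_eq_mul]; simp
    -- For z = λ(x₀) the factor z⁻¹ - 2 + z equals (z-1)²/z, so it is nonzero as soon as z ≠ 1.
    have h2 : ((lam x₀ : ℂ) - 1) ^ 2 = 0 := by linear_combination (lam x₀ : ℂ) * h0 - h1
    have h3 : (lam x₀ : ℂ) = 1 := sub_eq_zero.1 (pow_eq_zero_iff two_ne_zero |>.1 h2)
    exact Circle.ext h3
  set I : ℝ := ∫ x : K, ((1 + nabs x) ^ 2)⁻¹ * logWeight δ x ∂μ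
  set M : ℝ := ∫ x, ‖opA ψ x‖ ∂μ
  -- 19 = 1 + 9 + 9: the weight at x, and the weights at x ± t, each costing a factor 9.
  set D : ℝ := C * (2 / δ + 6) * (19 * I) with hD
  have hnx := nabs_pos hx₀0
  have hI0 : 0 ≤ I := integral_nonneg fun x => mul_nonneg (by positivity) (logWeight_nonneg _ _)
  have hM0 : 0 ≤ M := integral_nonneg fun x => norm_nonneg _
  have hD0 : 0 ≤ D := by positivity
  refine ⟨(D / c + M) * nabs x₀ ^ δ, fun y hy => ?_⟩
  have hny := nabs_pos hy
  have e : nabs x₀ ^ δ * nabs y ^ (-δ) = nabs (x₀ / y) ^ δ := by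
    rw [nabs_div, Real.div_rpow hnx.le hny.le, Real.rpow_neg hny.le, div_eq_mul_inv]
  rw [mul_assoc, e]
  -- With this step ty = x₀, so the factor in front of the transform is the fixed constant c > 0,
  -- while |t|^δ is a multiple of |y|^(-δ). For |t| ≥ 1 the trivial L¹ bound is enough.
  set t := x₀ / y with ht
  have htn : 0 ≤ nabs t := nabs_nonneg t
  rcases le_total (nabs t) 1 with h1 | h1
  · have hle : ∫ x, ‖opA ψ (x + t) - 2 * opA ψ x + opA ψ (x - t)‖ ∂μ ≤ D * nabs t ^ δ := by
      have i0 := integrable_inv_sq_mul_logWeight (μ := μ) hδ hδ1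
      obtain ⟨ip, hp⟩ := integral_inv_sq_mul_logWeight_add (μ := μ) hδ hδ1 h1
      obtain ⟨im, hm⟩ := integral_inv_sq_mul_logWeight_add (μ := μ) hδ hδ1 (t := -t)
        (by rwa [nabs_neg])
      have i1 : Integrable (fun x : K => ((1 + nabs x) ^ 2)⁻¹ * logWeight δ x +
        ((1 + nabs x) ^ 2)⁻¹ * logWeight δ (x + t)) μ := i0.add ip
      have hsum := (((i0.add ip).add im).const_mul (C * (2 / δ + 6) * nabs t ^ δ))
      calc _ ≤ ∫ x : K, C * (2 / δ + 6) * nabs t ^ δ * (((1 + nabs x) ^ 2)⁻¹ * logWeight δ x +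
            ((1 + nabs x) ^ 2)⁻¹ * logWeight δ (x + t) +
            ((1 + nabs x) ^ 2)⁻¹ * logWeight δ (x + -t)) ∂μ := by
            refine integral_mono_of_nonneg (ae_of_all _ fun x => norm_nonneg _) hsum ?_
            have hp' : ∀ᵐ x ∂μ, x + t ≠ 0 :=
              (measurePreserving_add_right μ t).quasiMeasurePreserving.ae (ae_ne_zero μ)
            have hm' : ∀ᵐ x ∂μ, x + -t ≠ 0 :=
              (measurePreserving_add_right μ (-t)).quasiMeasurePreserving.ae (ae_ne_zero μ)
            filter_upwards [ae_ne_zero μ, hp', hm'] with x hx hxp hxm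
            have b := hb t x h1
            have b' := hb (-t) x (by rwa [nabs_neg])
            rw [nabs_neg] at b'
            rw [← sub_eq_add_neg] at hxm b'
            rw [← sub_eq_add_neg, ← mul_add, ← mul_add]
            exact norm_opA_second_diff_le hC b.1 b.2.1 b'.2.1 b.2.2 h1 hδ hδ1.le hx hxp hxm
        _ = C * (2 / δ + 6) * nabs t ^ δ * (I +
            ∫ x : K, ((1 + nabs x) ^ 2)⁻¹ * logWeight δ (x + t) ∂μ +
            ∫ x : K, ((1 + nabs x) ^ 2)⁻¹ * logWeight δ (x + -t) ∂μ) := by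
            rw [integral_const_mul, integral_add i1 im, integral_add i0 ip]
        _ ≤ C * (2 / δ + 6) * nabs t ^ δ * (I + 9 * I + 9 * I) := by gcongr
        _ = _ := by rw [hD]; ring
    have h2 := (norm_fourierInvTr_second_diff hlam hui t y).trans hle
    rw [ht, div_mul_cancel₀ _ hy, ← ht, ← hc] at h2
    calc _ ≤ D * nabs t ^ δ / c := by rw [le_div_iff₀ hc0, mul_comm]; exact h2
      _ = D / c * nabs t ^ δ := by ring
      _ ≤ _ := by gcongr; linarith
  · calc _ ≤ M := norm_fourierInvTr_le lam _ y
      _ ≤ (D / c + M) * 1 := by rw [mul_one]; have : 0 ≤ D / c := by positivity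
                                linarith
      _ ≤ _ := by
        gcongr
        exact Real.one_le_rpow h1 hδ.le

lemma isMellin_fourierInvTr_opA {lam : AddChar K Circle} (hlam : Continuous lam)
    (hlam1 : ∃ x, lam x ≠ 1) {ψ : K → ℂ} (hψ : IsSchwartzBruhat ψ) :
    IsMellin μ (fourierInvTr lam μ (opA ψ)) := by
  intro σ h0 h1
  have hm : Measurable (fourierInvTr lam μ (opA ψ)) := measurable_fourierInvTr hlam
    (measurable_opA (LocalAnalysis.continuous_of_isSchwartzBruhat hψ).measurable)
  -- At infinity the total exponent is -σ - δ = -1 - σ/2 < -1; near 0 boundedness and σ < 1 suffice.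
  -- Covering the whole strip needs δ arbitrarily close to 1.
  obtain ⟨C, hC⟩ := exists_norm_fourierInvTr_opA_le (μ := μ) hlam hlam1 hψ (δ := 1 - σ / 2)
    (by linarith) (by linarith)
  refine ⟨hm, integrable_of_bounds μ (a := -σ) (b := -1 - σ / 2)
    (C := max C (∫ x, ‖opA ψ x‖ ∂μ))
    ((measurable_nabs.pow_const _).mul hm.norm).aestronglyMeasurable (by linarith) (by linarith)
    (fun x hx hx1 => ?_) (fun x hx1 => ?_)⟩
  · have hn := nabs_pos hx
    rw [norm_mul, norm_norm, Real.norm_of_nonneg (by positivity), mul_comm]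
    gcongr
    exact (norm_fourierInvTr_le lam _ x).trans (le_max_right _ _)
  · have hn : 0 < nabs x := by linarith
    have hx : x ≠ 0 := by rintro rfl; simp [nabs_zero] at hn
    rw [norm_mul, norm_norm, Real.norm_of_nonneg (by positivity)]
    calc nabs x ^ (-σ) * ‖fourierInvTr lam μ (opA ψ) x‖
        ≤ nabs x ^ (-σ) * (max C (∫ x, ‖opA ψ x‖ ∂μ) * nabs x ^ (-(1 - σ / 2))) := by
          gcongr
          refine (hC x hx).trans ?_
          gcongr
          exact le_max_left _ _
      _ = max C (∫ x, ‖opA ψ x‖ ∂μ) * (nabs x ^ (-σ) * nabs x ^ (-(1 - σ / 2))) := by ring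
      _ = _ := by
          rw [← Real.rpow_add hn]
          congr 2
          ring

end Decay

/-! ### The gamma factor, the spectral identities and the transposes -/

section Gamma

variable {K : Type*} [Field K] [TopologicalSpace K] [IsTopologicalRing K] [LocallyCompactSpace K]
  [LocalAnalysis K] [MeasurableSpace K] [BorelSpace K] {μ : Measure K} [μ.IsAddHaarMeasure]
  {lam : AddChar K Circle}

lemma fourierInvTr_eq_fourierTr_comp_neg (α : K → ℂ) (y : K) :
    fourierInvTr lam μ α y = fourierTr lam μ (fun x => α (-x)) y := by
  rw [fourierInvTr, fourierTr, ← integral_neg_eq_self]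
  refine integral_congr_ae (ae_of_all _ fun x => ?_)
  simp only [neg_mul, mul_comm x y]

lemma fourierTr_eq_fourierInvTr_neg (α : K → ℂ) (y : K) :
    fourierTr lam μ α y = fourierInvTr lam μ α (-y) := by
  simp only [fourierInvTr, fourierTr, mul_neg, mul_comm y]

/-- Self-duality is assumed for one order of composition; the other follows from the change of
variable x ↦ -x. -/
lemma fourierTr_fourierInvTr (hμ : IsSelfDual lam μ) {α : K → ℂ} (hα : IsSchwartzBruhat α) :
    fourierTr lam μ (fourierInvTr lam μ α) = α := by
  ext y
  rw [← hμ α hα y, fourierTr_eq_fourierInvTr_neg, fourierInvTr, fourierInvTr,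
    ← integral_neg_eq_self]
  refine integral_congr_ae (ae_of_all _ fun x => ?_)
  simp only [fourierTr_eq_fourierInvTr_neg α, neg_mul_neg]

lemma isSchwartzBruhat_fourierInvTr
    (hF : ∀ α : K → ℂ, IsSchwartzBruhat α → IsSchwartzBruhat (fourierTr lam μ α)) {α : K → ℂ}
    (hα : IsSchwartzBruhat α) : IsSchwartzBruhat (fourierInvTr lam μ α) := by
  have h : fourierInvTr lam μ α = fourierTr lam μ (fun x => α (-x)) :=
    funext fun y => fourierInvTr_eq_fourierTr_comp_neg α y
  rw [h]
  exact hF _ (LocalAnalysis.isSchwartzBruhat_comp_neg hα)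

-- A bump supported where Re(χ(x)|x|^s) > 0, a neighbourhood of 1 by continuity.
variable (μ) in
lemma exists_zetaInt_ne_zero (χ : Kˣ →ₜ* Circle) {s : ℂ} (h1 : -1 < s.re) (h2 : s.re < 1) :
    ∃ α : K → ℂ, IsSchwartzBruhat α ∧ zetaInt μ χ s α ≠ 0 := by
  have hc : ContinuousAt (quasiChar χ s : K → ℂ) 1 :=
    (continuousOn_quasiChar χ s).continuousAt (isOpen_compl_singleton.mem_nhds one_ne_zero)
  have hU : {x : K | 0 < (quasiChar χ s x).re} ∈ 𝓝 (1 : K) := by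
    have h := (Complex.continuous_re.continuousAt (x := quasiChar χ s 1)).tendsto.comp hc.tendsto
    exact h.eventually_const_lt (by simp [quasiChar_one])
  obtain ⟨f, hfc, hfs, hf0, hf1, hfU, hfSB⟩ := LocalAnalysis.exists_bump hU
  refine ⟨_, hfSB, fun h0 => ?_⟩
  have hi := (powIntegrable_of_isSchwartzBruhat (μ := μ) hfSB h1 h2).integrable_mul_quasiChar χ rfl
  have h3 := congrArg Complex.re h0
  rw [zetaInt, Complex.zero_re, ← RCLike.re_eq_complex_re, ← integral_re hi] at h3
  have e : (fun x => RCLike.re ((f x : ℂ) * quasiChar χ s x)) =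
      fun x => f x * (quasiChar χ s x).re := by
    ext x
    rw [RCLike.re_eq_complex_re, Complex.re_ofReal_mul]
  have hire := hi.re
  rw [e] at h3 hire
  have hnn : 0 ≤ fun x => f x * (quasiChar χ s x).re := by
    intro x
    by_cases hx : x ∈ Function.support f
    · exact mul_nonneg (hf0 x) (hfU hx).le
    · rw [Function.notMem_support] at hx
      simp [hx]
  have h4 := (integral_pos_iff_support_of_nonneg hnn hire).2 (by
    have hsub : Function.support f ⊆ Function.support fun x => f x * (quasiChar χ s x).re :=
      fun x hx => mul_ne_zero hx (hfU hx).ne'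
    refine lt_of_lt_of_le ?_ (measure_mono hsub)
    exact (hfc.isOpen_support).measure_pos μ ⟨1, hf1⟩)
  exact h4.ne' h3

lemma hasDerivAt_zetaInt_sub_one (χ : Kˣ →ₜ* Circle) {h : K → ℂ} (hh : IsMellin μ h) {s : ℂ}
    (hs : s ∈ criticalStrip) :
    HasDerivAt (fun s => zetaInt μ χ (s - 1) h) (zetaInt μ χ (s - 1) (opA h)) s := by
  have hs' : 1 - s ∈ criticalStrip := by
    obtain ⟨h0, h1⟩ := hs
    constructor <;> simp <;> linarith
  have h1 := (hh.hasDerivAt_zetaInt χ hs').comp s ((hasDerivAt_id s).const_sub 1)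
  simp only [Function.comp_def, neg_sub, mul_neg, neg_neg, mul_one] at h1
  exact h1

lemma isGammaFactor_iff_zetaInt
    (hF : ∀ α : K → ℂ, IsSchwartzBruhat α → IsSchwartzBruhat (fourierTr lam μ α))
    (χ : Kˣ →ₜ* Circle) {s : ℂ} (hs : s ∈ criticalStrip) (g : ℂ) :
    IsGammaFactor lam μ χ s g ↔ ∀ φ : K → ℂ, IsSchwartzBruhat φ →
      zetaInt μ χ (s - 1) (fourierTr lam μ φ) = g * zetaInt μ χ⁻¹ (-s) φ := by
  obtain ⟨h0, h1⟩ := hs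
  refine ⟨fun h φ hφ => (h φ hφ).2.2, fun h φ hφ => ⟨?_, ?_, h φ hφ⟩⟩
  · exact (powIntegrable_of_isSchwartzBruhat (a := s.re - 1) (hF φ hφ) (by linarith)
      (by linarith)).integrable_mul_quasiChar χ (by simp)
  · exact (powIntegrable_of_isSchwartzBruhat (a := -s.re) hφ (by linarith)
      (by linarith)).integrable_mul_quasiChar χ⁻¹ (by simp)

lemma fourierInvTr_fourierTr (hμ : IsSelfDual lam μ) {α : K → ℂ} (hα : IsSchwartzBruhat α) :
    fourierInvTr lam μ (fourierTr lam μ α) = α := funext (hμ α hα)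

lemma IsMellin.powIntegrable_sub_one {h : K → ℂ} (hh : IsMellin μ h) {s : ℂ}
    (hs : s ∈ criticalStrip) : PowIntegrable μ (s.re - 1) h := by
  obtain ⟨h0, h1⟩ := hs
  have := hh (1 - s.re) (by linarith) (by linarith)
  rwa [neg_sub] at this

lemma IsMellin.powIntegrable_neg {h : K → ℂ} (hh : IsMellin μ h) {s : ℂ}
    (hs : s ∈ criticalStrip) : PowIntegrable μ (-s.re) h := hh s.re hs.1 hs.2

/-- Standing hypotheses on the additive character and the measure: continuity, non-triviality,
self-duality, and invariance of the Schwartz--Bruhat space under the Fourier transform. -/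
structure IsFourierPair (lam : AddChar K Circle) (μ : Measure K) : Prop where
  continuous : Continuous lam
  nontrivial : ∃ x, lam x ≠ 1
  isSelfDual : IsSelfDual lam μ
  isSchwartzBruhat : ∀ α : K → ℂ, IsSchwartzBruhat α → IsSchwartzBruhat (fourierTr lam μ α)

variable (hP : IsFourierPair lam μ) (χ : Kˣ →ₜ* Circle)

include hP

/-- Put v = φ̃ in the symmetric functional equation, with φ a fixed test function of nonzero zeta
integral. The ratio obtained does not depend on u, which need not be Schwartz--Bruhat. -/
lemma exists_gammaFactor {s : ℂ} (hs : s ∈ criticalStrip) : ∃ g : ℂ, ∀ u : K → ℂ,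
    Integrable u μ → IsMellin μ u → IsMellin μ (fourierInvTr lam μ u) →
      zetaInt μ χ (s - 1) u = g * zetaInt μ χ⁻¹ (-s) (fourierInvTr lam μ u) := by
  have ⟨h0, h1⟩ := hs
  obtain ⟨φ, hφ, hne⟩ := exists_zetaInt_ne_zero μ χ⁻¹ (s := -s) (by simpa using h1)
    (by rw [Complex.neg_re]; linarith)
  have hφ' := hP.isSchwartzBruhat φ hφ
  refine ⟨zetaInt μ χ (s - 1) (fourierTr lam μ φ) / zetaInt μ χ⁻¹ (-s) φ, fun u hu hum hum' => ?_⟩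
  have key := zetaInt_mul_zetaInt_fourierInvTr hP.continuous χ hu
    (integrable_of_isSchwartzBruhat hφ') (hum.powIntegrable_sub_one hs)
    ((isMellin_of_isSchwartzBruhat hφ').powIntegrable_sub_one hs) (hum'.powIntegrable_neg hs)
    (by rw [fourierInvTr_fourierTr hP.isSelfDual hφ]
        exact (isMellin_of_isSchwartzBruhat hφ).powIntegrable_neg hs)
  rw [fourierInvTr_fourierTr hP.isSelfDual hφ] at key
  rw [div_mul_eq_mul_div, eq_div_iff hne, key]

lemma isGammaFactor_iff {s : ℂ} (hs : s ∈ criticalStrip) (g : ℂ) :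
    IsGammaFactor lam μ χ s g ↔ g = gammaFactor lam μ χ s := by
  have ⟨h0, h1⟩ := hs
  obtain ⟨g₀, hg₀⟩ := exists_gammaFactor hP χ hs
  have hex : IsGammaFactor lam μ χ s g₀ := by
    rw [isGammaFactor_iff_zetaInt hP.isSchwartzBruhat χ hs]
    intro φ hφ
    have hφ' := hP.isSchwartzBruhat φ hφ
    have h := hg₀ _ (integrable_of_isSchwartzBruhat hφ') (isMellin_of_isSchwartzBruhat hφ')
    rw [fourierInvTr_fourierTr hP.isSelfDual hφ] at h
    exact h (isMellin_of_isSchwartzBruhat hφ)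
  have hΓ : IsGammaFactor lam μ χ s (gammaFactor lam μ χ s) := Classical.epsilon_spec ⟨g₀, hex⟩
  refine ⟨fun h => ?_, fun h => h ▸ hΓ⟩
  rw [isGammaFactor_iff_zetaInt hP.isSchwartzBruhat χ hs] at h hΓ
  obtain ⟨φ, hφ, hne⟩ := exists_zetaInt_ne_zero μ χ⁻¹ (s := -s) (by simpa using h1)
    (by rw [Complex.neg_re]; linarith)
  exact mul_right_cancel₀ hne ((h φ hφ).symm.trans (hΓ φ hφ))

/-- The relation defining Γ, beyond transforms of test functions; it is applied to log|x| times a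
Fourier transform. -/
lemma zetaInt_eq_gammaFactor_mul {s : ℂ} (hs : s ∈ criticalStrip) {u : K → ℂ}
    (hu : Integrable u μ) (hum : IsMellin μ u) (hum' : IsMellin μ (fourierInvTr lam μ u)) :
    zetaInt μ χ (s - 1) u =
      gammaFactor lam μ χ s * zetaInt μ χ⁻¹ (-s) (fourierInvTr lam μ u) := by
  obtain ⟨g₀, hg₀⟩ := exists_gammaFactor hP χ hs
  rw [← (isGammaFactor_iff hP χ hs g₀).1 ?_]
  · exact hg₀ u hu hum hum'
  · rw [isGammaFactor_iff_zetaInt hP.isSchwartzBruhat χ hs]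
    intro φ hφ
    have hφ' := hP.isSchwartzBruhat φ hφ
    have h := hg₀ _ (integrable_of_isSchwartzBruhat hφ') (isMellin_of_isSchwartzBruhat hφ')
    rw [fourierInvTr_fourierTr hP.isSelfDual hφ] at h
    exact h (isMellin_of_isSchwartzBruhat hφ)

lemma zetaInt_fourierTr {s : ℂ} (hs : s ∈ criticalStrip) {φ : K → ℂ} (hφ : IsSchwartzBruhat φ) :
    zetaInt μ χ (s - 1) (fourierTr lam μ φ) = gammaFactor lam μ χ s * zetaInt μ χ⁻¹ (-s) φ :=
  (isGammaFactor_iff_zetaInt hP.isSchwartzBruhat χ hs _).1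
    ((isGammaFactor_iff hP χ hs _).2 rfl) φ hφ

omit hP in
lemma isOpen_criticalStrip : IsOpen criticalStrip :=
  (isOpen_lt continuous_const Complex.continuous_re).inter
    (isOpen_lt Complex.continuous_re continuous_const)

lemma differentiableAt_gammaFactor {s : ℂ} (hs : s ∈ criticalStrip) :
    DifferentiableAt ℂ (gammaFactor lam μ χ) s := by
  have ⟨h0, h1⟩ := hs
  obtain ⟨φ, hφ, hne⟩ := exists_zetaInt_ne_zero μ χ⁻¹ (s := -s) (by simpa using h1)
    (by rw [Complex.neg_re]; linarith)
  have d1 := hasDerivAt_zetaInt_sub_one χ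
    (isMellin_of_isSchwartzBruhat (hP.isSchwartzBruhat φ hφ) (μ := μ)) hs
  have d2 := (isMellin_of_isSchwartzBruhat (μ := μ) hφ).hasDerivAt_zetaInt χ⁻¹ hs
  have d3 := (d1.div d2 hne).differentiableAt
  refine d3.congr_of_eventuallyEq ?_
  filter_upwards [isOpen_criticalStrip.mem_nhds hs,
    d2.continuousAt.eventually_ne hne] with z hz hz'
  rw [Pi.div_apply, eq_div_iff hz', zetaInt_fourierTr hP χ hz hφ]

lemma gammaFactor_ne_zero {s : ℂ} (hs : s ∈ criticalStrip) : gammaFactor lam μ χ s ≠ 0 := by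
  have ⟨h0, h1⟩ := hs
  obtain ⟨ψ, hψ, hne⟩ := exists_zetaInt_ne_zero μ χ (s := s - 1)
    (by rw [Complex.sub_re, Complex.one_re]; linarith)
    (by rw [Complex.sub_re, Complex.one_re]; linarith)
  have h := zetaInt_fourierTr hP χ hs (isSchwartzBruhat_fourierInvTr hP.isSchwartzBruhat hψ)
  rw [fourierTr_fourierInvTr hP.isSelfDual hψ] at h
  intro h0
  rw [h0, zero_mul] at h
  exact hne h

lemma isMellin_opB {α : K → ℂ} (hα : IsSchwartzBruhat α) : IsMellin μ (opB lam μ α) :=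
  isMellin_fourierInvTr_opA hP.continuous hP.nontrivial (hP.isSchwartzBruhat α hα)

lemma zetaInt_opB {s : ℂ} (hs : s ∈ criticalStrip) {α : K → ℂ} (hα : IsSchwartzBruhat α) :
    zetaInt μ χ⁻¹ (-s) (opB lam μ α) =
      logDeriv (gammaFactor lam μ χ) s * zetaInt μ χ⁻¹ (-s) α - zetaInt μ χ⁻¹ (-s) (opA α) := by
  have hψ := hP.isSchwartzBruhat α hα
  have hψM : IsMellin μ (fourierTr lam μ α) := isMellin_of_isSchwartzBruhat hψ
  have d1 := hasDerivAt_zetaInt_sub_one χ hψM hs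
  have d2 := (isMellin_of_isSchwartzBruhat (μ := μ) hα).hasDerivAt_zetaInt χ⁻¹ hs
  have d3 := (differentiableAt_gammaFactor hP χ hs).hasDerivAt.mul d2
  -- The two sides of the functional equation agree near s, so their derivatives agree.
  have d4 := d1.unique (d3.congr_of_eventuallyEq (by
    filter_upwards [isOpen_criticalStrip.mem_nhds hs] with z hz
    exact zetaInt_fourierTr hP χ hz hα))
  rw [zetaInt_eq_gammaFactor_mul hP χ hs (integrable_opA_of_isSchwartzBruhat hψ) hψM.mul_log
    (isMellin_opB hP hα)] at d4
  have hne := gammaFactor_ne_zero hP χ hs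
  have hB : fourierInvTr lam μ (opA (fourierTr lam μ α)) = opB lam μ α := rfl
  rw [hB] at d4
  rw [logDeriv_apply]
  field_simp
  linear_combination d4

lemma zetaInt_commutator {s : ℂ} (hs : s ∈ criticalStrip) {α : K → ℂ} (hα : IsSchwartzBruhat α)
    (hAα : IsSchwartzBruhat (opA α)) :
    zetaInt μ χ⁻¹ (-s) (opB lam μ (opA α)) - zetaInt μ χ⁻¹ (-s) (opA (opB lam μ α)) =
      deriv (logDeriv (gammaFactor lam μ χ)) s * zetaInt μ χ⁻¹ (-s) α := by
  have hαM : IsMellin μ α := isMellin_of_isSchwartzBruhat hα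
  have hL : DifferentiableAt ℂ (logDeriv (gammaFactor lam μ χ)) s := by
    have hd : DifferentiableOn ℂ (gammaFactor lam μ χ) criticalStrip :=
      fun z hz => (differentiableAt_gammaFactor hP χ hz).differentiableWithinAt
    have hd' := (hd.deriv isOpen_criticalStrip).differentiableAt
      (isOpen_criticalStrip.mem_nhds hs)
    exact hd'.div (differentiableAt_gammaFactor hP χ hs) (gammaFactor_ne_zero hP χ hs)
  have d1 := (isMellin_opB hP hα).hasDerivAt_zetaInt χ⁻¹ hs
  have d2 := (hL.hasDerivAt.mul (hαM.hasDerivAt_zetaInt χ⁻¹ hs)).sub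
    (hαM.mul_log.hasDerivAt_zetaInt χ⁻¹ hs)
  have d3 := d1.unique (d2.congr_of_eventuallyEq (by
    filter_upwards [isOpen_criticalStrip.mem_nhds hs] with z hz
    exact zetaInt_opB hP χ hz hα))
  -- In the sum of this with the differentiated identity, (Γ'/Γ) Z(Aα) and Z(A²α) cancel.
  have h := zetaInt_opB hP χ hs hAα
  linear_combination h + d3

omit hP in
lemma IsMellin.integrable_quasiChar_mul {h : K → ℂ} (hh : IsMellin μ h) (χ : Kˣ →ₜ* Circle)
    {s : ℂ} (hs : s ∈ criticalStrip) : Integrable (fun y => quasiChar χ (-s) y * h y) μ := by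
  simp_rw [mul_comm (quasiChar χ (-s) _)]
  exact (hh.powIntegrable_neg hs).integrable_mul_quasiChar χ (by simp)

omit hP in
lemma integral_quasiChar_mul (χ : Kˣ →ₜ* Circle) (s : ℂ) (h : K → ℂ) :
    ∫ y, quasiChar χ s y * h y ∂μ = zetaInt μ χ s h := by
  simp_rw [zetaInt, mul_comm]

theorem isDistributionEigenfunction_opH {s : ℂ} (hs : s ∈ criticalStrip) :
    IsDistributionEigenfunction μ IsSchwartzBruhat (opH lam μ)
      (quasiChar χ⁻¹ (-s)) (logDeriv (gammaFactor lam μ χ) s) := by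
  intro α hα
  have hαM : IsMellin μ α := isMellin_of_isSchwartzBruhat hα
  have iA := hαM.mul_log.integrable_quasiChar_mul χ⁻¹ hs
  have iB := (isMellin_opB hP hα).integrable_quasiChar_mul χ⁻¹ hs
  simp only [opH, mul_add]
  refine ⟨hαM.integrable_quasiChar_mul χ⁻¹ hs, iA.add iB, ?_⟩
  rw [integral_add iA iB]
  simp only [integral_quasiChar_mul]
  rw [zetaInt_opB hP χ hs hα]
  ring

theorem isDistributionEigenfunction_opK {s : ℂ} (hs : s ∈ criticalStrip) :
    IsDistributionEigenfunction μ IsPuncturedTest (fun α => -opK lam μ α)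
      (quasiChar χ⁻¹ (-s)) (-Complex.I * deriv (logDeriv (gammaFactor lam μ χ)) s) := by
  intro α hα
  -- Vanishing near 0 keeps log|y| α(y) Schwartz--Bruhat, so B can be applied to it.
  have hAα := (LocalAnalysis.isPuncturedTest_opA hα).1
  have hαM : IsMellin μ α := isMellin_of_isSchwartzBruhat hα.1
  have iBA := ((isMellin_opB hP hAα).integrable_quasiChar_mul χ⁻¹ hs).const_mul (-Complex.I)
  have iAB := ((isMellin_opB hP hα.1).mul_log.integrable_quasiChar_mul χ⁻¹ hs).const_mul
    (-Complex.I)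
  have e : (fun y => quasiChar χ⁻¹ (-s) y * (-opK lam μ α) y) = fun y =>
      -Complex.I * (quasiChar χ⁻¹ (-s) y * opB lam μ (opA α) y) -
      -Complex.I * (quasiChar χ⁻¹ (-s) y * opA (opB lam μ α) y) := by
    ext y
    simp only [Pi.neg_apply, opK]
    ring
  refine ⟨hαM.integrable_quasiChar_mul χ⁻¹ hs, ?_, ?_⟩
  · rw [e]
    exact iBA.sub iAB
  · rw [e, integral_sub iBA iAB, integral_const_mul, integral_const_mul]
    simp only [integral_quasiChar_mul]
    rw [← mul_sub, zetaInt_commutator hP χ hs hα.1 hAα]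
    ring

omit χ

lemma integrable_opB_mul {α₁ α₂ : K → ℂ} (h₁ : IsSchwartzBruhat α₁) (h₂ : Integrable α₂ μ) :
    Integrable (fun y => opB lam μ α₁ y * α₂ y) μ := by
  have hm : Measurable (opB lam μ α₁) := (isMellin_opB hP h₁ (1 / 2) (by norm_num) (by norm_num)).1
  refine Integrable.mono' (h₂.norm.const_mul (∫ x, ‖opA (fourierTr lam μ α₁) x‖ ∂μ))
    (hm.aestronglyMeasurable.mul h₂.1) (ae_of_all _ fun y => ?_)
  rw [norm_mul]
  exact mul_le_mul_of_nonneg_right (norm_fourierInvTr_le lam _ y) (norm_nonneg _)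

/-- Parseval by Fubini. Since log|x| is even, the right side is symmetric in α₁ and α₂ after x ↦ -x,
which makes B symmetric. -/
lemma integral_opB_mul {α₁ α₂ : K → ℂ} (h₁ : IsSchwartzBruhat α₁) (h₂ : IsSchwartzBruhat α₂) :
    ∫ y, opB lam μ α₁ y * α₂ y ∂μ = ∫ x, (Real.log (nabs x) : ℂ) * fourierTr lam μ α₁ x *
      fourierTr lam μ α₂ (-x) ∂μ := by
  have i1 : Integrable (opA (fourierTr lam μ α₁)) μ :=
    integrable_opA_of_isSchwartzBruhat (hP.isSchwartzBruhat α₁ h₁)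
  have i2 : Integrable α₂ μ := integrable_of_isSchwartzBruhat h₂
  have hi : Integrable (Function.uncurry fun y x => opA (fourierTr lam μ α₁) x *
      (lam (x * y) : ℂ) * α₂ y) (μ.prod μ) := by
    have hm : Measurable fun z : K × K => (lam (z.2 * z.1) : ℂ) :=
      measurable_coe_comp hP.continuous (measurable_snd.mul measurable_fst)
    have h := i2.mul_prod i1
    refine (h.mul_bdd (c := 1) hm.aestronglyMeasurable (ae_of_all _ fun z => ?_)).congr
      (ae_of_all _ fun z => ?_)
    · rw [Circle.norm_coe]
    · simp only [Function.uncurry]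
      ring
  have e1 : ∀ y, opB lam μ α₁ y * α₂ y =
      ∫ x, opA (fourierTr lam μ α₁) x * (lam (x * y) : ℂ) * α₂ y ∂μ := by
    intro y
    rw [integral_mul_const]
    rfl
  simp_rw [e1]
  rw [integral_integral_swap hi]
  refine integral_congr_ae (ae_of_all _ fun x => ?_)
  simp only
  rw [fourierTr.eq_def lam μ α₂, ← integral_const_mul]
  refine integral_congr_ae (ae_of_all _ fun y => ?_)
  simp only [opA, neg_mul, neg_neg]
  ring

lemma integral_opB_mul_eq {α₁ α₂ : K → ℂ} (h₁ : IsSchwartzBruhat α₁) (h₂ : IsSchwartzBruhat α₂) :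
    ∫ y, opB lam μ α₁ y * α₂ y ∂μ = ∫ y, α₁ y * opB lam μ α₂ y ∂μ := by
  simp_rw [mul_comm (α₁ _)]
  rw [integral_opB_mul hP h₁ h₂, integral_opB_mul hP h₂ h₁, ← integral_neg_eq_self]
  refine integral_congr_ae (ae_of_all _ fun x => ?_)
  simp only [nabs_neg, neg_neg]
  ring

omit hP in
lemma integrable_opA_mul {α₁ α₂ : K → ℂ} (h₁ : IsSchwartzBruhat α₁) (h₂ : IsSchwartzBruhat α₂) :
    Integrable (fun y => opA α₁ y * α₂ y) μ := by
  obtain ⟨C, hC, hb⟩ := LocalAnalysis.exists_bound h₂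
  refine (integrable_opA_of_isSchwartzBruhat h₁).mul_bdd (c := C)
    (LocalAnalysis.continuous_of_isSchwartzBruhat h₂).measurable.aestronglyMeasurable
    (ae_of_all _ fun x => ?_)
  have hn := nabs_nonneg x
  refine ((hb 0 x (by rw [nabs_zero]; exact zero_le_one)).1).trans
    (mul_le_of_le_one_right hC (inv_le_one_of_one_le₀ ?_))
  nlinarith

theorem hasTranspose_opH : HasTranspose μ IsSchwartzBruhat (opH lam μ) (opH lam μ) := by
  intro α₁ α₂ h₁ h₂
  have a1 := integrable_opA_mul (μ := μ) h₁ h₂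
  have b1 := integrable_opB_mul hP h₁ (integrable_of_isSchwartzBruhat h₂)
  have a2 := integrable_opA_mul (μ := μ) h₂ h₁
  have b2 := integrable_opB_mul hP h₂ (integrable_of_isSchwartzBruhat h₁)
  simp_rw [mul_comm (α₁ _)]
  simp only [opH, add_mul]
  refine ⟨a1.add b1, a2.add b2, ?_⟩
  rw [integral_add a1 b1, integral_add a2 b2, integral_opB_mul_eq hP h₁ h₂]
  simp_rw [mul_comm (α₁ _)]
  congr 1
  refine integral_congr_ae (ae_of_all _ fun x => ?_)
  simp only [opA]
  ring

theorem hasTranspose_opK :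
    HasTranspose μ IsPuncturedTest (opK lam μ) (fun α => -opK lam μ α) := by
  intro α₁ α₂ h₁ h₂
  have h₁' := (LocalAnalysis.isPuncturedTest_opA h₁).1
  have h₂' := (LocalAnalysis.isPuncturedTest_opA h₂).1
  have e : ∀ f g : K → ℂ, (fun y => opA f y * g y) = fun y => f y * opA g y := by
    intro f g
    ext y
    simp only [opA]
    ring
  have key : ∀ {α β : K → ℂ}, IsSchwartzBruhat α → IsSchwartzBruhat (opA α) →
      IsSchwartzBruhat β → IsSchwartzBruhat (opA β) →
      Integrable (fun y => opB lam μ (opA α) y * β y) μ ∧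
      Integrable (fun y => opA (opB lam μ α) y * β y) μ := by
    intro α β hα hα' hβ hβ'
    refine ⟨integrable_opB_mul hP hα' (integrable_of_isSchwartzBruhat hβ), ?_⟩
    rw [e]
    exact integrable_opB_mul hP hα (integrable_of_isSchwartzBruhat hβ')
  -- Transposition exchanges BA and AB, hence changes the sign of their commutator.
  have hint : ∀ {α β : K → ℂ}, IsSchwartzBruhat α → IsSchwartzBruhat (opA α) →
      IsSchwartzBruhat β → IsSchwartzBruhat (opA β) →
      ∫ y, opB lam μ (opA α) y * β y ∂μ = ∫ y, opA (opB lam μ β) y * α y ∂μ := by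
    intro α β _ hα' hβ _
    rw [integral_opB_mul_eq hP hα' hβ, e, e]
    simp_rw [mul_comm (opB lam μ β _)]
    rw [e]
  obtain ⟨i1, j1⟩ := key h₁.1 h₁' h₂.1 h₂'
  obtain ⟨i2, j2⟩ := key h₂.1 h₂' h₁.1 h₁'
  have e1 : (fun y => opK lam μ α₁ y * α₂ y) = fun y =>
      Complex.I * (opB lam μ (opA α₁) y * α₂ y - opA (opB lam μ α₁) y * α₂ y) := by
    ext y
    simp only [opK]
    ring
  have e2 : (fun y => α₁ y * (-opK lam μ α₂) y) = fun y =>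
      -Complex.I * (opB lam μ (opA α₂) y * α₁ y - opA (opB lam μ α₂) y * α₁ y) := by
    ext y
    simp only [Pi.neg_apply, opK]
    ring
  refine ⟨?_, ?_, ?_⟩
  · rw [e1]
    exact (i1.sub j1).const_mul _
  · rw [e2]
    exact (i2.sub j2).const_mul _
  · rw [e1, e2, integral_const_mul, integral_const_mul, integral_sub i1 j1, integral_sub i2 j2,
      hint h₁.1 h₁' h₂.1 h₂', hint h₂.1 h₂' h₁.1 h₁']
    ring

end Gamma

/-! ### Non-archimedean fields: the module and the valuation define the same order -/

section Valuation

open ValuativeRel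

variable {K : Type*} [Field K] [TopologicalSpace K] [IsTopologicalRing K] [LocallyCompactSpace K]
  [ValuativeRel K] [IsNonarchimedeanLocalField K]

set_option linter.overlappingInstances false

lemma isOpen_valuation_lt_one : IsOpen {x : K | valuation K x < 1} := by
  rw [isOpen_iff_mem_nhds]
  intro x hx
  have h0 : {z : K | valuation K z < 1} ∈ 𝓝 (0 : K) := by
    rw [IsValuativeTopology.mem_nhds_zero_iff]
    exact ⟨1, by simp⟩
  have h1 : Tendsto (fun y : K => y - x) (𝓝 x) (𝓝 0) := by
    have : Continuous fun y : K => y - x := continuous_id.sub continuous_const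
    simpa using this.tendsto x
  filter_upwards [h1 h0] with y hy
  have := (valuation K).map_add_lt hx hy
  simpa using this

/-- Compare the Haar measures of the integers O and of yO ⊆ O. If y is in the maximal ideal, yO
misses the open set 1 + {v < 1} inside O, which has positive measure, so the inequality is strict.
-/
lemma nabs_le_one_of_valuation {y : K} (hy : valuation K y ≤ 1) : nabs y ≤ 1 ∧
    (valuation K y < 1 → nabs y < 1) := by
  by_cases h0 : y = 0
  · simp [h0, nabs_zero]
  borelize K
  let μ : Measure K := Measure.addHaar
  set O : Set K := {x | valuation K x ≤ 1} with hO
  have hOc : IsCompact O := IsNonarchimedeanLocalField.isCompact_closedBall K 1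
  have hM := isOpen_valuation_lt_one (K := K)
  have hfin : μ O ≠ ⊤ := hOc.measure_lt_top.ne
  have hpos : 0 < μ O := lt_of_lt_of_le (hM.measure_pos μ ⟨0, by simp⟩)
    (measure_mono fun x (hx : valuation K x < 1) => hx.le)
  have hmul := distribHaarChar_mul μ (Units.mk0 y h0) O
  have hsub : ∀ x ∈ Units.mk0 y h0 • O, valuation K x ≤ valuation K y := by
    rintro _ ⟨x, hx, rfl⟩
    change valuation K (y * x) ≤ _
    rw [map_mul]
    exact mul_le_of_le_one_right' hx
  rw [nabs_of_ne_zero h0]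
  constructor
  · have h : (distribHaarChar K (Units.mk0 y h0) : ℝ≥0∞) * μ O ≤ 1 * μ O := by
      rw [hmul, one_mul]
      exact measure_mono fun x hx => (hsub x hx).trans hy
    have h' := (ENNReal.mul_le_mul_iff_left hpos.ne' hfin).1 h
    exact_mod_cast h'
  · intro hlt
    have hU : IsOpen ((fun x : K => x - 1) ⁻¹' {x : K | valuation K x < 1}) :=
      hM.preimage (continuous_id.sub continuous_const)
    set U := (fun x : K => x - 1) ⁻¹' {x : K | valuation K x < 1} with hUdef
    have hU1 : ∀ x ∈ U, valuation K x = 1 := by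
      intro x (hx : valuation K (x - 1) < 1)
      have := (valuation K).map_add_eq_of_lt_left (x := 1) (y := x - 1) (by simpa using hx)
      simpa using this
    have hdisj : Disjoint (Units.mk0 y h0 • O) U := by
      rw [Set.disjoint_left]
      intro x hx hxU
      have h1 := hsub x hx
      rw [hU1 x hxU] at h1
      exact absurd hlt (not_lt.2 h1)
    have hadd : μ (Units.mk0 y h0 • O) + μ U ≤ μ O := by
      rw [← measure_union hdisj hU.measurableSet]
      refine measure_mono (Set.union_subset (fun x hx => (hsub x hx).trans hy) fun x hx => ?_)
      exact (hU1 x hx).le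
    have hUpos : 0 < μ U := hU.measure_pos μ ⟨1, by simp [hUdef]⟩
    by_contra hge
    have hge' : 1 ≤ distribHaarChar K (Units.mk0 y h0) := by
      rw [not_lt] at hge
      exact_mod_cast hge
    have h2 : μ O ≤ μ (Units.mk0 y h0 • O) := by
      rw [← hmul]
      calc μ O = 1 * μ O := (one_mul _).symm
        _ ≤ _ := by gcongr; exact_mod_cast hge'
    have h3 : μ O + μ U ≤ μ O := (add_le_add_left h2 _).trans hadd
    have h4 : μ U ≤ 0 := by
      have h5 : μ O + μ U ≤ μ O + 0 := by simpa using h3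
      exact (ENNReal.add_le_add_iff_left hfin).1 h5
    exact absurd hUpos (not_lt.2 h4)

lemma nabs_le_one_iff {y : K} : nabs y ≤ 1 ↔ valuation K y ≤ 1 := by
  refine ⟨fun h => ?_, fun h => (nabs_le_one_of_valuation h).1⟩
  by_contra hlt
  rw [not_le] at hlt
  have hy : y ≠ 0 := by rintro rfl; simp at hlt
  have h1 : valuation K y⁻¹ < 1 := by
    rw [map_inv₀]
    exact inv_lt_one_of_one_lt₀ hlt
  have h2 := (nabs_le_one_of_valuation h1.le).2 h1
  rw [nabs_inv] at h2
  have := (inv_lt_one₀ (nabs_pos hy)).1 h2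
  linarith

lemma nabs_le_iff {x y : K} : nabs x ≤ nabs y ↔ valuation K x ≤ valuation K y := by
  by_cases hy : y = 0
  · by_cases hx : x = 0
    · simp [hx, hy]
    · simp [hy, hx, nabs_zero, nabs_pos hx]
  · have h := nabs_le_one_iff (y := x / y)
    rwa [nabs_div, div_le_one (nabs_pos hy), map_div₀, div_le_one₀ (by simpa [zero_lt_iff] using hy)]
      at h

lemma nabs_lt_iff {x y : K} : nabs x < nabs y ↔ valuation K x < valuation K y := by
  rw [← not_le, ← not_le, nabs_le_iff]

end Valuation

/-- The facts on a non-archimedean local field used below, in terms of its module. -/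
structure IsUltrametric (K : Type*) [Field K] [TopologicalSpace K] [IsTopologicalRing K]
    [LocallyCompactSpace K] : Prop where
  nabs_add_le (x y : K) : nabs (x + y) ≤ max (nabs x) (nabs y)
  exists_nabs_lt_one : ∃ p : K, p ≠ 0 ∧ nabs p < 1
  isCompact_nabs_le_one : IsCompact {x : K | nabs x ≤ 1}
  hasBasis_nhds_zero : (𝓝 (0 : K)).HasBasis (fun ε : ℝ => 0 < ε) fun ε => {x | nabs x < ε}

set_option linter.overlappingInstances false in
lemma IsUltrametric.of_isNonarchimedeanLocalField (K : Type*) [Field K] [TopologicalSpace K]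
    [IsTopologicalRing K] [LocallyCompactSpace K] [ValuativeRel K]
    [IsNonarchimedeanLocalField K] : IsUltrametric K where
  nabs_add_le x y := by
    rcases le_total (nabs x) (nabs y) with h | h
    · rw [max_eq_right h, nabs_le_iff]
      exact (ValuativeRel.valuation K).map_add_le (nabs_le_iff.1 h) le_rfl
    · rw [max_eq_left h, nabs_le_iff]
      exact (ValuativeRel.valuation K).map_add_le le_rfl (nabs_le_iff.1 h)
  exists_nabs_lt_one := by
    obtain ⟨p, hp, hp1⟩ := Valuation.IsNontrivial.exists_lt_one (v := ValuativeRel.valuation K)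
    exact ⟨p, hp, (nabs_le_one_of_valuation hp1.le).2 hp1⟩
  isCompact_nabs_le_one := by
    simp_rw [nabs_le_one_iff]
    exact IsNonarchimedeanLocalField.isCompact_closedBall K 1
  hasBasis_nhds_zero := by
    refine ⟨fun U => ?_⟩
    rw [IsValuativeTopology.mem_nhds_zero_iff]
    constructor
    · rintro ⟨γ, hγ⟩
      obtain ⟨r, hr⟩ := ValuativeRel.valuation_surjective (γ : ValuativeRel.ValueGroupWithZero K)
      have hr0 : r ≠ 0 := by
        rintro rfl
        rw [map_zero] at hr
        exact γ.ne_zero hr.symm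
      refine ⟨nabs r, nabs_pos hr0, fun x hx => hγ ?_⟩
      change ValuativeRel.valuation K x < γ
      rw [← hr]
      exact nabs_lt_iff.1 hx
    · rintro ⟨ε, hε, hU⟩
      obtain ⟨p, hp, hp1⟩ := Valuation.IsNontrivial.exists_lt_one (v := ValuativeRel.valuation K)
      have hp1' := (nabs_le_one_of_valuation hp1.le).2 hp1
      obtain ⟨n, hn⟩ := exists_pow_lt_of_lt_one hε hp1'
      refine ⟨Units.mk0 (ValuativeRel.valuation K (p ^ n)) (by simp [hp]), fun x hx => hU ?_⟩
      change ValuativeRel.valuation K x < ValuativeRel.valuation K (p ^ n) at hx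
      rw [← nabs_lt_iff, nabs_pow] at hx
      exact hx.trans hn

/-! ### Non-archimedean fields: locally constant functions, characters, Fourier stability -/

section Ultrametric

variable {K : Type*} [Field K] [TopologicalSpace K] [IsTopologicalRing K] [LocallyCompactSpace K]
  (hK : IsUltrametric K)

include hK

namespace IsUltrametric

lemma eventually_nabs_sub_lt (x : K) {ε : ℝ} (hε : 0 < ε) : ∀ᶠ y in 𝓝 x, nabs (y - x) < ε := by
  have h1 : Tendsto (fun y : K => y - x) (𝓝 x) (𝓝 0) := by
    have : Continuous fun y : K => y - x := continuous_id.sub continuous_const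
    simpa using this.tendsto x
  exact h1 (hK.hasBasis_nhds_zero.mem_of_mem hε)

lemma exists_forall_nabs_sub_lt {x : K} {U : Set K} (hU : U ∈ 𝓝 x) :
    ∃ ε > 0, ∀ y, nabs (y - x) < ε → y ∈ U := by
  have h1 : Tendsto (fun y : K => y + x) (𝓝 0) (𝓝 x) := by
    have : Continuous fun y : K => y + x := continuous_id.add continuous_const
    simpa using this.tendsto 0
  obtain ⟨ε, hε, h⟩ := hK.hasBasis_nhds_zero.mem_iff.1 (h1 hU)
  refine ⟨ε, hε, fun y hy => ?_⟩
  have := h hy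
  simpa using this

lemma nabs_eq_of_sub_lt {x y : K} (h : nabs (y - x) < nabs x) : nabs y = nabs x := by
  have h1 := hK.nabs_add_le (y - x) x
  have h2 := hK.nabs_add_le (-(y - x)) y
  rw [sub_add_cancel, max_eq_right h.le] at h1
  rw [nabs_neg, neg_sub, sub_add_cancel] at h2
  rcases le_max_iff.1 h2 with h3 | h3
  · linarith
  · exact le_antisymm h1 h3

lemma eventually_nabs_eq {x : K} (hx : x ≠ 0) : ∀ᶠ y in 𝓝 x, nabs y = nabs x :=
  (hK.eventually_nabs_sub_lt x (nabs_pos hx)).mono fun _ h => hK.nabs_eq_of_sub_lt h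

lemma continuous_nabs : Continuous (nabs : K → ℝ) := by
  rw [continuous_iff_continuousAt]
  intro x
  by_cases hx : x = 0
  · rw [hx, ContinuousAt, nabs_zero, Metric.tendsto_nhds]
    intro ε hε
    filter_upwards [hK.eventually_nabs_sub_lt 0 hε] with y hy
    rw [sub_zero] at hy
    rwa [Real.dist_eq, sub_zero, abs_of_nonneg (nabs_nonneg y)]
  · exact (continuousAt_const (y := nabs x)).congr
      ((hK.eventually_nabs_eq hx).mono fun y h => h.symm)

lemma sqrt_nabs_add_le (a b : K) : √(nabs (a + b)) ≤ √(nabs a) + √(nabs b) := by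
  have h := Real.sqrt_le_sqrt (hK.nabs_add_le a b)
  have h1 := Real.sqrt_nonneg (nabs a)
  have h2 := Real.sqrt_nonneg (nabs b)
  rcases max_choice (nabs a) (nabs b) with h3 | h3 <;> rw [h3] at h <;> linarith

lemma t2Space : T2Space K := by
  refine ⟨fun x y hxy => ?_⟩
  have hc : Continuous fun z : K => nabs (z - x) :=
    hK.continuous_nabs.comp (continuous_id.sub continuous_const)
  refine separated_by_continuous hc ?_
  rw [sub_self, nabs_zero]
  exact (nabs_pos (sub_ne_zero.2 hxy.symm)).ne

lemma isCompact_nabs_le (r : ℝ) : IsCompact {x : K | nabs x ≤ r} := by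
  obtain ⟨p, hp, hp1⟩ := hK.exists_nabs_lt_one
  obtain ⟨n, hn⟩ := exists_pow_lt_of_lt_one (show 0 < (|r| + 1)⁻¹ by positivity) hp1
  have hpn : p ^ n ≠ 0 := pow_ne_zero _ hp
  have h := hK.isCompact_nabs_le_one.image (continuous_const_mul (p ^ n)⁻¹)
  refine h.of_isClosed_subset (isClosed_le hK.continuous_nabs continuous_const) ?_
  intro x hx
  refine ⟨p ^ n * x, ?_, by simp [hpn]⟩
  simp only [Set.mem_ofPred_eq] at hx ⊢
  rw [nabs_mul, nabs_pow]
  calc nabs p ^ n * nabs x ≤ (|r| + 1)⁻¹ * (|r| + 1) := by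
        refine mul_le_mul hn.le ?_ (nabs_nonneg _) (by positivity)
        linarith [le_abs_self r]
    _ = 1 := inv_mul_cancel₀ (by positivity)

/-- Neighbourhoods of 0 are pulled back from ℝ by the module, so the uniformity is countably
generated and pseudometrizable; the closed balls make K σ-compact. -/
lemma secondCountableTopology : SecondCountableTopology K := by
  let := IsTopologicalAddGroup.rightUniformSpace K
  have := isUniformAddGroup_of_addCommGroup (G := K)
  have hcomap : 𝓝 (0 : K) = comap nabs (𝓝 (0 : ℝ)) := by
    refine le_antisymm ?_ ?_
    · have := hK.continuous_nabs.tendsto 0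
      rw [nabs_zero] at this
      exact this.le_comap
    · intro U hU
      obtain ⟨ε, hε, h⟩ := hK.hasBasis_nhds_zero.mem_iff.1 hU
      exact ⟨Set.Iio ε, Iio_mem_nhds hε, h⟩
  have : (𝓝 (0 : K)).IsCountablyGenerated := by
    rw [hcomap]
    infer_instance
  have : (uniformity K).IsCountablyGenerated := IsUniformAddGroup.uniformity_countably_generated
  let := UniformSpace.pseudoMetricSpace K
  have : SigmaCompactSpace K := by
    refine ⟨⟨fun n : ℕ => {x : K | nabs x ≤ n}, fun n => hK.isCompact_nabs_le n, ?_⟩⟩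
    refine Set.eq_univ_of_forall fun x => Set.mem_iUnion.2 ?_
    exact exists_nat_ge (nabs x)
  exact EMetric.secondCountable_of_sigmaCompact K

lemma isClopen_ball (x : K) {ε : ℝ} (hε : 0 < ε) : IsClopen {y : K | nabs (y - x) < ε} := by
  have hc : Continuous fun y : K => nabs (y - x) :=
    hK.continuous_nabs.comp (continuous_id.sub continuous_const)
  refine ⟨⟨?_⟩, isOpen_lt hc continuous_const⟩
  rw [isOpen_iff_mem_nhds]
  intro y hy
  filter_upwards [hK.eventually_nabs_sub_lt y hε] with z hz hzx
  apply hy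
  have h := hK.nabs_add_le (-(z - y)) (z - x)
  rw [show -(z - y) + (z - x) = y - x by ring, nabs_neg] at h
  exact h.trans_lt (max_lt hz hzx)

/-- The open unit ball is clopen and contains 0 but not 1. This rules out the two archimedean
alternatives in `IsSchwartzBruhat`. -/
lemma not_exists_homeomorph {E : Type*} [TopologicalSpace E] [PreconnectedSpace E] (f : E → K)
    (hf : Continuous f) (hs : Function.Surjective f) : False := by
  have h := ((hK.isClopen_ball 0 one_pos).preimage hf).eq_univ (by
    obtain ⟨a, ha⟩ := hs 0
    exact ⟨a, by simp [ha, nabs_zero]⟩)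
  obtain ⟨a, ha⟩ := hs 1
  have h1 : a ∈ f ⁻¹' {y : K | nabs (y - 0) < 1} := by rw [h]; trivial
  simp [ha, nabs_one] at h1

lemma isSchwartzBruhat_iff {α : K → ℂ} :
    IsSchwartzBruhat α ↔ IsLocallyConstant α ∧ HasCompactSupport α := by
  refine ⟨fun h => ?_, fun h => Or.inr (Or.inr h)⟩
  rcases h with ⟨e, _, he, _⟩ | ⟨e, _, he, _⟩ | h
  · exact (hK.not_exists_homeomorph _ he e.symm.surjective).elim
  · exact (hK.not_exists_homeomorph _ he e.symm.surjective).elim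
  · exact h

/-- Local constancy is uniform on the compact support; if only x + t lies in the support, argue from
x + t with -t. -/
lemma exists_forall_add_eq {α : K → ℂ} (h1 : IsLocallyConstant α) (h2 : HasCompactSupport α) :
    ∃ ε > 0, ∀ t, nabs t < ε → ∀ x, α (x + t) = α x := by
  obtain ⟨ε, hε, h⟩ : ∃ ε > 0, ∀ x ∈ tsupport α, ∀ t, nabs t < ε → α (x + t) = α x := by
    refine IsCompact.induction_on (p := fun s => ∃ ε > (0 : ℝ), ∀ x ∈ s, ∀ t, nabs t < ε →
      α (x + t) = α x) h2 ?_ ?_ ?_ ?_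
    · exact ⟨1, one_pos, by simp⟩
    · rintro s t hst ⟨ε, hε, h⟩
      exact ⟨ε, hε, fun x hx => h x (hst hx)⟩
    · rintro s t ⟨ε, hε, h⟩ ⟨ε', hε', h'⟩
      refine ⟨min ε ε', lt_min hε hε', ?_⟩
      rintro x (hx | hx) t ht
      · exact h x hx t (ht.trans_le (min_le_left _ _))
      · exact h' x hx t (ht.trans_le (min_le_right _ _))
    · intro x _
      obtain ⟨ε, hε, h⟩ := hK.exists_forall_nabs_sub_lt
        ((IsLocallyConstant.iff_eventually_eq α).1 h1 x)
      refine ⟨{y | nabs (y - x) < ε},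
        mem_nhdsWithin_of_mem_nhds (hK.eventually_nabs_sub_lt x hε), ε, hε, fun y hy t ht => ?_⟩
      have h3 : nabs (y + t - x) < ε := by
        rw [show y + t - x = (y - x) + t by ring]
        exact (hK.nabs_add_le _ _).trans_lt (max_lt hy ht)
      exact (h _ h3).trans (h _ hy).symm
  refine ⟨ε, hε, fun t ht x => ?_⟩
  by_cases hx : x ∈ tsupport α
  · exact h x hx t ht
  by_cases hxt : x + t ∈ tsupport α
  · have := h (x + t) hxt (-t) (by rwa [nabs_neg])
    rw [add_neg_cancel_right] at this
    exact this.symm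
  · rw [image_eq_zero_of_notMem_tsupport hx, image_eq_zero_of_notMem_tsupport hxt]

lemma exists_bound {α : K → ℂ} (h1 : IsLocallyConstant α) (h2 : HasCompactSupport α) :
    ∃ C : ℝ, 0 ≤ C ∧ ∀ t x : K, nabs t ≤ 1 → ‖α x‖ ≤ C * ((1 + nabs x) ^ 2)⁻¹ ∧
      ‖α (x + t) - α x‖ ≤ C * √(nabs t) * ((1 + nabs x) ^ 2)⁻¹ ∧
      ‖α (x + t) - 2 * α x + α (x - t)‖ ≤ C * nabs t * ((1 + nabs x) ^ 2)⁻¹ := by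
  obtain ⟨C₁, hC₁⟩ : ∃ C, ∀ x, ‖α x * (((1 + nabs x) ^ 2 : ℝ) : ℂ)‖ ≤ C := by
    refine Continuous.bounded_above_of_compact_support ?_ (HasCompactSupport.mul_right h2)
    exact h1.continuous.mul (Complex.continuous_ofReal.comp
      ((continuous_const.add hK.continuous_nabs).pow 2))
  have hC₁0 : 0 ≤ C₁ := (norm_nonneg _).trans (hC₁ 0)
  have hb : ∀ x, ‖α x‖ ≤ C₁ * ((1 + nabs x) ^ 2)⁻¹ := by
    intro x
    have hn := nabs_nonneg x
    have := hC₁ x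
    rw [norm_mul, Complex.norm_real, Real.norm_of_nonneg (by positivity)] at this
    rwa [← div_eq_mul_inv, le_div_iff₀ (by positivity)]
  obtain ⟨ε₀, hε₀, hε₀'⟩ := hK.exists_forall_add_eq h1 h2
  obtain ⟨ε, hε, hε1, hεle⟩ : ∃ ε : ℝ, 0 < ε ∧ ε ≤ 1 ∧ ε ≤ ε₀ :=
    ⟨min ε₀ 1, lt_min hε₀ one_pos, min_le_right _ _, min_le_left _ _⟩
  have hle : C₁ ≤ 20 * C₁ / ε := by
    rw [le_div_iff₀ hε]
    nlinarith
  -- Differences vanish for |t| < ε. For ε ≤ |t| ≤ 1 the triangle inequality gives at most 9 + 2 + 9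
  -- = 20 times C₁ w, and |t|/ε ≥ 1.
  refine ⟨20 * C₁ / ε, by positivity, fun t x ht => ⟨?_, ?_⟩⟩
  · refine (hb x).trans ?_
    have hn := nabs_nonneg x
    gcongr
  · have hn := nabs_nonneg x
    have hnt := nabs_nonneg t
    set w := ((1 + nabs x) ^ 2)⁻¹ with hw
    have hw0 : 0 ≤ w := by positivity
    rcases lt_or_ge (nabs t) ε with hlt | hge
    · have e1 := hε₀' t (hlt.trans_le hεle) x
      have e2 := hε₀' (-t) (by rw [nabs_neg]; exact hlt.trans_le hεle) x
      rw [sub_eq_add_neg x t, e1, e2, sub_self, norm_zero,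
        show α x - 2 * α x + α x = 0 by ring, norm_zero]
      constructor <;> positivity
    · have b1 : ‖α (x + t)‖ ≤ C₁ * (9 * w) := (hb _).trans
        (mul_le_mul_of_nonneg_left (inv_sq_le_nine_mul hK.sqrt_nabs_add_le ht) hC₁0)
      have b2 : ‖α (x - t)‖ ≤ C₁ * (9 * w) := by
        rw [sub_eq_add_neg]
        exact (hb _).trans (mul_le_mul_of_nonneg_left
          (inv_sq_le_nine_mul hK.sqrt_nabs_add_le (by rwa [nabs_neg])) hC₁0)
      have hs : nabs t ≤ √(nabs t) := by
        rw [Real.le_sqrt hnt hnt]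
        nlinarith
      have h3 : 20 * C₁ * w ≤ 20 * C₁ / ε * nabs t * w := by
        refine mul_le_mul_of_nonneg_right ?_ hw0
        rw [div_mul_eq_mul_div, le_div_iff₀ hε]
        exact mul_le_mul_of_nonneg_left hge (by positivity)
      have h4 : 20 * C₁ / ε * nabs t * w ≤ 20 * C₁ / ε * √(nabs t) * w := by gcongr
      have h5 : 0 ≤ C₁ * w := by positivity
      have h6 := hb x
      constructor
      · refine le_trans ?_ (h3.trans h4)
        calc _ ≤ ‖α (x + t)‖ + ‖α x‖ := norm_sub_le _ _
          _ ≤ _ := by nlinarith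
      · refine le_trans ?_ h3
        calc _ ≤ ‖α (x + t)‖ + ‖2 * α x‖ + ‖α (x - t)‖ :=
              norm_add_le_of_le (norm_sub_le _ _) le_rfl
          _ ≤ _ := by rw [norm_mul, Complex.norm_ofNat]; nlinarith

lemma exists_bump {U : Set K} (hU : U ∈ 𝓝 (1 : K)) : ∃ f : K → ℝ, Continuous f ∧
    HasCompactSupport f ∧ (∀ x, 0 ≤ f x) ∧ f 1 ≠ 0 ∧ Function.support f ⊆ U ∧
    IsSchwartzBruhat fun x => (f x : ℂ) := by
  obtain ⟨ε, hε, h⟩ := hK.exists_forall_nabs_sub_lt hU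
  have hb := hK.isClopen_ball 1 hε
  set B := {y : K | nabs (y - 1) < ε}
  have hBc : IsCompact B := by
    refine (hK.isCompact_nabs_le (max ε 1)).of_isClosed_subset hb.1 fun y hy => ?_
    have hy : nabs (y - 1) < ε := hy
    have := hK.nabs_add_le (y - 1) 1
    rw [sub_add_cancel, nabs_one] at this
    exact this.trans (max_le_max hy.le le_rfl)
  have hlc : IsLocallyConstant (B.indicator fun _ => (1 : ℝ)) := by
    rw [IsLocallyConstant.iff_eventually_eq]
    intro x
    by_cases hx : x ∈ B
    · filter_upwards [hb.2.mem_nhds hx] with y hy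
      rw [Set.indicator_of_mem hx, Set.indicator_of_mem hy]
    · filter_upwards [hb.1.isOpen_compl.mem_nhds hx] with y hy
      rw [Set.indicator_of_notMem hx, Set.indicator_of_notMem hy]
  have hT2 := hK.t2Space
  have hcs : HasCompactSupport (B.indicator fun _ => (1 : ℝ)) :=
    HasCompactSupport.intro hBc fun x hx => Set.indicator_of_notMem hx _
  refine ⟨B.indicator fun _ => (1 : ℝ), hlc.continuous, hcs,
    fun x => Set.indicator_nonneg (fun _ _ => zero_le_one) x, ?_, ?_,
    Or.inr (Or.inr ⟨hlc.comp Complex.ofReal, hcs.comp_left Complex.ofReal_zero⟩)⟩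
  · have : (1 : K) ∈ B := by simpa [B, nabs_zero] using hε
    rw [Set.indicator_of_mem this]
    exact one_ne_zero
  · intro x hx
    have hxB : x ∈ B := Set.support_indicator_subset hx
    exact h x hxB

lemma isPuncturedTest_opA {α : K → ℂ} (hα : IsPuncturedTest α) : IsPuncturedTest (opA α) := by
  obtain ⟨hα, h0⟩ := hα
  obtain ⟨h1, h2⟩ := hK.isSchwartzBruhat_iff.1 hα
  have h0' : ∀ᶠ y in 𝓝 (0 : K), opA α y = 0 := h0.mono fun y hy => by simp [opA, hy]
  refine ⟨Or.inr (Or.inr ⟨?_, HasCompactSupport.mul_left h2⟩), h0'⟩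
  rw [IsLocallyConstant.iff_eventually_eq]
  intro x
  by_cases hx : x = 0
  · subst hx
    filter_upwards [h0'] with y hy
    rw [hy, h0'.self_of_nhds]
  · filter_upwards [hK.eventually_nabs_eq hx,
      (IsLocallyConstant.iff_eventually_eq α).1 h1 x] with y hy hy'
    simp only [opA, hy, hy']

theorem localAnalysis [ContinuousInv₀ K] : LocalAnalysis K where
  toT2Space := hK.t2Space
  toSecondCountableTopology := hK.secondCountableTopology
  continuous_nabs := hK.continuous_nabs
  sqrt_nabs_add_le := hK.sqrt_nabs_add_le
  exists_nabs_lt_one := hK.exists_nabs_lt_one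
  isCompact_nabs_le_one := hK.isCompact_nabs_le_one
  continuous_of_isSchwartzBruhat hα := (hK.isSchwartzBruhat_iff.1 hα).1.continuous
  isSchwartzBruhat_comp_neg hα := by
    obtain ⟨h1, h2⟩ := hK.isSchwartzBruhat_iff.1 hα
    exact Or.inr (Or.inr ⟨h1.comp_continuous continuous_neg,
      h2.comp_homeomorph (Homeomorph.neg K)⟩)
  exists_bound hα := by
    obtain ⟨h1, h2⟩ := hK.isSchwartzBruhat_iff.1 hα
    exact hK.exists_bound h1 h2
  exists_bump hU := hK.exists_bump hU
  isPuncturedTest_opA hα := hK.isPuncturedTest_opA hα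

-- The circle has no small subgroups: z² - 1 = (z - 1)(z + 1) with |z + 1| ≥ 3/2, so repeated
-- squaring pushes z ≠ 1 away from 1 geometrically.
omit hK in
lemma _root_.Circle.eq_one_of_forall_pow {c : Circle} (h : ∀ n : ℕ, ‖(c : ℂ) ^ n - 1‖ ≤ 1 / 2) :
    c = 1 := by
  have key : ∀ n : ℕ, (3 / 2 : ℝ) ^ n * ‖(c : ℂ) - 1‖ ≤ ‖(c : ℂ) ^ (2 ^ n) - 1‖ := by
    intro n
    induction n with
    | zero => simp
    | succ n ih =>
      have e : (c : ℂ) ^ (2 ^ (n + 1)) - 1 =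
          ((c : ℂ) ^ (2 ^ n) - 1) * (2 + ((c : ℂ) ^ (2 ^ n) - 1)) := by
        rw [pow_succ 2 n, pow_mul]
        ring
      have h2 : (3 / 2 : ℝ) ≤ ‖2 + ((c : ℂ) ^ (2 ^ n) - 1)‖ := by
        have := norm_sub_le_norm_add (2 : ℂ) ((c : ℂ) ^ (2 ^ n) - 1)
        rw [Complex.norm_ofNat] at this
        linarith [h (2 ^ n)]
      rw [e, norm_mul, pow_succ]
      nlinarith [norm_nonneg ((c : ℂ) ^ (2 ^ n) - 1)]
  by_contra hc
  have hpos : 0 < ‖(c : ℂ) - 1‖ := by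
    rw [norm_pos_iff, sub_ne_zero]
    exact fun h => hc (Circle.ext h)
  obtain ⟨n, hn⟩ := pow_unbounded_of_one_lt (1 / ‖(c : ℂ) - 1‖) (show (1 : ℝ) < 3 / 2 by norm_num)
  rw [div_lt_iff₀ hpos] at hn
  linarith [key n, h (2 ^ n)]

/-- Balls around 0 are stable under x ↦ nx, so all powers of λ(x) stay close to 1. -/
lemma exists_forall_addChar_eq_one {lam : AddChar K Circle} (hlam : Continuous lam) :
    ∃ ρ > 0, ∀ x : K, nabs x < ρ → lam x = 1 := by
  have hc : Continuous fun x => ‖(lam x : ℂ) - 1‖ :=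
    ((continuous_subtype_val.comp hlam).sub continuous_const).norm
  have h0 : ∀ᶠ x in 𝓝 (0 : K), ‖(lam x : ℂ) - 1‖ < 1 / 2 :=
    (hc.tendsto 0).eventually_lt_const (by simp)
  obtain ⟨ρ, hρ, h⟩ := hK.hasBasis_nhds_zero.mem_iff.1 h0
  refine ⟨ρ, hρ, fun x hx => Circle.eq_one_of_forall_pow fun n => ?_⟩
  have hn : nabs (n • x) < ρ := by
    induction n with
    | zero => simpa [nabs_zero] using hρ
    | succ n ih =>
      rw [succ_nsmul]
      exact (hK.nabs_add_le _ _).trans_lt (max_lt ih hx)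
  have h1 : ‖(lam (n • x) : ℂ) - 1‖ < 1 / 2 := h hn
  rw [AddChar.map_nsmul_eq_pow, Circle.coe_pow] at h1
  exact h1.le

variable [MeasurableSpace K] [BorelSpace K] (μ : Measure K) [μ.IsAddHaarMeasure]

theorem isSchwartzBruhat_fourierTr {lam : AddChar K Circle} (hlam : Continuous lam)
    (hlam1 : ∃ x, lam x ≠ 1) {α : K → ℂ} (hα : IsSchwartzBruhat α) :
    IsSchwartzBruhat (fourierTr lam μ α) := by
  obtain ⟨h1, h2⟩ := hK.isSchwartzBruhat_iff.1 hα
  have hT2 := hK.t2Space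
  have hSC := hK.secondCountableTopology
  refine Or.inr (Or.inr ⟨?_, ?_⟩)
  · obtain ⟨ρ, hρ, hρ'⟩ := hK.exists_forall_addChar_eq_one hlam
    obtain ⟨R, hR⟩ := h2.isCompact.exists_bound_of_continuousOn hK.continuous_nabs.continuousOn
    rw [IsLocallyConstant.iff_eventually_eq]
    intro x
    filter_upwards [hK.eventually_nabs_sub_lt x (show 0 < ρ / (|R| + 1) by positivity)] with z hz
    refine integral_congr_ae (ae_of_all _ fun y => ?_)
    by_cases hy : y ∈ tsupport α
    · have h3 : nabs y ≤ |R| + 1 := by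
        have := hR y hy
        rw [Real.norm_of_nonneg (nabs_nonneg y)] at this
        linarith [le_abs_self R]
      have h4 : nabs (-((z - x) * y)) < ρ := by
        rw [nabs_neg, nabs_mul]
        rw [lt_div_iff₀ (by positivity)] at hz
        exact (mul_le_mul_of_nonneg_left h3 (nabs_nonneg _)).trans_lt hz
      have h5 : lam (-(z * y)) = lam (-(x * y)) := by
        rw [show -(z * y) = -((z - x) * y) + -(x * y) by ring, AddChar.map_add_eq_mul, hρ' _ h4,
          one_mul]
      simp only [h5]
    · simp only [image_eq_zero_of_notMem_tsupport hy, zero_mul]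
  · obtain ⟨ε, hε, hε'⟩ := hK.exists_forall_add_eq h1 h2
    obtain ⟨x₀, hx₀⟩ := hlam1
    refine HasCompactSupport.intro (hK.isCompact_nabs_le (nabs x₀ / ε)) fun x hx => ?_
    simp only [Set.mem_ofPred_eq, not_le] at hx
    have hnx : 0 < nabs x := lt_of_le_of_lt (div_nonneg (nabs_nonneg _) hε.le) hx
    have hx0 : x ≠ 0 := by rintro rfl; simp [nabs_zero] at hnx
    have ht : nabs (x₀ / x) < ε := by
      rw [nabs_div, div_lt_iff₀ hnx, mul_comm]
      exact (div_lt_iff₀ hε).1 hx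
    -- For large |x| the function α is invariant under translation by x₀/x, which multiplies the
    -- transform at x by λ(-x₀) ≠ 1; so the transform vanishes there.
    have key : fourierTr lam μ α x = (lam (-x₀) : ℂ) * fourierTr lam μ α x := by
      conv_lhs => rw [fourierTr, ← integral_add_right_eq_self _ (x₀ / x)]
      rw [fourierTr, ← integral_const_mul]
      refine integral_congr_ae (ae_of_all _ fun y => ?_)
      have h3 : lam (-(x * (y + x₀ / x))) = lam (-x₀) * lam (-(x * y)) := by
        rw [← AddChar.map_add_eq_mul]
        congr 1
        field_simp
        ring
      simp only [hε' _ ht y, h3, Circle.coe_mul]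
      ring
    have hne : (1 : ℂ) - lam (-x₀) ≠ 0 := by
      rw [sub_ne_zero]
      intro h
      apply hx₀
      have h3 : lam (-x₀) = 1 := (Circle.ext h).symm
      rw [AddChar.map_neg_eq_inv, inv_eq_one] at h3
      exact h3
    have h4 : (1 - (lam (-x₀) : ℂ)) * fourierTr lam μ α x = 0 := by linear_combination key
    exact (mul_eq_zero.1 h4).resolve_left hne

end IsUltrametric

end Ultrametric

/-! ### Schwartz functions: difference bounds and multiplication by the logarithm -/

section Schwartz

variable {E F : Type*} [NormedAddCommGroup E] [NormedSpace ℝ E] [NormedAddCommGroup F]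
  [NormedSpace ℝ F]

lemma exists_norm_schwartz_le (f : 𝓢(E, F)) :
    ∃ C : ℝ, 0 ≤ C ∧ ∀ x, ‖f x‖ ≤ C * ((1 + ‖x‖) ^ 4)⁻¹ := by
  refine ⟨2 ^ 4 * ((Finset.Iic (4, 0)).sup fun m => SchwartzMap.seminorm ℝ m.1 m.2) f,
    mul_nonneg (by positivity) (apply_nonneg _ _), fun x => ?_⟩
  have h := SchwartzMap.one_add_le_sup_seminorm_apply (𝕜 := ℝ) (m := (4, 0)) le_rfl le_rfl f x
  rw [norm_iteratedFDeriv_zero] at h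
  rw [← div_eq_mul_inv, le_div_iff₀ (by positivity), mul_comm]
  exact h

lemma inv_pow_four_le {x y : E} (h : ‖y - x‖ ≤ 1) :
    ((1 + ‖y‖) ^ 4)⁻¹ ≤ 16 * ((1 + ‖x‖) ^ 4)⁻¹ := by
  have h1 : ‖x‖ ≤ ‖y‖ + 1 := by
    have := norm_le_norm_add_norm_sub y x
    linarith
  have h2 : 1 + ‖x‖ ≤ 2 * (1 + ‖y‖) := by linarith [norm_nonneg y]
  rw [← div_eq_mul_inv, le_div_iff₀ (by positivity), inv_mul_le_iff₀ (by positivity)]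
  calc (1 + ‖x‖) ^ 4 ≤ (2 * (1 + ‖y‖)) ^ 4 := by gcongr
    _ = _ := by ring

lemma exists_norm_schwartz_diff_le (f : 𝓢(E, F)) : ∃ C : ℝ, 0 ≤ C ∧ ∀ x t : E, ‖t‖ ≤ 1 →
    ‖f (x + t) - f x‖ ≤ C * ‖t‖ * ((1 + ‖x‖) ^ 4)⁻¹ := by
  obtain ⟨C, hC, h⟩ := exists_norm_schwartz_le (SchwartzMap.fderivCLM ℝ E F f)
  refine ⟨16 * C, by positivity, fun x t ht => ?_⟩
  have := (convex_closedBall x 1).norm_image_sub_le_of_norm_fderiv_le (𝕜 := ℝ) (f := f)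
    (C := 16 * C * ((1 + ‖x‖) ^ 4)⁻¹) (x := x) (y := x + t) (fun y _ => f.differentiableAt)
    (fun y hy => ?_) (by simp) (by simpa [mem_closedBall_iff_norm] using ht)
  · rw [add_sub_cancel_left] at this
    linarith
  · have h1 := h y
    rw [SchwartzMap.fderivCLM_apply] at h1
    have h2 := inv_pow_four_le (mem_closedBall_iff_norm.1 hy)
    calc _ ≤ _ := h1
      _ ≤ C * (16 * ((1 + ‖x‖) ^ 4)⁻¹) := by gcongr
      _ = _ := by ring

/-- The mean value inequality for y ↦ f(y+t) - f(y), whose derivative is a first difference of the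
Schwartz function Df. -/
lemma exists_norm_schwartz_second_diff_le (f : 𝓢(E, F)) : ∃ C : ℝ, 0 ≤ C ∧ ∀ x t : E, ‖t‖ ≤ 1 →
    ‖f (x + t) - (2 : ℝ) • f x + f (x - t)‖ ≤ C * ‖t‖ ^ 2 * ((1 + ‖x‖) ^ 4)⁻¹ := by
  obtain ⟨C, hC, h⟩ := exists_norm_schwartz_diff_le (SchwartzMap.fderivCLM ℝ E F f)
  refine ⟨16 * C, by positivity, fun x t ht => ?_⟩
  have hd : ∀ y, HasFDerivAt (fun y => f (y + t) - f y) (fderiv ℝ f (y + t) - fderiv ℝ f y) y := by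
    intro y
    have h1 : HasFDerivAt (fun y => f (y + t)) (fderiv ℝ f (y + t)) y :=
      (hasFDerivAt_comp_add_right t).2 f.differentiableAt.hasFDerivAt
    exact h1.sub f.differentiableAt.hasFDerivAt
  have := (convex_closedBall x 1).norm_image_sub_le_of_norm_fderiv_le (𝕜 := ℝ)
    (f := fun y => f (y + t) - f y) (C := 16 * C * ‖t‖ * ((1 + ‖x‖) ^ 4)⁻¹) (x := x - t) (y := x)
    (fun y _ => (hd y).differentiableAt) (fun y hy => ?_)
    (by simpa [mem_closedBall_iff_norm] using ht) (by simp)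
  · rw [sub_sub_cancel, sub_add_cancel] at this
    rw [show f (x + t) - (2 : ℝ) • f x + f (x - t) = f (x + t) - f x - (f x - f (x - t)) by
      rw [two_smul]; abel]
    linarith
  · rw [(hd y).fderiv]
    have h1 := h y t ht
    simp only [SchwartzMap.fderivCLM_apply] at h1
    have h2 := inv_pow_four_le (mem_closedBall_iff_norm.1 hy)
    calc _ ≤ _ := h1
      _ ≤ C * ‖t‖ * (16 * ((1 + ‖x‖) ^ 4)⁻¹) := by gcongr
      _ = _ := by ring

lemma exists_norm_iteratedDeriv_log_le {c : ℝ} (hc : 0 < c) (n : ℕ) :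
    ∃ C : ℝ, 0 ≤ C ∧ ∀ x, c < x → ‖iteratedDeriv n Real.log x‖ ≤ C * (1 + ‖x‖) := by
  cases n with
  | zero =>
    refine ⟨1 + c⁻¹, by positivity, fun x hx => ?_⟩
    have hx0 : 0 < x := hc.trans hx
    have h1 := Real.log_le_sub_one_of_pos hx0
    have h2 := Real.log_le_sub_one_of_pos (inv_pos.2 hx0)
    rw [Real.log_inv] at h2
    have h3 : x⁻¹ ≤ c⁻¹ := inv_anti₀ hc hx.le
    have h4 : 0 < c⁻¹ := inv_pos.2 hc
    rw [iteratedDeriv_zero, Real.norm_eq_abs, Real.norm_of_nonneg hx0.le, abs_le]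
    constructor <;> nlinarith
  | succ n =>
    refine ⟨n.factorial * c ^ (-1 - (n : ℤ)), by positivity, fun x hx => ?_⟩
    have hx0 : 0 < x := hc.trans hx
    rw [iteratedDeriv_succ', Real.deriv_log', iteratedDeriv_eq_iterate]
    rw [iter_deriv_inv, norm_mul, norm_mul, norm_pow, norm_neg, norm_one, one_pow, one_mul,
      Real.norm_of_nonneg (by positivity), Real.norm_of_nonneg (by positivity),
      Real.norm_of_nonneg hx0.le]
    have h1 : x ^ (-1 - (n : ℤ)) ≤ c ^ (-1 - (n : ℤ)) := by
      rw [show (-1 - (n : ℤ)) = -((n + 1 : ℕ) : ℤ) by push_cast; ring, zpow_neg, zpow_neg,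
        zpow_natCast, zpow_natCast]
      exact inv_anti₀ (by positivity) (by gcongr)
    calc _ ≤ n.factorial * c ^ (-1 - (n : ℤ)) * 1 := by rw [mul_one]; gcongr
      _ ≤ _ := by gcongr; linarith

lemma hasTemperateGrowth_log_comp {p : E → ℝ} (hp : p.HasTemperateGrowth) {c : ℝ} (hc : 0 < c)
    (hcp : ∀ x, c < p x) : (fun x => Real.log (p x)).HasTemperateGrowth := by
  have hne : ∀ x ∈ Set.Ioi c, x ≠ 0 := fun x hx => (hc.trans hx).ne'
  refine hp.comp' (g := Real.log) (t := Set.Ioi c) (by rintro _ ⟨x, rfl⟩; exact hcp x)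
    isOpen_Ioi.uniqueDiffOn (fun x hx => (Real.contDiffAt_log.2 (hne x hx)).contDiffWithinAt)
    fun N => ?_
  choose C hC0 hC using fun n => exists_norm_iteratedDeriv_log_le hc n
  refine ⟨1, ∑ n ∈ Finset.range (N + 1), C n, Finset.sum_nonneg fun n _ => hC0 n,
    fun n hn x hx => ?_⟩
  rw [norm_iteratedFDerivWithin_eq_norm_iteratedDerivWithin,
    iteratedDerivWithin_of_isOpen isOpen_Ioi hx, pow_one]
  refine (hC n x hx).trans (mul_le_mul_of_nonneg_right ?_ (by positivity))
  exact Finset.single_le_sum (f := C) (fun i _ => hC0 i) (Finset.mem_range.2 (by omega))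

end Schwartz

lemma exists_schwartz_log_mul {H : Type*} [NormedAddCommGroup H] [InnerProductSpace ℝ H]
    [FiniteDimensional ℝ H] (f : 𝓢(H, ℂ)) (h0 : ∀ᶠ x in 𝓝 (0 : H), f x = 0) (d : ℕ) :
    ∃ g : 𝓢(H, ℂ), ∀ x, g x = (Real.log (‖x‖ ^ d) : ℂ) * f x := by
  obtain ⟨r, hr, hf⟩ := Metric.eventually_nhds_iff.1 h0
  -- Adding η to ‖x‖² keeps the argument of the logarithm away from 0 without changing it where f
  -- may be nonzero. So (d/2) log(‖x‖² + η) is a smooth multiplier of temperate growth with the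
  -- required product.
  let η : ContDiffBump (0 : H) := ⟨r / 2, r, half_pos hr, half_lt_self hr⟩
  have hp : (fun x : H => ‖x‖ ^ 2 + η x).HasTemperateGrowth :=
    (Function.hasTemperateGrowth_norm_sq H).add
      (η.hasCompactSupport.hasTemperateGrowth η.contDiff)
  have hpos : ∀ x : H, min 1 ((r / 2) ^ 2) / 2 < ‖x‖ ^ 2 + η x := by
    intro x
    have hmin : 0 < min 1 ((r / 2) ^ 2) := lt_min one_pos (by positivity)
    have hη : 0 ≤ η x := η.nonneg
    rcases le_total ‖x‖ (r / 2) with h | h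
    · have h1 : η x = 1 := η.one_of_mem_closedBall (by simpa using h)
      have := min_le_left 1 ((r / 2) ^ 2)
      rw [h1]
      nlinarith [sq_nonneg ‖x‖]
    · have h1 : (r / 2) ^ 2 ≤ ‖x‖ ^ 2 := by gcongr
      have := min_le_right 1 ((r / 2) ^ 2)
      linarith
  have hlog := hasTemperateGrowth_log_comp hp
    (half_pos (lt_min one_pos (show 0 < (r / 2) ^ 2 by positivity))) hpos
  have hmul : (fun x : H => ((d / 2 : ℝ) : ℂ) * (Real.log (‖x‖ ^ 2 + η x) : ℂ)).HasTemperateGrowth :=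
    (Function.HasTemperateGrowth.const _).mul (Function.HasTemperateGrowth.comp (g := Complex.ofReal) (by fun_prop) hlog)
  refine ⟨SchwartzMap.smulLeftCLM ℂ
    (fun x : H => ((d / 2 : ℝ) : ℂ) * (Real.log (‖x‖ ^ 2 + η x) : ℂ)) f, fun x => ?_⟩
  rw [SchwartzMap.smulLeftCLM_apply_apply hmul, smul_eq_mul]
  rcases lt_or_ge ‖x‖ r with h | h
  · rw [hf (by simpa using h), mul_zero, mul_zero]
  · have h1 : η x = 0 := η.zero_of_le_dist (by simpa using h)
    rw [h1, add_zero, Real.log_pow, Real.log_pow]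
    push_cast
    ring

/-! ### Continuous unitary characters of ℝ and ℂ -/

section Character

/-- Integrating λ(x+y) = λ(x)λ(y) over y in an interval with nonzero integral shows that λ is
differentiable; it then solves f' = bf, and |f| = 1 makes b imaginary. -/
lemma exists_addChar_real_eq {lam : AddChar ℝ Circle} (hlam : Continuous lam) :
    ∃ a : ℝ, ∀ t, (lam t : ℂ) = Complex.exp ((2 * Real.pi * (a * t) : ℝ) * Complex.I) := by
  set f : ℝ → ℂ := fun t => (lam t : ℂ) with hf
  have hfc : Continuous f := continuous_subtype_val.comp hlam
  have hadd : ∀ x y, f (x + y) = f x * f y := fun x y => by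
    simp [hf, AddChar.map_add_eq_mul]
  have hf0 : f 0 = 1 := by simp [hf]
  have hprim : ∀ x, HasDerivAt (fun u => ∫ t in (0 : ℝ)..u, f t) (f x) x := fun x =>
    intervalIntegral.integral_hasDerivAt_right (hfc.intervalIntegrable _ _)
      (hfc.stronglyMeasurableAtFilter _ _) hfc.continuousAt
  obtain ⟨r, hr⟩ : ∃ r : ℝ, (∫ t in (0 : ℝ)..r, f t) ≠ 0 := by
    by_contra! h
    have h1 := hprim 0
    have h2 : (fun u => ∫ t in (0 : ℝ)..u, f t) = fun _ => 0 := funext h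
    rw [h2, hf0] at h1
    exact zero_ne_one ((hasDerivAt_const (0 : ℝ) (0 : ℂ)).unique h1)
  set c := ∫ t in (0 : ℝ)..r, f t with hc
  have hshift : ∀ x, f x * c = (∫ t in (0 : ℝ)..(x + r), f t) - ∫ t in (0 : ℝ)..x, f t := by
    intro x
    rw [intervalIntegral.integral_interval_sub_left (hfc.intervalIntegrable _ _)
      (hfc.intervalIntegrable _ _), hc, ← intervalIntegral.integral_const_mul]
    simp_rw [← hadd]
    rw [intervalIntegral.integral_comp_add_left (fun t => f t) x, add_zero]
  have hder : ∀ x, HasDerivAt f ((f r - 1) / c * f x) x := by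
    intro x
    have h1 : HasDerivAt (fun x => ((∫ t in (0 : ℝ)..(x + r), f t) - ∫ t in (0 : ℝ)..x, f t) / c)
        ((f (x + r) - f x) / c) x :=
      (((hprim (x + r)).comp_add_const x r).sub (hprim x)).div_const c
    have h2 : f = fun x => ((∫ t in (0 : ℝ)..(x + r), f t) - ∫ t in (0 : ℝ)..x, f t) / c := by
      ext y
      rw [← hshift, mul_div_cancel_right₀ _ hr]
    rw [← h2] at h1
    refine h1.congr_deriv ?_
    rw [hadd]
    ring
  set b := (f r - 1) / c
  have hexp : ∀ x, f x = Complex.exp (b * x) := by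
    have hd : ∀ x : ℝ, HasDerivAt (fun x : ℝ => f x * Complex.exp (-(b * x))) 0 x := by
      intro x
      have h1 : HasDerivAt (fun x : ℝ => -(b * (x : ℂ))) (-(b * 1)) x :=
        ((Complex.ofRealCLM.hasDerivAt (x := x)).const_mul b).neg
      refine ((hder x).mul h1.cexp).congr_deriv ?_
      ring
    intro x
    have h1 := is_const_of_deriv_eq_zero (fun x => (hd x).differentiableAt)
      (fun x => (hd x).deriv) x 0
    simp only [hf0, Complex.ofReal_zero, mul_zero, neg_zero, Complex.exp_zero, mul_one] at h1
    rw [Complex.exp_neg] at h1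
    exact (mul_inv_eq_one₀ (Complex.exp_ne_zero _)).1 h1
  have hre : b.re = 0 := by
    have h1 : ‖f 1‖ = 1 := Circle.norm_coe _
    rw [hexp, Complex.norm_exp, Real.exp_eq_one_iff] at h1
    simpa using h1
  refine ⟨b.im / (2 * Real.pi), fun t => ?_⟩
  change f t = _
  rw [hexp]
  congr 1
  have hpi : (2 * Real.pi * (b.im / (2 * Real.pi) * t)) = b.im * t := by
    have := Real.pi_pos
    field_simp
  rw [hpi]
  apply Complex.ext <;> simp [hre]

lemma exists_addChar_rclike_eq {𝕜 : Type*} [RCLike 𝕜] {lam : AddChar 𝕜 Circle}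
    (hlam : Continuous lam) : ∃ w : 𝕜, ∀ z, (lam z : ℂ) =
      Complex.exp ((2 * Real.pi * RCLike.re (w * z) : ℝ) * Complex.I) := by
  have key : ∀ v : 𝕜, ∃ a : ℝ, ∀ t : ℝ, (lam ((t : 𝕜) * v) : ℂ) =
      Complex.exp ((2 * Real.pi * (a * t) : ℝ) * Complex.I) := by
    intro v
    let L := ContinuousLinearMap.toSpanSingleton ℝ v
    obtain ⟨a, ha⟩ := exists_addChar_real_eq
      (lam := lam.compAddMonoidHom (L : ℝ →ₗ[ℝ] 𝕜).toAddMonoidHom) (hlam.comp L.continuous)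
    refine ⟨a, fun t => ?_⟩
    rw [← ha t, ← RCLike.real_smul_eq_coe_mul]
    rfl
  obtain ⟨a, ha⟩ := key 1
  obtain ⟨b, hb⟩ := key RCLike.I
  -- Chosen so that Re(wz) = a Re z + b Im z; over ℝ both `RCLike.I` and Im z vanish.
  refine ⟨(a : 𝕜) - (b : 𝕜) * RCLike.I, fun z => ?_⟩
  conv_lhs => rw [← RCLike.re_add_im z]
  have h1 := ha (RCLike.re z)
  rw [mul_one] at h1
  rw [AddChar.map_add_eq_mul, Circle.coe_mul, h1, hb, ← Complex.exp_add, ← add_mul]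
  congr 2
  have h2 := RCLike.mul_im_I_ax z
  have h3 : RCLike.re (((a : 𝕜) - (b : 𝕜) * RCLike.I) * z) =
      a * RCLike.re z + b * RCLike.im z := by
    simp only [RCLike.mul_re, map_sub, RCLike.ofReal_re, RCLike.ofReal_im, RCLike.I_re,
      RCLike.mul_im]
    linear_combination b * h2
  rw [h3]
  push_cast
  ring

end Character

/-- The field `K` is identified by `e` with `ℝ` or `ℂ`, compatibly with its module and its
Schwartz--Bruhat functions. -/
structure IsArchimedean {K : Type*} [Field K] [TopologicalSpace K] [IsTopologicalRing K]
    [LocallyCompactSpace K] {𝕜 : Type*} [RCLike 𝕜] (e : K ≃+* 𝕜) : Prop where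
  continuous : Continuous e
  continuous_symm : Continuous e.symm
  exists_nabs_eq : ∃ d : ℕ, (d = 1 ∨ d = 2) ∧ ∀ x, nabs x = ‖e x‖ ^ d
  isSchwartzBruhat_iff (α : K → ℂ) :
    IsSchwartzBruhat α ↔ ∃ f : 𝓢(𝕜, ℂ), ∀ x, α x = f (e x)

/-! ### Archimedean fields: verification of the analytic facts -/

namespace IsArchimedean

variable {K : Type*} [Field K] [TopologicalSpace K] [IsTopologicalRing K] [LocallyCompactSpace K]
  {𝕜 : Type*} [RCLike 𝕜] {e : K ≃+* 𝕜} (he : IsArchimedean e)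

include he

/-- The homeomorphism underlying the identification. -/
def homeomorph : K ≃ₜ 𝕜 where
  toEquiv := e.toEquiv
  continuous_toFun := he.continuous
  continuous_invFun := he.continuous_symm

lemma exists_bound {α : K → ℂ} (hα : IsSchwartzBruhat α) : ∃ C : ℝ, 0 ≤ C ∧
    ∀ t x : K, nabs t ≤ 1 → ‖α x‖ ≤ C * ((1 + nabs x) ^ 2)⁻¹ ∧
      ‖α (x + t) - α x‖ ≤ C * √(nabs t) * ((1 + nabs x) ^ 2)⁻¹ ∧
      ‖α (x + t) - 2 * α x + α (x - t)‖ ≤ C * nabs t * ((1 + nabs x) ^ 2)⁻¹ := by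
  obtain ⟨f, hf⟩ := (he.isSchwartzBruhat_iff α).1 hα
  obtain ⟨d, hd, hn⟩ := he.exists_nabs_eq
  obtain ⟨C₀, hC₀, h0⟩ := exists_norm_schwartz_le f
  obtain ⟨C₁, hC₁, h1⟩ := exists_norm_schwartz_diff_le f
  obtain ⟨C₂, hC₂, h2⟩ := exists_norm_schwartz_second_diff_le f
  -- The fourth power is needed on ℂ, where the module is the square of the norm.
  have hw : ∀ x : K, ((1 + ‖e x‖) ^ 4)⁻¹ ≤ ((1 + nabs x) ^ 2)⁻¹ := by
    intro x
    have hx := norm_nonneg (e x)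
    have hnx := nabs_nonneg x
    refine inv_anti₀ (by positivity) ?_
    rw [show (1 + ‖e x‖) ^ 4 = ((1 + ‖e x‖) ^ 2) ^ 2 by ring]
    gcongr
    rw [hn]
    rcases hd with rfl | rfl <;> nlinarith
  have hd0 : d ≠ 0 := by rcases hd with rfl | rfl <;> norm_num
  refine ⟨C₀ + C₁ + C₂, by positivity, fun t x ht => ?_⟩
  have hnt := nabs_nonneg t
  have ht' : ‖e t‖ ≤ 1 := by
    rw [hn] at ht
    exact (pow_le_one_iff_of_nonneg (norm_nonneg _) hd0).1 ht
  have hsq : ‖e t‖ ^ 2 ≤ nabs t := by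
    rw [hn]
    exact pow_le_pow_of_le_one (norm_nonneg _) ht' (by rcases hd with rfl | rfl <;> norm_num)
  have hsqrt : ‖e t‖ ≤ √(nabs t) := Real.le_sqrt_of_sq_le hsq
  simp only [hf, map_add, map_sub]
  have hwx := hw x
  set w := ((1 + nabs x) ^ 2)⁻¹
  have hw0 : 0 ≤ ((1 + ‖e x‖) ^ 4)⁻¹ := by positivity
  have hw1 : 0 ≤ w := hw0.trans hwx
  refine ⟨(h0 _).trans ?_, (h1 _ _ ht').trans ?_, ?_⟩
  · gcongr
    linarith
  · gcongr
    linarith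
  · have := h2 (e x) (e t) ht'
    rw [Complex.real_smul, Complex.ofReal_ofNat] at this
    refine this.trans ?_
    gcongr
    linarith

lemma comp_real_linear {α : K → ℂ} (hα : IsSchwartzBruhat α) (L : 𝕜 ≃L[ℝ] 𝕜) {β : K → ℂ}
    (hβ : ∀ x, β x = α (e.symm (L (e x)))) : IsSchwartzBruhat β := by
  obtain ⟨f, hf⟩ := (he.isSchwartzBruhat_iff α).1 hα
  refine (he.isSchwartzBruhat_iff β).2
    ⟨SchwartzMap.compCLMOfContinuousLinearEquiv ℝ L f, fun x => ?_⟩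
  rw [hβ, hf, e.apply_symm_apply]
  rfl

lemma exists_bump {U : Set K} (hU : U ∈ 𝓝 (1 : K)) : ∃ f : K → ℝ, Continuous f ∧
    HasCompactSupport f ∧ (∀ x, 0 ≤ f x) ∧ f 1 ≠ 0 ∧ Function.support f ⊆ U ∧
    IsSchwartzBruhat fun x => (f x : ℂ) := by
  have hU' : e.symm ⁻¹' U ∈ 𝓝 (1 : 𝕜) :=
    he.continuous_symm.continuousAt.preimage_mem_nhds (by rwa [map_one])
  obtain ⟨r, hr, h⟩ := Metric.mem_nhds_iff.1 hU'
  let η : ContDiffBump (1 : 𝕜) := ⟨r / 2, r, half_pos hr, half_lt_self hr⟩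
  refine ⟨fun x => η (e x), η.continuous.comp he.continuous,
    η.hasCompactSupport.comp_homeomorph he.homeomorph, fun x => η.nonneg, ?_, ?_, ?_⟩
  · have h1 : η (1 : 𝕜) = 1 := η.one_of_mem_closedBall (by simpa using (half_pos hr).le)
    simp only [map_one, h1]
    exact one_ne_zero
  · intro x hx
    have h1 : e x ∈ Function.support η := hx
    rw [η.support_eq] at h1
    have h2 := h h1
    simpa using h2
  · have hs : HasCompactSupport fun z : 𝕜 => (η z : ℂ) :=
      η.hasCompactSupport.comp_left Complex.ofReal_zero
    have hc : ContDiff ℝ ∞ fun z : 𝕜 => (η z : ℂ) := Complex.ofRealCLM.contDiff.comp η.contDiff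
    exact (he.isSchwartzBruhat_iff _).2 ⟨hs.toSchwartzMap hc, fun x => rfl⟩

lemma isPuncturedTest_opA {α : K → ℂ} (hα : IsPuncturedTest α) : IsPuncturedTest (opA α) := by
  obtain ⟨hα, h0⟩ := hα
  obtain ⟨f, hf⟩ := (he.isSchwartzBruhat_iff α).1 hα
  obtain ⟨d, -, hn⟩ := he.exists_nabs_eq
  have h0' : ∀ᶠ z in 𝓝 (0 : 𝕜), f z = 0 := by
    have h1 : Tendsto e.symm (𝓝 (0 : 𝕜)) (𝓝 (0 : K)) := by
      simpa using he.continuous_symm.tendsto (0 : 𝕜)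
    filter_upwards [h1.eventually h0] with z hz
    rwa [hf, e.apply_symm_apply] at hz
  obtain ⟨g, hg⟩ := exists_schwartz_log_mul f h0' d
  refine ⟨(he.isSchwartzBruhat_iff _).2 ⟨g, fun x => ?_⟩, h0.mono fun y hy => by simp [opA, hy]⟩
  rw [hg, opA, hn, hf]

theorem localAnalysis : LocalAnalysis K where
  toT2Space := he.homeomorph.symm.t2Space
  toSecondCountableTopology := he.homeomorph.secondCountableTopology
  toContinuousInv₀ := by
    refine ⟨fun x hx => ?_⟩
    have h1 : (Inv.inv : K → K) = fun x => e.symm (e x)⁻¹ := by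
      funext x
      rw [map_inv₀, e.symm_apply_apply]
    rw [h1]
    exact he.continuous_symm.continuousAt.comp
      (he.continuous.continuousAt.inv₀ (by simpa using hx))
  continuous_nabs := by
    obtain ⟨d, -, hn⟩ := he.exists_nabs_eq
    exact (he.continuous.norm.pow d).congr fun x => (hn x).symm
  sqrt_nabs_add_le a b := by
    obtain ⟨d, hd, hn⟩ := he.exists_nabs_eq
    have h := norm_add_le (e a) (e b)
    have ha := norm_nonneg (e a)
    have hb := norm_nonneg (e b)
    rw [hn, hn, hn, map_add]
    rcases hd with rfl | rfl
    · simp only [pow_one]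
      refine Real.sqrt_le_iff.2 ⟨by positivity, ?_⟩
      nlinarith [Real.sq_sqrt ha, Real.sq_sqrt hb, Real.sqrt_nonneg ‖e a‖, Real.sqrt_nonneg ‖e b‖,
        mul_nonneg (Real.sqrt_nonneg ‖e a‖) (Real.sqrt_nonneg ‖e b‖)]
    · rwa [Real.sqrt_sq (norm_nonneg _), Real.sqrt_sq ha, Real.sqrt_sq hb]
  exists_nabs_lt_one := by
    obtain ⟨d, hd, hn⟩ := he.exists_nabs_eq
    refine ⟨e.symm 2⁻¹, by simp, ?_⟩
    rw [hn, e.apply_symm_apply, norm_inv, RCLike.norm_ofNat]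
    rcases hd with rfl | rfl <;> norm_num
  isCompact_nabs_le_one := by
    obtain ⟨d, hd, hn⟩ := he.exists_nabs_eq
    have hd0 : d ≠ 0 := by rcases hd with rfl | rfl <;> norm_num
    have h := (isCompact_closedBall (0 : 𝕜) 1).image he.continuous_symm
    convert h using 1
    ext x
    simp only [Set.mem_ofPred_eq, Set.mem_image, mem_closedBall_zero_iff]
    rw [hn, pow_le_one_iff_of_nonneg (norm_nonneg _) hd0]
    constructor
    · exact fun hx => ⟨e x, hx, e.symm_apply_apply x⟩
    · rintro ⟨z, hz, rfl⟩
      rwa [e.apply_symm_apply]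
  continuous_of_isSchwartzBruhat {α} hα := by
    obtain ⟨f, hf⟩ := (he.isSchwartzBruhat_iff α).1 hα
    exact (f.continuous.comp he.continuous).congr fun x => (hf x).symm
  isSchwartzBruhat_comp_neg hα :=
    he.comp_real_linear hα (ContinuousLinearEquiv.neg ℝ) fun x => by simp
  exists_bound hα := he.exists_bound hα
  exists_bump hU := he.exists_bump hU
  isPuncturedTest_opA hα := he.isPuncturedTest_opA hα

variable [MeasurableSpace K] [BorelSpace K] (μ : Measure K) [μ.IsAddHaarMeasure]

theorem isSchwartzBruhat_fourierTr {lam : AddChar K Circle} (hlam : Continuous lam)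
    (hlam1 : ∃ x, lam x ≠ 1) {α : K → ℂ} (hα : IsSchwartzBruhat α) :
    IsSchwartzBruhat (fourierTr lam μ α) := by
  borelize 𝕜
  obtain ⟨f, hf⟩ := (he.isSchwartzBruhat_iff α).1 hα
  obtain ⟨w, hw⟩ := exists_addChar_rclike_eq (𝕜 := 𝕜)
    (lam := lam.compAddMonoidHom e.symm.toAddMonoidHom) (hlam.comp he.continuous_symm)
  have hw' : ∀ x, (lam x : ℂ) =
      Complex.exp ((2 * Real.pi * RCLike.re (w * e x) : ℝ) * Complex.I) := by
    intro x
    rw [← hw (e x)]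
    exact congrArg (fun y => (lam y : ℂ)) (e.symm_apply_apply x).symm
  have hw0 : w ≠ 0 := by
    rintro rfl
    obtain ⟨x, hx⟩ := hlam1
    apply hx
    apply Circle.ext
    rw [hw']
    simp
  have hν : (μ.map e).IsAddHaarMeasure :=
    e.toAddEquiv.isAddHaarMeasure_map μ he.continuous he.continuous_symm
  set c := (μ.map e).addHaarScalarFactor (volume : Measure 𝕜)
  have hνc : μ.map e = c • (volume : Measure 𝕜) :=
    Measure.isAddLeftInvariant_eq_smul _ _
  -- The real inner product of z with conj(xw) is Re(wxz), so composing the standard Fourier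
  -- transform with L gives the transform attached to λ, up to the Haar scalar c.
  let L : 𝕜 ≃L[ℝ] 𝕜 :=
    ((ContinuousLinearEquiv.unitsEquivAut 𝕜 (Units.mk0 w hw0)).restrictScalars ℝ).trans
      RCLike.conjCLE
  have hL : ∀ z, L z = (starRingEnd 𝕜) (z * w) := fun z => rfl
  refine (he.isSchwartzBruhat_iff _).2 ⟨(c : ℂ) •
    SchwartzMap.compCLMOfContinuousLinearEquiv ℝ L (𝓕 f), fun x => ?_⟩
  have h1 : fourierTr lam μ α x = ∫ z, f z *
      Complex.exp ((2 * Real.pi * RCLike.re (w * -(e x * z)) : ℝ) * Complex.I) ∂(μ.map e) := by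
    have hme : MeasurableEmbedding e := he.homeomorph.measurableEmbedding
    rw [hme.integral_map]
    refine integral_congr_ae (ae_of_all _ fun y => ?_)
    simp only [hw', hf, map_neg, map_mul]
  rw [h1, hνc, integral_smul_nnreal_measure]
  simp only [_root_.smul_apply, SchwartzMap.compCLMOfContinuousLinearEquiv_apply,
    Function.comp_apply, SchwartzMap.fourier_coe, Real.fourier_eq]
  rw [NNReal.smul_def, Complex.real_smul, smul_eq_mul]
  congr 1
  refine integral_congr_ae (ae_of_all _ fun z => ?_)
  have h2 : inner ℝ z (L (e x)) = RCLike.re (w * (e x * z)) := by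
    rw [real_inner_eq_re_inner 𝕜, RCLike.inner_apply, hL, ← map_mul, RCLike.conj_re]
    congr 1
    ring
  simp only [Circle.smul_def, Real.fourierChar_apply, smul_eq_mul, h2]
  rw [mul_comm]
  congr 3
  simp

end IsArchimedean

/-! ### Identification of the archimedean cases and assembly for all local fields -/

section

variable {K : Type*} [Field K] [TopologicalSpace K]

lemma eq_zero_of_isLocallyConstant_of_hasCompactSupport {𝕜 : Type*} [RCLike 𝕜] (e : K ≃+* 𝕜)
    (he : Continuous e.symm) {α : K → ℂ} (hα : IsLocallyConstant α)
    (hs : HasCompactSupport α) (he' : Continuous e) (x : K) : α x = 0 := by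
  let h : 𝕜 ≃ₜ K := ⟨e.symm.toEquiv, he, he'⟩
  have h1 : IsLocallyConstant (α ∘ h) := hα.comp_continuous h.continuous
  have h2 : HasCompactSupport (α ∘ h) := hs.comp_homeomorph h
  have h3 : ∃ z, (α ∘ h) z = 0 := by
    by_contra! hne
    have h4 : Function.support (α ∘ h) = Set.univ := Set.eq_univ_of_forall hne
    rw [HasCompactSupport, tsupport, h4, closure_univ] at h2
    exact noncompact_univ 𝕜 h2
  obtain ⟨z, hz⟩ := h3
  have h5 := h1.apply_eq_of_preconnectedSpace (e x) z
  rw [hz] at h5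
  simpa [h] using h5

lemma isEmpty_ringEquiv_real_complex (e : K ≃+* ℝ) (e' : K ≃+* ℂ) : False := by
  have h : (e (e'.symm Complex.I)) * e (e'.symm Complex.I) = -1 := by
    rw [← map_mul, ← map_mul, Complex.I_mul_I]
    simp
  nlinarith [mul_self_nonneg (e (e'.symm Complex.I))]

lemma isSchwartzBruhat_iff_of_real (e : K ≃+* ℝ) (he : Continuous e) (he' : Continuous e.symm)
    (α : K → ℂ) : IsSchwartzBruhat α ↔ ∃ f : 𝓢(ℝ, ℂ), ∀ x, α x = f (e x) := by
  constructor
  · rintro (⟨e', -, -, f, hf⟩ | ⟨e', -⟩ | ⟨h, hs⟩)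
    · refine ⟨f, fun x => ?_⟩
      have h : (e.symm.trans e' : ℝ →+* ℝ) = RingHom.id ℝ := Subsingleton.elim _ _
      have h' : e' (e.symm (e x)) = e x := RingHom.congr_fun h (e x)
      rw [hf, ← h', e.symm_apply_apply]
    · exact (isEmpty_ringEquiv_real_complex e e').elim
    · exact ⟨0, fun x => eq_zero_of_isLocallyConstant_of_hasCompactSupport e he' h hs he x⟩
  · rintro ⟨f, hf⟩
    exact Or.inl ⟨e, he, he', f, hf⟩

/-- Two continuous identifications with ℂ differ by the identity or conjugation, and conjugation
preserves Schwartz functions. The locally constant alternative yields only 0. -/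
lemma isSchwartzBruhat_iff_of_complex (e : K ≃+* ℂ) (he : Continuous e)
    (he' : Continuous e.symm) (α : K → ℂ) :
    IsSchwartzBruhat α ↔ ∃ f : 𝓢(ℂ, ℂ), ∀ x, α x = f (e x) := by
  constructor
  · rintro (⟨e', -⟩ | ⟨e', hc, -, f, hf⟩ | ⟨h, hs⟩)
    · exact (isEmpty_ringEquiv_real_complex e' e).elim
    · have h : Continuous (e.symm.trans e' : ℂ →+* ℂ) := hc.comp he'
      rcases Complex.ringHom_eq_id_or_conj_of_continuous h with h | h
      · refine ⟨f, fun x => ?_⟩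
        have h' : e' x = e x := by simpa using RingHom.congr_fun h (e x)
        rw [hf, h']
      · refine ⟨SchwartzMap.compCLMOfContinuousLinearEquiv ℝ Complex.conjCLE f, fun x => ?_⟩
        have h' : e' x = (starRingEnd ℂ) (e x) := by simpa using RingHom.congr_fun h (e x)
        rw [hf, h']
        rfl
    · exact ⟨0, fun x => eq_zero_of_isLocallyConstant_of_hasCompactSupport e he' h hs he x⟩
  · rintro ⟨f, hf⟩
    exact Or.inr (Or.inl ⟨e, he, he', f, hf⟩)

variable [IsTopologicalRing K] [LocallyCompactSpace K]

/-- Multiplication by e x is ℝ-linear with determinant its algebra norm, and Lebesgue measure of the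
unit ball scales by the absolute value of the determinant. -/
lemma nabs_eq_abs_norm {𝕜 : Type*} [RCLike 𝕜] (e : K ≃+* 𝕜) (he : Continuous e)
    (he' : Continuous e.symm) (x : K) : nabs x = |Algebra.norm ℝ (e x)| := by
  by_cases hx : x = 0
  · subst hx
    simp [nabs_zero, Algebra.norm_zero]
  borelize K
  borelize 𝕜
  let h : 𝕜 ≃ₜ K := ⟨e.symm.toEquiv, he', he⟩
  let μ : Measure K := (volume : Measure 𝕜).map h
  have hμ : μ.IsAddHaarMeasure :=
    e.symm.toAddEquiv.isAddHaarMeasure_map volume he' he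
  have hr : μ.Regular := Measure.Regular.map h
  have key (s : Set K) : μ s = volume (h ⁻¹' s) := h.measurableEmbedding.map_apply _ _
  set s : Set K := h '' Metric.ball 0 1
  have hs : μ s = volume (Metric.ball (0 : 𝕜) 1) := by
    rw [key, h.preimage_image]
  have hs' : h ⁻¹' (Units.mk0 x hx • s) =
      LinearMap.mulLeft ℝ (e x) '' Metric.ball (0 : 𝕜) 1 := by
    ext z
    simp only [s, Set.mem_preimage, Set.mem_smul_set, Set.mem_image, exists_exists_and_eq_and,
      LinearMap.mulLeft_apply]
    refine exists_congr fun w => and_congr_right fun _ => ?_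
    rw [Units.smul_def, Units.val_mk0, smul_eq_mul]
    change x * e.symm w = e.symm z ↔ _
    rw [← e.injective.eq_iff, map_mul, e.apply_symm_apply, e.apply_symm_apply]
  have h1 : μ (Units.mk0 x hx • s) =
      (ENNReal.ofNNReal ⟨|Algebra.norm ℝ (e x)|, abs_nonneg _⟩) * μ s := by
    rw [key, hs', Measure.addHaar_image_linearMap, hs, ENNReal.ofReal_eq_coe_nnreal (abs_nonneg _)]
    rfl
  rw [nabs_of_ne_zero hx, distribHaarChar_eq_of_measure_smul_eq_mul
    (hs ▸ (Metric.measure_ball_pos _ _ one_pos).ne') (hs ▸ measure_ball_lt_top.ne) h1]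
  rfl

theorem isArchimedean_of_real (e : K ≃+* ℝ) (he : Continuous e) (he' : Continuous e.symm) :
    IsArchimedean e where
  continuous := he
  continuous_symm := he'
  exists_nabs_eq := ⟨1, Or.inl rfl, fun x => by
    rw [nabs_eq_abs_norm e he he', Algebra.norm_self, pow_one]
    rfl⟩
  isSchwartzBruhat_iff := isSchwartzBruhat_iff_of_real e he he'

theorem isArchimedean_of_complex (e : K ≃+* ℂ) (he : Continuous e) (he' : Continuous e.symm) :
    IsArchimedean e where
  continuous := he
  continuous_symm := he'
  exists_nabs_eq := ⟨2, Or.inr rfl, fun x => by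
    rw [nabs_eq_abs_norm e he he']
    have h := Algebra.norm_complex_apply (e x)
    rw [Complex.normSq_eq_norm_sq] at h
    exact (congrArg abs h).trans (abs_of_nonneg (by positivity))⟩
  isSchwartzBruhat_iff := isSchwartzBruhat_iff_of_complex e he he'

theorem IsLocalField.localAnalysis (hK : IsLocalField K) : LocalAnalysis K := by
  obtain ⟨e, he, he'⟩ | ⟨e, he, he'⟩ | ⟨v, hv⟩ := hK
  · exact (isArchimedean_of_real e he he').localAnalysis
  · exact (isArchimedean_of_complex e he he').localAnalysis
  · let _ := v
    exact (IsUltrametric.of_isNonarchimedeanLocalField K).localAnalysis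

theorem IsLocalField.isSchwartzBruhat_fourierTr (hK : IsLocalField K) [MeasurableSpace K]
    [BorelSpace K] (μ : Measure K) [μ.IsAddHaarMeasure] {lam : AddChar K Circle}
    (hlam : Continuous lam) (hlam1 : ∃ x, lam x ≠ 1) {α : K → ℂ} (hα : IsSchwartzBruhat α) :
    IsSchwartzBruhat (fourierTr lam μ α) := by
  obtain ⟨e, he, he'⟩ | ⟨e, he, he'⟩ | ⟨v, hv⟩ := hK
  · exact (isArchimedean_of_real e he he').isSchwartzBruhat_fourierTr μ hlam hlam1 hα
  · exact (isArchimedean_of_complex e he he').isSchwartzBruhat_fourierTr μ hlam hlam1 hα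
  · let _ := v
    exact (IsUltrametric.of_isNonarchimedeanLocalField K).isSchwartzBruhat_fourierTr μ hlam hlam1 hα

end

end LocalCommutator

open LocalCommutator in
theorem mainTheorem1 {K : Type*} [Field K] [TopologicalSpace K] [IsTopologicalRing K]
    [LocallyCompactSpace K] [MeasurableSpace K] [BorelSpace K] (hK : IsLocalField K)
    (lam : AddChar K Circle) (hlam : Continuous lam) (hlam1 : ∃ x, lam x ≠ 1)
    (μ : Measure K) [μ.IsAddHaarMeasure] (hμ : IsSelfDual lam μ) (χ : Kˣ →ₜ* Circle) :
    -- the operators are well defined on test functions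
    (∀ α : K → ℂ, IsSchwartzBruhat α →
      Integrable α μ ∧ Integrable (opA (fourierTr lam μ α)) μ) ∧
    (∀ α : K → ℂ, IsPuncturedTest α → IsPuncturedTest (opA α)) ∧
    -- the gamma factor exists, is unique, holomorphic and non-vanishing in the critical strip
    (∀ s ∈ criticalStrip, ∀ g : ℂ, IsGammaFactor lam μ χ s g ↔ g = gammaFactor lam μ χ s) ∧
    DifferentiableOn ℂ (gammaFactor lam μ χ) criticalStrip ∧
    (∀ s ∈ criticalStrip, gammaFactor lam μ χ s ≠ 0) ∧
    -- the transpose of `H` is `H` on the whole line, that of `K` is `-K` on the punctured line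
    HasTranspose μ IsSchwartzBruhat (opH lam μ) (opH lam μ) ∧
    HasTranspose μ IsPuncturedTest (opK lam μ) (fun α => -opK lam μ α) ∧
    -- the spectral identities for `H` and `K`
    ∀ s ∈ criticalStrip,
      IsDistributionEigenfunction μ IsSchwartzBruhat (opH lam μ)
        (quasiChar χ⁻¹ (-s)) (logDeriv (gammaFactor lam μ χ) s) ∧
      IsDistributionEigenfunction μ IsPuncturedTest (fun α => -opK lam μ α)
        (quasiChar χ⁻¹ (-s)) (-Complex.I * deriv (logDeriv (gammaFactor lam μ χ)) s) := by
  have hL : LocalAnalysis K := IsLocalField.localAnalysis hK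
  have hP : IsFourierPair lam μ :=
    ⟨hlam, hlam1, hμ, fun α hα => IsLocalField.isSchwartzBruhat_fourierTr hK μ hlam hlam1 hα⟩
  exact ⟨fun α hα => ⟨integrable_of_isSchwartzBruhat hα,
      integrable_opA_of_isSchwartzBruhat (hP.isSchwartzBruhat α hα)⟩,
    fun α hα => LocalAnalysis.isPuncturedTest_opA hα,
    fun s hs g => isGammaFactor_iff hP χ hs g,
    fun s hs => (differentiableAt_gammaFactor hP χ hs).differentiableWithinAt,
    fun s hs => gammaFactor_ne_zero hP χ hs,
    hasTranspose_opH hP, hasTranspose_opK hP,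
    fun s hs => ⟨isDistributionEigenfunction_opH hP χ hs,
      isDistributionEigenfunction_opK hP χ hs⟩⟩
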